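/- A noncompact metric graph $\mathcal G$ is a connected metric space obtained by gluing together, at some of their endpoints, finitely many closed intervals according to the topology of a graph (self-loops and multiple edges allowed): bounded edges $[0,\ell_e]$ with $\ell_e>0$, and at least one half-line $[0,+\infty)$; the distance is the shortest-path distance. $H^1(\mathcal G)$ is the space of (real or complex valued) continuous functions on $\mathcal G$ whose restriction to each edge $I$ belongs to $H^1(I)$. For $u\in H^1(\mathcal G)$ and $\mu\ge 0$ put $$E(u,\mathcal G)=\tfrac12\|u'\|_{L^2(\mathcal G)}^2-\tfrac16\|u\|_{L^6(\mathcal G)}^6,\qquad H^1_\mu(\mathcal G)=\{u\in H^1(\mathcal G):\|u\|_{L^2(\mathcal G)}^2=\mu\},$$ $$\mathcal E_{\mathcal G}(\mu)=\inf_{u\in H^1_\mu(\mathcal G)}E(u,\mathcal G)\in[-\infty,+\infty),\qquad K_{\mathcal G}=\sup_{u\in H^1(\mathcal G),\,u\not\equiv0}\frac{\|u\|_{L^6(\mathcal G)}^6}{\|u\|_{L^2(\mathcal G)}^4\,\|u'\|_{L^2(\mathcal G)}^2},\qquad \mu_{\mathcal G}=\sqrt{3/K_{\mathcal G}}.$$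 The number $\mu_{\mathcal G}$ is the critical mass of $\mathcal G$; $\mu_{\mathbb R^+}$ and $\mu_{\mathbb R}$ are the critical masses of the half-line $\mathbb R^+=[0,+\infty)$ and of the line $\mathbb R$ (two half-lines glued at their origins). A terminal point (tip) of $\mathcal G$ is a point of $\mathcal G$ corresponding to a vertex of degree one (a self-loop counts twice in the degree; the points at infinity of the half-lines are not points of $\mathcal G$). **Theorem (graphs with a tip).** Let $\mathcal G$ be a noncompact metric graph having at least one terminal point. Then $\mu_{\mathcal G}=\mu_{\mathbb R^+}$. When $\mu\in(\mu_{\mathbb R^+},\mu_{\mathbb R}]$, $\mathcal E_{\mathcal G}(\mu)=-\infty$. When $\mu=\mu_{\mathbb R^+}$, $\mathcal E_{\mathcal G}(\mu)=0$, and this infimum is attained by some $u\in H^1_\mu(\mathcal G)$ if and only if $\mathcal G$ is isometric to the half-line $[0,+\infty)$. -/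

import Mathlib

open MeasureTheory
open scoped ENNReal NNReal

/-- Combinatorial data of a connected metric graph with vertex set `V`, bounded edges `E` and
half-lines `H`. The edge `e` is a copy of `[0, len e]` whose endpoint `0` is attached at `src e` and
whose endpoint `len e` is attached at `tgt e`; the half-line `h` is a copy of `[0, ∞)` whose
origin is attached at `origin h`. Self-loops and multiple edges are allowed. -/
structure MetricGraph (V E H : Type*) where
  src : E → V
  tgt : E → V
  origin : H → V
  len : E → ℝ
  len_pos : ∀ e, 0 < len e
  /-- Any two vertices are joined by a finite path of bounded edges. -/
  connected : ∀ v w, Relation.EqvGen (fun a b => ∃ e, src e = a ∧ tgt e = b) v w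

namespace MetricGraph

variable {V E H : Type*} (G : MetricGraph V E H)

/-- The parameter interval of an edge: `[0, len e]` or `[0, ∞)`. -/
def interval : E ⊕ H → Set ℝ
  | Sum.inl e => Set.Icc 0 (G.len e)
  | Sum.inr _ => Set.Ici 0

/-- The disjoint union of the closed edges, before gluing. -/
structure Pt where
  edge : E ⊕ H
  coord : ℝ
  mem : coord ∈ G.interval edge

/-- The endpoint relation: the point `x` of the edge `i` is an endpoint attached at `v`. -/
def EndAt (i : E ⊕ H) (x : ℝ) (v : V) : Prop :=
  match i with
  | Sum.inl e => (x = 0 ∧ G.src e = v) ∨ (x = G.len e ∧ G.tgt e = v)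
  | Sum.inr h => x = 0 ∧ G.origin h = v

/-- `G.Joined p q r`: some path in the graph from `p` to `q` has length `r`. A path runs
along edges and passes freely between endpoints attached at the same vertex. -/
inductive Joined : G.Pt → G.Pt → ℝ≥0 → Prop
  | along (p q : G.Pt) (h : p.edge = q.edge) : Joined p q (nndist p.coord q.coord)
  | glue (p q : G.Pt) (v : V) (hp : G.EndAt p.edge p.coord v) (hq : G.EndAt q.edge q.coord v) :
      Joined p q 0
  | trans (p q s : G.Pt) (r t : ℝ≥0) : Joined p q r → Joined q s t → Joined p s (r + t)

variable {G} in
theorem Joined.symm {p q : G.Pt} {r : ℝ≥0} (h : G.Joined p q r) : G.Joined q p r := by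
  induction h with
  | along p q h => rw [nndist_comm]; exact Joined.along q p h.symm
  | glue p q v hp hq => exact Joined.glue q p v hq hp
  | trans p q s r t _ _ h1 h2 => rw [add_comm]; exact Joined.trans _ _ _ _ _ h2 h1

/-- The shortest-path (pseudo-)distance on the disjoint union of the edges. -/
noncomputable instance : PseudoEMetricSpace G.Pt where
  edist p q := ⨅ (r : ℝ≥0) (_ : G.Joined p q r), (r : ℝ≥0∞)
  edist_self p := by
    refine le_antisymm ?_ zero_le
    have h : G.Joined p p 0 := by
      have := Joined.along p p rfl
      rwa [nndist_self] at this
    exact (iInf₂_le (0 : ℝ≥0) h).trans (by simp)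
  edist_comm p q := by
    apply le_antisymm <;>
    exact le_iInf₂ fun r h => iInf₂_le r h.symm
  edist_triangle p q s := by
    rw [ENNReal.iInf_add]
    refine le_iInf fun r => ?_
    rw [ENNReal.iInf_add]
    refine le_iInf fun hr => ?_
    rw [ENNReal.add_iInf]
    refine le_iInf fun t => ?_
    rw [ENNReal.add_iInf]
    refine le_iInf fun ht => ?_
    exact (iInf₂_le (r + t) (Joined.trans _ _ _ _ _ hr ht)).trans (by simp)

/-- The metric graph as a metric space: the edges glued at the vertices (points at
shortest-path distance zero are identified), with the shortest-path distance. -/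
abbrev Space : Type _ := SeparationQuotient G.Pt

/-- The nearest-point projection of `ℝ` onto the parameter interval of an edge. -/
noncomputable def clamp : E ⊕ H → ℝ → ℝ
  | Sum.inl e, x => max 0 (min x (G.len e))
  | Sum.inr _, x => max 0 x

theorem clamp_mem (i : E ⊕ H) (x : ℝ) : G.clamp i x ∈ G.interval i := by
  rcases i with e | h
  · exact ⟨le_max_left _ _, max_le (G.len_pos e).le (min_le_right _ _)⟩
  · exact le_max_left (0 : ℝ) x

/-- The parametrization of an edge by its interval (constant on either side of the interval). -/
noncomputable def chart (i : E ⊕ H) (x : ℝ) : G.Space :=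
  SeparationQuotient.mk ⟨i, G.clamp i x, G.clamp_mem i x⟩

/-- The degree of a vertex; a self-loop counts twice. -/
noncomputable def degree (v : V) : ℕ :=
  Nat.card {e // G.src e = v} + Nat.card {e // G.tgt e = v} + Nat.card {h // G.origin h = v}

/-- The graph has a terminal point (a tip): a vertex of degree one. -/
def HasTip : Prop := ∃ v, G.degree v = 1

section Functions

variable {𝕜 : Type*} [RCLike 𝕜] [Fintype E] [Fintype H]

/-- The Sobolev space `H¹(G)`: continuous functions on `G` whose restriction to every edge is
(locally) absolutely continuous and, together with its derivative, square integrable. -/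
def H1 (𝕜 : Type*) [RCLike 𝕜] : Set (G.Space → 𝕜) :=
  {u | Continuous u ∧ ∀ i : E ⊕ H,
    (∀ a ∈ G.interval i, ∀ b ∈ G.interval i,
      AbsolutelyContinuousOnInterval (fun x => u (G.chart i x)) a b) ∧
    MemLp (fun x => u (G.chart i x)) 2 (volume.restrict (G.interval i)) ∧
    MemLp (deriv fun x => u (G.chart i x)) 2 (volume.restrict (G.interval i))}

/-- `∫_G |u|^p`. -/
noncomputable def normPow (p : ℕ) (u : G.Space → 𝕜) : ℝ :=
  ∑ i : E ⊕ H, ∫ x in G.interval i, ‖u (G.chart i x)‖ ^ p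

/-- `∫_G |u'|²`. -/
noncomputable def kinetic (u : G.Space → 𝕜) : ℝ :=
  ∑ i : E ⊕ H, ∫ x in G.interval i, ‖deriv (fun y => u (G.chart i y)) x‖ ^ 2

/-- The critical NLS energy. -/
noncomputable def energy (u : G.Space → 𝕜) : ℝ :=
  1 / 2 * G.kinetic u - 1 / 6 * G.normPow 6 u

/-- The functions in `H¹(G)` of mass `μ`. -/
def H1Mass (𝕜 : Type*) [RCLike 𝕜] (μ : ℝ) : Set (G.Space → 𝕜) :=
  {u | u ∈ G.H1 𝕜 ∧ G.normPow 2 u = μ}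

/-- The ground-state energy level, possibly `-∞`. -/
noncomputable def energyLevel (𝕜 : Type*) [RCLike 𝕜] (μ : ℝ) : EReal :=
  ⨅ u ∈ G.H1Mass 𝕜 μ, (G.energy u : EReal)

/-- The best constant in `‖u‖₆⁶ ≤ K ‖u‖₂⁴ ‖u'‖₂²` on `H¹(G)`. -/
noncomputable def gnConstant (𝕜 : Type*) [RCLike 𝕜] : ℝ≥0∞ :=
  ⨆ u ∈ {u | u ∈ G.H1 𝕜 ∧ u ≠ 0},
    ENNReal.ofReal (G.normPow 6 u / (G.normPow 2 u ^ 2 * G.kinetic u))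

/-- The critical mass `√(3 / K_G)`. -/
noncomputable def criticalMass (𝕜 : Type*) [RCLike 𝕜] : ℝ :=
  √(3 / G.gnConstant 𝕜).toReal

end Functions

/-- The half-line `[0, ∞)`: one half-line attached at one vertex. -/
def halfLine : MetricGraph Unit Empty Unit where
  src := Empty.elim
  tgt := Empty.elim
  origin := id
  len := Empty.elim
  len_pos := fun e => e.elim
  connected := fun v _ => Relation.EqvGen.refl v

/-- The real line: two half-lines attached at one vertex. -/
def realLine : MetricGraph Unit Empty Bool where
  src := Empty.elim
  tgt := Empty.elim
  origin := fun _ => ()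
  len := Empty.elim
  len_pos := fun e => e.elim
  connected := fun v _ => Relation.EqvGen.refl v

/-- The critical mass of the half-line. -/
noncomputable def muHalfLine (𝕜 : Type*) [RCLike 𝕜] : ℝ := halfLine.criticalMass 𝕜

/-- The critical mass of the real line. -/
noncomputable def muRealLine (𝕜 : Type*) [RCLike 𝕜] : ℝ := realLine.criticalMass 𝕜

end MetricGraph

/-! ### The tangent weight and its superadditivity. -/

section Calibration

open Real Set

/-! The core is a sharp inequality on every noncompact graph, `π² ‖u‖₆⁶ ≤ 16 ‖u‖₂⁴ ‖u'‖₂²`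
(`gagliardo_nirenberg`), obtained without rearrangement by a calibration. Along an edge let `M` be
the mass accumulated so far and let `h = tanWeight c`, a solution of `h' = c² + 4h²`. Then `‖u'‖² -
c²‖u‖⁶ + (‖u‖⁴ h(M))'` is the square `‖u' + 2h(M)‖u‖²u‖²`, so `∫‖u'‖² - c²∫‖u‖⁶` is a nonnegative
deficit plus boundary terms (`deficit_eq`).

The boundary terms are matched by letting mass flow along a spanning tree towards the origin of one
half-line: tree edges start with what has reached their tail, all other edges with zero. Since `h`
is superadditive, each vertex contributes a nonnegative term (`gap`), and nothing is left at
infinity. The weight blows up at `π / (4c)`, so every `c` with `c ‖u‖₂² < π/4` is admissible; the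
limit gives the inequality.

At a tip, concentrated truncations of the half-soliton `(cosh x)^(-1/2)` show that `16/π²` is
optimal, so the critical mass is `√3 π / 4` for every graph with a tip, including the half-line.
Above this mass, concentration drives the energy to `-∞`. At this mass the inequality gives
nonnegative energy, and spreading along a half-line gives infimum zero.

If zero is attained, all deficits and gaps vanish in the limit. Vanishing deficits make `‖u‖² /
cos(2cM)` constant, so `u` vanishes nowhere. A second half-line would leave room for a larger `c`,
and two edges entering a vertex would give a strict gap. Hence there is one half-line and `head` is
injective; from the tip this makes the graph a chain, parametrized by arc length. Conversely, an
isometry onto `[0, ∞)` preserves integrals and unsigned derivatives along edges, so the half-soliton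
can be pulled back. -/

/-- The weight `h` solving `h' = c² + 4h²`, `h 0 = 0`. -/
noncomputable def tanWeight (c t : ℝ) : ℝ := c / 2 * tan (2 * c * t)

theorem tanWeight_zero (c : ℝ) : tanWeight c 0 = 0 := by simp [tanWeight]

theorem cos_pos_of_lt {c t : ℝ} (hc : 0 ≤ c) (ht : 0 ≤ t) (h : c * t < π / 4) :
    0 < cos (2 * c * t) :=
  cos_pos_of_mem_Ioo ⟨by nlinarith [pi_pos, mul_nonneg hc ht], by linarith⟩

theorem tanWeight_nonneg {c t : ℝ} (hc : 0 ≤ c) (ht : 0 ≤ t) (h : c * t < π / 4) :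
    0 ≤ tanWeight c t := by
  refine mul_nonneg (by positivity) (tan_nonneg_of_nonneg_of_le_pi_div_two ?_ ?_)
  · positivity
  · linarith

/-- The derivative of the tangent gives `c²(1 + tan²)`, and `c² tan²` is four times the square of
the weight. This Riccati equation is what completes the square in `deficit`. -/
theorem hasDerivAt_tanWeight {c t : ℝ} (hc : 0 ≤ c) (ht : 0 ≤ t) (h : c * t < π / 4) :
    HasDerivAt (tanWeight c) (c ^ 2 + 4 * tanWeight c t ^ 2) t := by
  have hcos := (cos_pos_of_lt hc ht h).ne'
  have h1 := (hasDerivAt_tan hcos).comp t ((hasDerivAt_id t).const_mul (2 * c))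
  refine (h1.const_mul (c / 2)).congr_deriv ?_
  have e : 1 / cos (2 * c * t) ^ 2 = 1 + (sin (2 * c * t) / cos (2 * c * t)) ^ 2 := by
    field_simp
    linear_combination -sin_sq_add_cos_sq (2 * c * t)
  simp only [tanWeight, tan_eq_sin_div_cos, e]
  ring

/-- The addition formula reads `tan (x + y) = tan x + tan y + tan x * tan y * tan (x + y)`, with a
last term that is nonnegative, and positive when both arguments are. -/
theorem tan_add_tan_le {x y : ℝ} (hx : 0 ≤ x) (hy : 0 ≤ y) (h : x + y < π / 2) :
    tan x + tan y ≤ tan (x + y) ∧ (0 < x → 0 < y → tan x + tan y < tan (x + y)) := by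
  have cx : 0 < cos x := cos_pos_of_mem_Ioo ⟨by linarith [pi_pos], by linarith⟩
  have cy : 0 < cos y := cos_pos_of_mem_Ioo ⟨by linarith [pi_pos], by linarith⟩
  have cxy : 0 < cos (x + y) := cos_pos_of_mem_Ioo ⟨by linarith [pi_pos], by linarith⟩
  have tx : 0 ≤ tan x := tan_nonneg_of_nonneg_of_le_pi_div_two hx (by linarith)
  have ty : 0 ≤ tan y := tan_nonneg_of_nonneg_of_le_pi_div_two hy (by linarith)
  have txy : 0 ≤ tan (x + y) := tan_nonneg_of_nonneg_of_le_pi_div_two (by linarith) h.le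
  have key : tan (x + y) = tan x + tan y + tan x * tan y * tan (x + y) := by
    rw [tan_eq_sin_div_cos, tan_eq_sin_div_cos, tan_eq_sin_div_cos]
    have e : cos (x + y) = cos x * cos y - sin x * sin y := cos_add x y
    have e' : sin (x + y) = sin x * cos y + cos x * sin y := sin_add x y
    field_simp
    rw [e']
    linear_combination -(sin x * cos y + cos x * sin y) * e
  constructor
  · rw [key]; nlinarith [mul_nonneg (mul_nonneg tx ty) txy]
  · intro h1 h2
    have := tan_pos_of_pos_of_lt_pi_div_two h1 (by linarith)
    have := tan_pos_of_pos_of_lt_pi_div_two h2 (by linarith)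
    have := tan_pos_of_pos_of_lt_pi_div_two (add_pos h1 h2) h
    rw [key]; nlinarith [mul_pos (mul_pos ‹0 < tan x› ‹0 < tan y›) this]

theorem tanWeight_add_le {c x y : ℝ} (hc : 0 < c) (hx : 0 ≤ x) (hy : 0 ≤ y)
    (h : c * (x + y) < π / 4) : tanWeight c x + tanWeight c y ≤ tanWeight c (x + y) ∧
      (0 < x → 0 < y → tanWeight c x + tanWeight c y < tanWeight c (x + y)) := by
  have e : 2 * c * (x + y) = 2 * c * x + 2 * c * y := by ring
  have := tan_add_tan_le (x := 2 * c * x) (y := 2 * c * y) (by positivity) (by positivity)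
    (by linarith)
  unfold tanWeight
  rw [e, ← mul_add]
  refine ⟨mul_le_mul_of_nonneg_left this.1 (by positivity), fun h1 h2 => ?_⟩
  exact mul_lt_mul_of_pos_left (this.2 (by positivity) (by positivity)) (by positivity)

theorem sum_tanWeight_le {ι : Type*} {c : ℝ} (hc : 0 < c) (s : Finset ι) (x : ι → ℝ)
    (hx : ∀ i, 0 ≤ x i) (h : c * ∑ i ∈ s, x i < π / 4) :
    ∑ i ∈ s, tanWeight c (x i) ≤ tanWeight c (∑ i ∈ s, x i) := by
  classical
  induction s using Finset.induction_on with
  | empty => simp [tanWeight_zero]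
  | insert a s ha ih =>
    rw [Finset.sum_insert ha] at h ⊢
    rw [Finset.sum_insert ha]
    have h0 : 0 ≤ ∑ i ∈ s, x i := Finset.sum_nonneg fun i _ => hx i
    have h1 := ih (by nlinarith [mul_nonneg hc.le (hx a)])
    have h2 := (tanWeight_add_le hc (hx a) h0 h).1
    linarith

/-- Two positive summands make one application of superadditivity strict: split off `i`, and `j`
keeps the remaining sum positive. This detects vertices entered by two edges. -/
theorem sum_tanWeight_lt {ι : Type*} {c : ℝ} (hc : 0 < c) (s : Finset ι) (x : ι → ℝ)
    (hx : ∀ i, 0 ≤ x i) (h : c * ∑ i ∈ s, x i < π / 4) {i j : ι} (hi : i ∈ s) (hj : j ∈ s)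
    (hij : i ≠ j) (xi : 0 < x i) (xj : 0 < x j) :
    ∑ i ∈ s, tanWeight c (x i) < tanWeight c (∑ i ∈ s, x i) := by
  classical
  rw [← Finset.add_sum_erase _ _ hi] at h ⊢
  rw [← Finset.add_sum_erase _ _ hi]
  have hj' : j ∈ s.erase i := Finset.mem_erase.2 ⟨hij.symm, hj⟩
  have h0 : 0 < ∑ k ∈ s.erase i, x k :=
    Finset.sum_pos' (fun k _ => hx k) ⟨j, hj', xj⟩
  have h1 := sum_tanWeight_le hc (s.erase i) x hx (by nlinarith [mul_nonneg hc.le (hx i)])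
  have h2 := (tanWeight_add_le hc (hx i) h0.le h).2 xi h0
  linarith

theorem LipschitzWith.comp_absolutelyContinuousOnInterval {X Y : Type*} [PseudoMetricSpace X]
    [PseudoMetricSpace Y] {g : X → Y} {K : ℝ≥0} (hg : LipschitzWith K g) {f : ℝ → X} {a b : ℝ}
    (hf : AbsolutelyContinuousOnInterval f a b) :
    AbsolutelyContinuousOnInterval (fun x => g (f x)) a b := by
  have := Filter.Tendsto.const_mul (K : ℝ) hf
  rw [mul_zero] at this
  refine squeeze_zero (fun t => Finset.sum_nonneg fun i _ => dist_nonneg) (fun t => ?_) this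
  rw [Finset.mul_sum]
  exact Finset.sum_le_sum fun i _ => hg.dist_le_mul _ _

/-! ### Accumulated mass and the calibration identity on an interval. -/

variable {X : Type*} [NormedAddCommGroup X]

/-- The mass accumulated along an edge, starting from `a`. -/
noncomputable def accMass (f : ℝ → X) (a x : ℝ) : ℝ := a + ∫ t in (0 : ℝ)..x, ‖f t‖ ^ 2

theorem accMass_zero (f : ℝ → X) (a : ℝ) : accMass f a 0 = a := by simp [accMass]

theorem hasDerivAt_accMass {f : ℝ → X} (hf : Continuous f) (a x : ℝ) :
    HasDerivAt (accMass f a) (‖f x‖ ^ 2) x := by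
  have h : Continuous fun t => ‖f t‖ ^ 2 := by fun_prop
  exact (intervalIntegral.integral_hasDerivAt_right (h.intervalIntegrable _ _)
    h.stronglyMeasurable.stronglyMeasurableAtFilter h.continuousAt).const_add a

theorem accMass_mono {f : ℝ → X} (hf : Continuous f) (a : ℝ) : Monotone (accMass f a) :=
  monotone_of_hasDerivAt_nonneg (fun x => hasDerivAt_accMass hf a x) fun x => by positivity

theorem continuous_accMass {f : ℝ → X} (hf : Continuous f) (a : ℝ) : Continuous (accMass f a) :=
  continuous_iff_continuousAt.2 fun x => (hasDerivAt_accMass hf a x).continuousAt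

theorem le_accMass {f : ℝ → X} (hf : Continuous f) (a : ℝ) {x : ℝ} (hx : 0 ≤ x) :
    a ≤ accMass f a x := by
  simpa [accMass_zero] using accMass_mono hf a hx

theorem AbsolutelyContinuousOnInterval.norm_sq {f : ℝ → X} {a b : ℝ}
    (h : AbsolutelyContinuousOnInterval f a b) :
    AbsolutelyContinuousOnInterval (fun x => ‖f x‖ ^ 2) a b := by
  have h1 := LipschitzWith.comp_absolutelyContinuousOnInterval lipschitzWith_one_norm h
  simpa only [sq] using h1.fun_mul h1

variable [InnerProductSpace ℝ X]

/-- The defect in the calibration inequality on `[0, l]`. -/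
noncomputable def deficit (f : ℝ → X) (c a l : ℝ) : ℝ :=
  ∫ x in (0 : ℝ)..l, ‖deriv f x + (2 * tanWeight c (accMass f a x) * ‖f x‖ ^ 2) • f x‖ ^ 2

theorem deficit_nonneg (f : ℝ → X) (c a : ℝ) {l : ℝ} (hl : 0 ≤ l) : 0 ≤ deficit f c a l :=
  intervalIntegral.integral_nonneg hl fun _ _ => by positivity

theorem AbsolutelyContinuousOnInterval.ae_differentiableAt' [FiniteDimensional ℝ X] {f : ℝ → X}
    {a b : ℝ} (h : AbsolutelyContinuousOnInterval f a b) :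
    ∀ᵐ x, x ∈ uIcc a b → DifferentiableAt ℝ f x :=
  h.boundedVariationOn.ae_differentiableAt_of_mem_uIcc

section

variable {f : ℝ → X} {c a l : ℝ} (hl : 0 ≤ l) (hf : Continuous f)
  (hc : 0 < c) (ha : 0 ≤ a) (hM : c * accMass f a l < π / 4)
include hf hc ha hM

omit [InnerProductSpace ℝ X] in
theorem accMass_mem {x : ℝ} (hx : x ∈ Icc 0 l) :
    0 ≤ accMass f a x ∧ c * accMass f a x < π / 4 :=
  ⟨ha.trans (le_accMass hf a hx.1),
    (mul_le_mul_of_nonneg_left (accMass_mono hf a hx.2) hc.le).trans_lt hM⟩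

include hl in
omit [InnerProductSpace ℝ X] in
-- The accumulated mass is `C¹` and stays in the range where `g'` is continuous, so the composite
-- has bounded derivative on `[0, l]` and is Lipschitz. It serves both the weight and the reciprocal
-- cosine of the rigidity argument.
theorem absolutelyContinuous_comp_accMass {g g' : ℝ → ℝ}
    (hg : ∀ t, 0 ≤ t → c * t < π / 4 → HasDerivAt g (g' t) t)
    (hg' : ∀ t, 0 ≤ t → c * t < π / 4 → ContinuousAt g' t) :
    AbsolutelyContinuousOnInterval (fun x => g (accMass f a x)) 0 l := by
  have hF := hasDerivAt_accMass hf a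
  have hd : ∀ x ∈ Icc 0 l, HasDerivWithinAt (fun x => g (accMass f a x))
      (g' (accMass f a x) * ‖f x‖ ^ 2) (Icc 0 l) x := fun x hx =>
    have := accMass_mem hf hc ha hM hx
    ((hg _ this.1 this.2).comp x (hF x)).hasDerivWithinAt
  have hcont : ContinuousOn (fun x => g' (accMass f a x) * ‖f x‖ ^ 2) (Icc 0 l) := fun x hx =>
    have := accMass_mem hf hc ha hM hx
    ((ContinuousAt.comp (hg' _ this.1 this.2) (hF x).continuousAt).mul
      (by fun_prop)).continuousWithinAt
  obtain ⟨C, hC⟩ := isCompact_Icc.exists_bound_of_continuousOn hcont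
  have := (convex_Icc (0 : ℝ) l).lipschitzOnWith_of_nnnorm_hasDerivWithin_le (C := C.toNNReal) hd
    fun x hx => by
      rw [← NNReal.coe_le_coe, coe_nnnorm]
      exact (hC x hx).trans (Real.le_coe_toNNReal C)
  rw [← uIcc_of_le hl] at this
  exact this.absolutelyContinuousOnInterval

include hl in
omit [InnerProductSpace ℝ X] in
theorem absolutelyContinuous_tanWeight_accMass :
    AbsolutelyContinuousOnInterval (fun x => tanWeight c (accMass f a x)) 0 l :=
  absolutelyContinuous_comp_accMass hl hf hc ha hM
    (fun _ h0 h => hasDerivAt_tanWeight hc.le h0 h) fun _ h0 h =>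
    continuousAt_const.add (continuousAt_const.mul
      ((hasDerivAt_tanWeight hc.le h0 h).continuousAt.pow 2))

include hl in
omit [InnerProductSpace ℝ X] in
theorem absolutelyContinuous_calibration (hac : AbsolutelyContinuousOnInterval f 0 l) :
    AbsolutelyContinuousOnInterval
      (fun x => ‖f x‖ ^ 2 * ‖f x‖ ^ 2 * tanWeight c (accMass f a x)) 0 l :=
  (hac.norm_sq.fun_mul hac.norm_sq).fun_mul
    (absolutelyContinuous_tanWeight_accMass hl hf hc ha hM)

include hl in
-- The square expands to `‖f'‖² + 4h‖f‖²⟪f, f'⟫ + 4h²‖f‖⁶`. Since the accumulated mass has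
-- derivative `‖f‖²`, that of `‖f‖⁴h` is `4h‖f‖²⟪f, f'⟫ + (c² + 4h²)‖f‖⁶`, and the difference is
-- `‖f'‖² - c²‖f‖⁶`.
theorem deficit_integrand_ae_eq [FiniteDimensional ℝ X]
    (hac : AbsolutelyContinuousOnInterval f 0 l) :
    ∀ᵐ x, x ∈ uIoc 0 l →
      ‖deriv f x + (2 * tanWeight c (accMass f a x) * ‖f x‖ ^ 2) • f x‖ ^ 2 =
      ‖deriv f x‖ ^ 2 - c ^ 2 * ‖f x‖ ^ 6 +
      deriv (fun x => ‖f x‖ ^ 2 * ‖f x‖ ^ 2 * tanWeight c (accMass f a x)) x := by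
  filter_upwards [hac.ae_differentiableAt'] with x hx hx'
  have hxl : x ∈ Icc 0 l := by
    rw [uIoc_of_le hl] at hx'; exact Ioc_subset_Icc_self hx'
  have hfx := (hx (by rwa [uIcc_of_le hl])).hasDerivAt
  have hm := accMass_mem hf hc ha hM hxl
  have hwx := hfx.norm_sq
  have hgx := (hwx.mul hwx).mul
    ((hasDerivAt_tanWeight hc.le hm.1 hm.2).comp x (hasDerivAt_accMass hf a x))
  erw [hgx.deriv]
  rw [norm_add_sq_real, norm_smul, inner_smul_right, mul_pow, Real.norm_eq_abs, sq_abs,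
    real_inner_comm]
  simp only [Function.comp, Pi.mul_apply]
  ring

include hl in
theorem intervalIntegrable_deficit [FiniteDimensional ℝ X]
    (hac : AbsolutelyContinuousOnInterval f 0 l)
    (hd : IntervalIntegrable (fun x => ‖deriv f x‖ ^ 2) volume 0 l) :
    IntervalIntegrable (fun x =>
      ‖deriv f x + (2 * tanWeight c (accMass f a x) * ‖f x‖ ^ 2) • f x‖ ^ 2) volume 0 l := by
  have h6 : IntervalIntegrable (fun x => c ^ 2 * ‖f x‖ ^ 6) volume 0 l :=
    Continuous.intervalIntegrable (by fun_prop) _ _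
  refine ((hd.sub h6).add
    (absolutelyContinuous_calibration hl hf hc ha hM hac).intervalIntegrable_deriv).congr_ae ?_
  rw [Filter.EventuallyEq, ae_restrict_iff' measurableSet_uIoc]
  filter_upwards [deficit_integrand_ae_eq hl hf hc ha hM hac] with x hx hx'
  exact (hx hx').symm

include hl in
-- The previous identity integrated, by the fundamental theorem for absolutely continuous functions.
-- Its two boundary terms are what has to be balanced at the vertices.
theorem deficit_eq [FiniteDimensional ℝ X] (hac : AbsolutelyContinuousOnInterval f 0 l)
    (hd : IntervalIntegrable (fun x => ‖deriv f x‖ ^ 2) volume 0 l) :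
    deficit f c a l = (∫ x in (0 : ℝ)..l, ‖deriv f x‖ ^ 2) - c ^ 2 * (∫ x in (0 : ℝ)..l, ‖f x‖ ^ 6)
      + ‖f l‖ ^ 4 * tanWeight c (accMass f a l) - ‖f 0‖ ^ 4 * tanWeight c a := by
  have hg := absolutelyContinuous_calibration hl hf hc ha hM hac
  have h1 := hg.integral_deriv_eq_sub
  rw [accMass_zero] at h1
  have h6 : IntervalIntegrable (fun x => ‖f x‖ ^ 6) volume 0 l :=
    Continuous.intervalIntegrable (by fun_prop) _ _
  rw [deficit, intervalIntegral.integral_congr_ae (deficit_integrand_ae_eq hl hf hc ha hM hac),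
    intervalIntegral.integral_add (hd.sub (h6.const_mul _)) hg.intervalIntegrable_deriv,
    intervalIntegral.integral_sub hd (h6.const_mul _), intervalIntegral.integral_const_mul, h1]
  ring

end

end Calibration

/-! ### The calibration on a half-line. -/

section EdgeInequality

open Real Set

variable {X : Type*} [NormedAddCommGroup X] [InnerProductSpace ℝ X] [FiniteDimensional ℝ X]
  {f : ℝ → X} {c a l : ℝ}

theorem deficit_mono (hf : Continuous f) (hc : 0 < c) (ha : 0 ≤ a)
    (hM : c * accMass f a l < π / 4) (hac : AbsolutelyContinuousOnInterval f 0 l)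
    (hd : IntervalIntegrable (fun x => ‖deriv f x‖ ^ 2) volume 0 l) {y : ℝ} (hy : y ∈ Icc 0 l) :
    deficit f c a y ≤ deficit f c a l :=
  intervalIntegral.integral_mono_interval le_rfl hy.1 hy.2 (ae_of_all _ fun _ => by positivity)
    (intervalIntegrable_deficit (hy.1.trans hy.2) hf hc ha hM hac hd)

theorem tanWeight_mono {s t : ℝ} (hc : 0 < c) (hs : 0 ≤ s) (hst : s ≤ t) (ht : c * t < π / 4) :
    tanWeight c s ≤ tanWeight c t := by
  have h := (tanWeight_add_le hc hs (sub_nonneg.2 hst) (by rwa [add_sub_cancel])).1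
  rw [add_sub_cancel] at h
  have := tanWeight_nonneg hc.le (sub_nonneg.2 hst) (by nlinarith [mul_nonneg hc.le hs])
  linarith

omit [InnerProductSpace ℝ X] [FiniteDimensional ℝ X] in
-- Otherwise `‖f‖²` would be bounded below on a set of infinite measure. Cutting at such points
-- controls the boundary term without first proving decay at infinity.
theorem exists_ge_norm_lt (hi : IntegrableOn (fun x => ‖f x‖ ^ 2) (Ioi 0)) {ε : ℝ} (hε : 0 < ε)
    (N : ℝ) : ∃ x ≥ N, 0 ≤ x ∧ ‖f x‖ < ε := by
  by_contra! h
  have h1 : IntegrableOn (fun _ : ℝ => ε ^ 2) (Ioi (max N 0)) := by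
    refine Integrable.mono' (hi.mono_set (Ioi_subset_Ioi (le_max_right _ _)))
      aestronglyMeasurable_const ?_
    rw [ae_restrict_iff' measurableSet_Ioi]
    refine ae_of_all _ fun x hx => ?_
    have h2 := h x ((le_max_left _ _).trans (le_of_lt hx)) ((le_max_right _ _).trans (le_of_lt hx))
    rw [Real.norm_eq_abs, abs_of_pos (by positivity)]
    gcongr
  rw [integrableOn_const_iff] at h1
  simp [hε.ne'] at h1

section HalfLine

variable (hf : Continuous f) (hac : ∀ l, 0 ≤ l → AbsolutelyContinuousOnInterval f 0 l)
  (hd : IntegrableOn (fun x => ‖deriv f x‖ ^ 2) (Ioi 0))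
  (hi : IntegrableOn (fun x => ‖f x‖ ^ 2) (Ioi 0))

theorem intervalIntegral_le_Ioi {g : ℝ → ℝ} (hg : IntegrableOn g (Ioi 0)) (h0 : ∀ x, 0 ≤ g x)
    {x : ℝ} (hx : 0 ≤ x) : ∫ t in (0 : ℝ)..x, g t ≤ ∫ t in Ioi 0, g t := by
  rw [intervalIntegral.integral_of_le hx]
  exact setIntegral_mono_set hg (ae_of_all _ h0) Ioc_subset_Ioi_self.eventuallyLE

theorem intervalIntegrable_of_integrableOn_Ioi {g : ℝ → ℝ} (hg : IntegrableOn g (Ioi 0)) {x : ℝ}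
    (hx : 0 ≤ x) : IntervalIntegrable g volume 0 x :=
  (intervalIntegrable_iff_integrableOn_Ioc_of_le hx).2 (hg.mono_set Ioc_subset_Ioi_self)

include hi in
omit [InnerProductSpace ℝ X] [FiniteDimensional ℝ X] in
theorem accMass_le_total (a : ℝ) {x : ℝ} (hx : 0 ≤ x) :
    accMass f a x ≤ a + ∫ t in Ioi 0, ‖f t‖ ^ 2 :=
  add_le_add_right (intervalIntegral_le_Ioi hi (fun _ => by positivity) hx) a

include hf hac hd hi

/-- The calibration itself bounds the sixth power: with `c` small enough for the whole mass,
nonnegativity of the deficit bounds `c² ∫‖f‖⁶` up to points where `‖f‖ < 1`. -/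
theorem integrableOn_norm_pow_six : IntegrableOn (fun x => ‖f x‖ ^ 6) (Ioi 0) := by
  set m := ∫ t in Ioi 0, ‖f t‖ ^ 2 with hm
  have m0 : 0 ≤ m := by positivity
  obtain ⟨c, hc, hcm⟩ : ∃ c : ℝ, 0 < c ∧ c * (0 + m) < π / 4 := by
    refine ⟨π / 4 / (m + 1), by positivity, ?_⟩
    rw [div_mul_eq_mul_div, div_lt_iff₀ (by positivity)]
    nlinarith [pi_pos]
  refine integrableOn_Ioi_of_intervalIntegral_norm_bounded (l := Filter.atTop) (b := id)
    (((∫ x in Ioi 0, ‖deriv f x‖ ^ 2) + tanWeight c m) / c ^ 2) 0 (fun x => ?_)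
    Filter.tendsto_id ?_
  · exact ((Continuous.locallyIntegrable (by fun_prop)).integrableOn_isCompact
      isCompact_Icc).mono_set Ioc_subset_Icc_self
  · filter_upwards [Filter.eventually_ge_atTop (0 : ℝ)] with x hx
    obtain ⟨y, hxy, hy, hy1⟩ := exists_ge_norm_lt hi one_pos x
    have hmy := accMass_le_total hi 0 hy
    have hlt : c * accMass f 0 y < π / 4 :=
      (mul_le_mul_of_nonneg_left hmy hc.le).trans_lt hcm
    have h1 := deficit_eq hy hf hc le_rfl hlt (hac y hy) (intervalIntegrable_of_integrableOn_Ioi hd hy)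
    have h2 := deficit_nonneg f c 0 hy
    rw [tanWeight_zero, mul_zero, sub_zero] at h1
    have h3 := intervalIntegral_le_Ioi hd (fun _ => by positivity) hy
    have h4 := tanWeight_mono hc (le_accMass hf 0 hy) hmy hcm
    rw [zero_add, ← hm] at h4
    have h40 := tanWeight_nonneg hc.le (le_accMass hf 0 hy) hlt
    have h5 : ‖f y‖ ^ 4 ≤ 1 := pow_le_one₀ (norm_nonneg _) hy1.le
    have h6 : ∫ t in (0 : ℝ)..x, ‖f t‖ ^ 6 ≤ ∫ t in (0 : ℝ)..y, ‖f t‖ ^ 6 :=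
      intervalIntegral.integral_mono_interval le_rfl hx hxy (ae_of_all _ fun _ => by positivity)
        (Continuous.intervalIntegrable (by fun_prop) _ _)
    simp only [norm_pow, norm_norm, id]
    rw [le_div_iff₀ (by positivity)]
    nlinarith [pow_pos hc 2]

theorem deficit_le_of_halfLine (hc : 0 < c) (ha : 0 ≤ a)
    (hM : c * (a + ∫ t in Ioi 0, ‖f t‖ ^ 2) < π / 4) {N : ℝ} (hN : 0 ≤ N) :
    deficit f c a N ≤ (∫ x in Ioi 0, ‖deriv f x‖ ^ 2) - c ^ 2 * (∫ x in Ioi 0, ‖f x‖ ^ 6)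
      - ‖f 0‖ ^ 4 * tanWeight c a := by
  set m := a + ∫ t in Ioi 0, ‖f t‖ ^ 2
  have hm0 : 0 ≤ tanWeight c m := tanWeight_nonneg hc.le (by positivity) hM
  refine le_of_forall_pos_le_add fun ε hε => ?_
  have h6 := integrableOn_norm_pow_six hf hac hd hi
  have ht := intervalIntegral_tendsto_integral_Ioi 0 h6 Filter.tendsto_id
  obtain ⟨N', hN'⟩ := Filter.eventually_atTop.1 (ht.eventually (lt_mem_nhds
    (show (∫ x in Ioi 0, ‖f x‖ ^ 6) - ε / 2 / c ^ 2 < _ from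
      sub_lt_self _ (by positivity))))
  -- The error `ε` is split in two: one half for the part of `∫‖f‖⁶` beyond `y`, the other for the
  -- boundary term at `y`, where `‖f‖⁴ ≤ ‖f‖` because the norm is below one.
  obtain ⟨y, hxy, hy, hy1⟩ := exists_ge_norm_lt hi
    (ε := min 1 (ε / 2 / (tanWeight c m + 1))) (by positivity) (max N N')
  have hmy := accMass_le_total hi a hy
  have hlt : c * accMass f a y < π / 4 := (mul_le_mul_of_nonneg_left hmy hc.le).trans_lt hM
  have hdy := intervalIntegrable_of_integrableOn_Ioi hd hy
  have h1 := deficit_eq hy hf hc ha hlt (hac y hy) hdy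
  have h2 := deficit_mono hf hc ha hlt (hac y hy) hdy ⟨hN, (le_max_left _ _).trans hxy⟩
  have h3 := intervalIntegral_le_Ioi hd (fun _ => by positivity) hy
  have h4 := tanWeight_mono hc (ha.trans (le_accMass hf a hy)) hmy hM
  have h5 := hN' y ((le_max_right _ _).trans hxy)
  simp only [id] at h5
  have h7 : c ^ 2 * ((∫ x in Ioi 0, ‖f x‖ ^ 6) - ε / 2 / c ^ 2) ≤
    c ^ 2 * ∫ t in (0 : ℝ)..y, ‖f t‖ ^ 6 := mul_le_mul_of_nonneg_left h5.le (by positivity)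
  have h8 : c ^ 2 * (ε / 2 / c ^ 2) = ε / 2 := by field_simp
  have h9 : ‖f y‖ ^ 4 * tanWeight c (accMass f a y) ≤ ε / 2 := by
    have e1 : ‖f y‖ ^ 4 ≤ ‖f y‖ :=
      pow_le_of_le_one (norm_nonneg _) (hy1.le.trans (min_le_left _ _)) (by norm_num)
    have e2 : ‖f y‖ ≤ ε / 2 / (tanWeight c m + 1) := hy1.le.trans (min_le_right _ _)
    rw [le_div_iff₀ (by positivity)] at e2
    have e3 := tanWeight_nonneg hc.le (ha.trans (le_accMass hf a hy)) hlt
    nlinarith [norm_nonneg (f y)]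
  linarith

end HalfLine

end EdgeInequality

/-! ### Functions with vanishing deficit. -/

section Rigidity

open Real Set

variable {X : Type*} [NormedAddCommGroup X] [InnerProductSpace ℝ X] [FiniteDimensional ℝ X]
  {f : ℝ → X} {c a l : ℝ}

theorem tendsto_tanWeight {t : ℝ} (hc : 0 < c) (h0 : 0 ≤ t) (ht : c * t < π / 4) :
    Filter.Tendsto (fun k => tanWeight k t) (nhdsWithin c (Iio c)) (nhds (tanWeight c t)) := by
  refine Filter.Tendsto.mono_left ?_ nhdsWithin_le_nhds
  have hcos := (cos_pos_of_lt hc.le h0 ht).ne'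
  refine Filter.Tendsto.mul (Filter.Tendsto.div_const Filter.tendsto_id _) ?_
  exact (continuousAt_tan.2 hcos).tendsto.comp (Continuous.tendsto' (by fun_prop) _ _ rfl)

/-- In the equality case the total mass sits at the singularity of the weight, so the calibration is
available only for `k < c`. Before the singularity the deficit is continuous in the constant by
`deficit_eq`, and the bound tends to zero. -/
theorem deficit_eq_zero_of_limit (hf : Continuous f) (hc : 0 < c) (ha : 0 ≤ a) (hl : 0 ≤ l)
    (hM : c * accMass f a l < π / 4) (hac : AbsolutelyContinuousOnInterval f 0 l)
    (hd : IntervalIntegrable (fun x => ‖deriv f x‖ ^ 2) volume 0 l) {C : ℝ}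
    (h : ∀ k, 0 < k → k < c → deficit f k a l ≤ (c ^ 2 - k ^ 2) * C) : deficit f c a l = 0 := by
  refine le_antisymm ?_ (deficit_nonneg f c a hl)
  have hFa := le_accMass hf a hl
  have hca : c * a < π / 4 := (mul_le_mul_of_nonneg_left hFa hc.le).trans_lt hM
  have ck : Filter.Tendsto (fun k : ℝ => k ^ 2) (nhdsWithin c (Iio c)) (nhds (c ^ 2)) :=
    ((continuous_pow 2).tendsto c).mono_left nhdsWithin_le_nhds
  have L : Filter.Tendsto (fun k => (∫ x in (0 : ℝ)..l, ‖deriv f x‖ ^ 2)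
      - k ^ 2 * (∫ x in (0 : ℝ)..l, ‖f x‖ ^ 6)
      + ‖f l‖ ^ 4 * tanWeight k (accMass f a l) - ‖f 0‖ ^ 4 * tanWeight k a)
      (nhdsWithin c (Iio c)) (nhds (deficit f c a l)) := by
    rw [deficit_eq hl hf hc ha hM hac hd]
    exact ((tendsto_const_nhds.sub (ck.mul_const _)).add
      ((tendsto_tanWeight hc (ha.trans hFa) hM).const_mul _)).sub ((tendsto_tanWeight hc ha hca).const_mul _)
  have R : Filter.Tendsto (fun k => (c ^ 2 - k ^ 2) * C) (nhdsWithin c (Iio c)) (nhds 0) := by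
    have := ((ck.const_sub (c ^ 2)).mul_const C)
    rwa [sub_self, zero_mul] at this
  refine le_of_tendsto_of_tendsto L R ?_
  filter_upwards [Ioo_mem_nhdsLT hc] with k hk
  have hMk : k * accMass f a l < π / 4 :=
    (mul_le_mul_of_nonneg_right hk.2.le (ha.trans hFa)).trans_lt hM
  rw [← deficit_eq hl hf hk.1 ha hMk hac hd]
  exact h k hk.1 hk.2

/-- Zero deficit means `f' = -2h‖f‖²f` almost everywhere. Then `‖f‖²` and `cos (2cM)`, with `M` the
accumulated mass, have the same logarithmic derivative `-2c tan(2cM)‖f‖²`, so their quotient, being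
absolutely continuous, is constant. -/
theorem norm_sq_eq_of_deficit_eq_zero (hf : Continuous f) (hc : 0 < c) (ha : 0 ≤ a) (hl : 0 ≤ l)
    (hM : c * accMass f a l < π / 4) (hac : AbsolutelyContinuousOnInterval f 0 l)
    (hd : IntervalIntegrable (fun x => ‖deriv f x‖ ^ 2) volume 0 l)
    (h : deficit f c a l = 0) :
    ∀ x ∈ Icc 0 l, ‖f x‖ ^ 2 = ‖f 0‖ ^ 2 / cos (2 * c * a) * cos (2 * c * accMass f a x) := by
  have hG : AbsolutelyContinuousOnInterval
      (fun x => ‖f x‖ ^ 2 * (cos (2 * c * accMass f a x))⁻¹) 0 l := by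
    refine hac.norm_sq.fun_mul (absolutelyContinuous_comp_accMass hl hf hc ha hM
      (g := fun t => (cos (2 * c * t))⁻¹)
      (g' := fun t => 2 * c * sin (2 * c * t) / cos (2 * c * t) ^ 2) (fun t h0 ht => ?_)
      fun t h0 ht => ?_)
    · have hcos := (cos_pos_of_lt hc.le h0 ht).ne'
      have h1 := (((hasDerivAt_cos _).comp t ((hasDerivAt_id t).const_mul (2 * c)))).inv hcos
      refine h1.congr_deriv ?_
      simp only [Function.comp, id]
      ring
    · have hcos := (cos_pos_of_lt hc.le h0 ht).ne'
      exact ContinuousAt.div (by fun_prop) (by fun_prop) (pow_ne_zero 2 hcos)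
  have hz : ∀ᵐ x, x ∈ Ioc 0 l →
      deriv f x + (2 * tanWeight c (accMass f a x) * ‖f x‖ ^ 2) • f x = 0 := by
    have h1 := intervalIntegrable_deficit hl hf hc ha hM hac hd
    rw [deficit, intervalIntegral.integral_eq_zero_iff_of_le_of_nonneg_ae hl
      (ae_of_all _ fun _ => by positivity) h1] at h
    rw [Filter.EventuallyEq, ae_restrict_iff' measurableSet_Ioc] at h
    filter_upwards [h] with x hx hx'
    simpa using hx hx'
  have hconst : ∀ᵐ x, x ∈ uIcc 0 l →
      HasDerivAt (fun x => ‖f x‖ ^ 2 * (cos (2 * c * accMass f a x))⁻¹) 0 x := by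
    have h0 : ∀ᵐ x : ℝ, x ≠ 0 := by simp [ae_iff]
    filter_upwards [hz, hac.ae_differentiableAt', h0] with x hx hx' h0 hxl
    have hfx := (hx' hxl).hasDerivAt
    rw [uIcc_of_le hl] at hxl
    have hm := accMass_mem hf hc ha hM hxl
    have hcos := (cos_pos_of_lt hc.le hm.1 hm.2).ne'
    have hz := hx ⟨lt_of_le_of_ne hxl.1 (Ne.symm h0), hxl.2⟩
    have h1 := (((hasDerivAt_cos _).comp x ((hasDerivAt_accMass hf a x).const_mul (2 * c)))).inv
      hcos
    refine (hfx.norm_sq.mul h1).congr_deriv ?_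
    rw [eq_neg_of_add_eq_zero_left hz, inner_neg_right, inner_smul_right,
      real_inner_self_eq_norm_sq]
    simp only [Function.comp, tanWeight, tan_eq_sin_div_cos, Pi.inv_apply]
    field_simp
    ring
  obtain ⟨C, hC⟩ := hG.const_of_ae_hasDerivAt_zero hconst
  rw [uIcc_of_le hl] at hC
  intro x hx
  have h0 := hC 0 ⟨le_rfl, hl⟩
  have hm := accMass_mem hf hc ha hM hx
  have hcos := (cos_pos_of_lt hc.le hm.1 hm.2).ne'
  rw [accMass_zero, ← hC x hx] at h0
  rw [div_eq_mul_inv, h0]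
  field_simp

variable (hf : Continuous f) (hc : 0 < c) (ha : 0 ≤ a) (hl : 0 < l)
  (hM : c * accMass f a l ≤ π / 4) (hac : AbsolutelyContinuousOnInterval f 0 l)
  (hd : IntervalIntegrable (fun x => ‖deriv f x‖ ^ 2) volume 0 l)
  (h : ∀ y ∈ Icc 0 l, c * accMass f a y < π / 4 → deficit f c a y = 0)

include hf hl in
omit [InnerProductSpace ℝ X] [FiniteDimensional ℝ X] in
theorem lt_accMass {x : ℝ} (hx : x ∈ Icc 0 l) (hfx : f x ≠ 0) : a < accMass f a l := by
  have := intervalIntegral.integral_pos hl (f := fun t => ‖f t‖ ^ 2)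
    (Continuous.continuousOn (by fun_prop)) (fun _ _ => by positivity)
    ⟨x, hx, pow_pos (norm_pos_iff.2 hfx) 2⟩
  unfold accMass; linarith

include hf hc ha hl hac hd h in
theorem norm_sq_eq_of_accMass_lt {y : ℝ} (hy : y ∈ Icc 0 l) (hlt : c * accMass f a y < π / 4) :
    ∀ x ∈ Icc 0 y, ‖f x‖ ^ 2 = ‖f 0‖ ^ 2 / cos (2 * c * a) * cos (2 * c * accMass f a x) :=
  norm_sq_eq_of_deficit_eq_zero hf hc ha hy.1 hlt
    (hac.mono (by rw [uIcc_of_le hy.1, uIcc_of_le hl.le]; exact Icc_subset_Icc_right hy.2))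
    (hd.mono_set (by rw [uIcc_of_le hy.1, uIcc_of_le hl.le]; exact Icc_subset_Icc_right hy.2))
    (h y hy hlt)

include hf hc ha hl hac hd h hM in
theorem eq_zero_of_deficit_eq_zero (h0 : f 0 = 0) : ∀ x ∈ Icc 0 l, f x = 0 := by
  by_contra! hne
  obtain ⟨x, hx, hfx⟩ := hne
  have hal := lt_accMass (a := a) hf hl hx hfx
  -- At half of the mass gain the weight is still finite even if the endpoint is critical; there the
  -- explicit formula forces `f = 0` on `[0, y]`, so no mass was gained.
  obtain ⟨y, hy, hFy⟩ := intermediate_value_Icc hl.le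
    (continuous_accMass hf a).continuousOn
    (show (a + accMass f a l) / 2 ∈ Icc (accMass f a 0) (accMass f a l) from
      ⟨by rw [accMass_zero]; linarith, by linarith⟩)
  have hw := norm_sq_eq_of_accMass_lt hf hc ha hl hac hd h hy (by rw [hFy]; nlinarith)
  have : accMass f a y = a := by
    rw [accMass, intervalIntegral.integral_congr (g := fun _ => (0 : ℝ))]
    · simp
    · intro t ht
      rw [uIcc_of_le hy.1] at ht
      have := hw t ht
      simpa [h0] using this
  linarith

include hf hc ha hl hac hd h hM in
-- With `g = π/2 - 2cM`, `M` the accumulated mass, the explicit formula gives `g' = -2cB sin g ≥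
-- -2cB g`. Thus `g` decays at most exponentially: the critical mass is not reached at finite length
-- and the cosine never vanishes.
theorem ne_zero_of_deficit_eq_zero (h0 : f 0 ≠ 0) :
    (∀ x ∈ Icc 0 l, f x ≠ 0) ∧ c * accMass f a l < π / 4 := by
  have hal := lt_accMass (a := a) hf hl ⟨le_rfl, hl.le⟩ h0
  have hca : c * a < π / 4 := (mul_lt_mul_of_pos_left hal hc).trans_le hM
  have hcosa := cos_pos_of_lt hc.le ha hca
  set B := ‖f 0‖ ^ 2 / cos (2 * c * a) with hB
  have hB0 : 0 < B := div_pos (pow_pos (norm_pos_iff.2 h0) 2) hcosa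
  have key : ∀ y ∈ Icc 0 l, c * accMass f a y < π / 4 →
      (π / 2 - 2 * c * a) * exp (-(2 * c * B * l)) ≤ π / 2 - 2 * c * accMass f a y := by
    intro y hy hlt
    have hw := norm_sq_eq_of_accMass_lt hf hc ha hl hac hd h hy hlt
    have hder : ∀ x, HasDerivAt
        (fun x => (π / 2 - 2 * c * accMass f a x) * exp (2 * c * B * x))
        (-(2 * c * ‖f x‖ ^ 2) * exp (2 * c * B * x) +
          (π / 2 - 2 * c * accMass f a x) * (exp (2 * c * B * x) * (2 * c * B))) x := by
      intro x
      have h1 := ((hasDerivAt_accMass hf a x).const_mul (2 * c)).const_sub (π / 2)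
      have h2 := ((hasDerivAt_id x).const_mul (2 * c * B)).exp
      refine (h1.mul h2).congr_deriv ?_
      simp
    have hmono := monotoneOn_of_deriv_nonneg (convex_Icc 0 y)
      (f := fun x => (π / 2 - 2 * c * accMass f a x) * exp (2 * c * B * x))
      (fun x _ => (hder x).continuousAt.continuousWithinAt)
      (fun x _ => (hder x).differentiableAt.differentiableWithinAt) fun x hx => by
        rw [interior_Icc] at hx
        rw [(hder x).deriv, hw x (Ioo_subset_Icc_self hx)]
        have hm := accMass_mem hf hc ha hlt (Ioo_subset_Icc_self hx)
        have hs : cos (2 * c * accMass f a x) ≤ π / 2 - 2 * c * accMass f a x := by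
          rw [← sin_pi_div_two_sub]
          exact sin_le (by linarith)
        have : 0 ≤ 2 * c * B * exp (2 * c * B * x) := by positivity
        rw [← hB]
        nlinarith
    have h3 := hmono ⟨le_rfl, hy.1⟩ ⟨hy.1, le_rfl⟩ hy.1
    simp only [accMass_zero, mul_zero, exp_zero, mul_one] at h3
    have h4 : exp (2 * c * B * y) ≤ exp (2 * c * B * l) :=
      exp_le_exp.2 (mul_le_mul_of_nonneg_left hy.2 (by positivity))
    rw [exp_neg, ← div_eq_mul_inv, div_le_iff₀ (exp_pos _)]
    exact h3.trans (mul_le_mul_of_nonneg_left h4 (by linarith))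
  have hlt : c * accMass f a l < π / 4 := by
    refine lt_of_le_of_ne hM fun heq => ?_
    set δ := (π / 2 - 2 * c * a) * exp (-(2 * c * B * l)) with hδ
    have hg : 0 < π / 2 - 2 * c * a := by linarith
    have hδ0 : 0 < δ := mul_pos hg (exp_pos _)
    have hδ1 : δ ≤ π / 2 - 2 * c * a :=
      mul_le_of_le_one_right hg.le (exp_le_one_iff.2 (neg_nonpos.2 (by positivity)))
    have e1 : c * (δ / (4 * c)) = δ / 4 := by field_simp
    obtain ⟨y, hy, hFy⟩ := intermediate_value_Icc hl.le
      (continuous_accMass hf a).continuousOn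
      -- At this point `π/2 - 2c * accMass f a y` equals `δ / 2`, below the uniform lower bound `δ`
      -- of `key`.
      (show accMass f a l - δ / (4 * c) ∈ Icc (accMass f a 0) (accMass f a l) from ⟨by
        rw [accMass_zero]
        refine le_of_mul_le_mul_left ?_ hc
        rw [mul_sub, e1]; linarith, sub_le_self _ (by positivity)⟩)
    have h5 : c * accMass f a y = π / 4 - δ / 4 := by rw [hFy, mul_sub, e1, heq]
    have h6 := key y hy (by linarith)
    linarith
  refine ⟨fun x hx hfx => ?_, hlt⟩
  have hw := norm_sq_eq_of_accMass_lt hf hc ha hl hac hd h ⟨hl.le, le_rfl⟩ hlt x hx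
  have hm := accMass_mem hf hc ha hlt hx
  rw [hfx, norm_zero, zero_pow two_ne_zero] at hw
  exact (mul_pos hB0 (cos_pos_of_lt hc.le hm.1 hm.2)).ne hw

end Rigidity

/-! ### Spanning trees and the flow of mass to the root. -/

namespace MetricGraph

section Tree

open Classical in
/-- The vertex where an edge starts when the edges in `R` run from `tgt` to `src`. -/
noncomputable def orientedTail {V E H : Type*} (G : MetricGraph V E H) (R : E → Prop) (e : E) : V :=
  if R e then G.tgt e else G.src e

open Classical in
/-- The vertex where an edge ends when the edges in `R` run from `tgt` to `src`. -/
noncomputable def orientedHead {V E H : Type*} (G : MetricGraph V E H) (R : E → Prop) (e : E) : V :=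
  if R e then G.src e else G.tgt e

/-- A spanning tree rooted at `r`, with an orientation of all bounded edges such that the edges of
the tree point towards the root. -/
structure SpanningTree {V E H : Type*} (G : MetricGraph V E H) (r : V) where
  rank : V → ℕ
  tree : Finset E
  /-- The edges that run from `tgt` to `src`. -/
  reversed : E → Prop
  rank_lt : ∀ e ∈ tree, rank (G.orientedHead reversed e) < rank (G.orientedTail reversed e)
  tail_inj : ∀ e ∈ tree, ∀ e' ∈ tree,
    G.orientedTail reversed e = G.orientedTail reversed e' → e = e'
  exists_mem : ∀ v, v ≠ r → ∃ e ∈ tree, G.orientedTail reversed e = v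
  tail_ne : ∀ e ∈ tree, G.orientedTail reversed e ≠ r

variable {V E H : Type*} {G : MetricGraph V E H}

/-- The simple graph on the vertices in which the ends of the bounded edges are adjacent. -/
def vertexGraph (G : MetricGraph V E H) : SimpleGraph V :=
  SimpleGraph.fromRel fun a b => ∃ e, G.src e = a ∧ G.tgt e = b

theorem vertexGraph_reachable (v w : V) : G.vertexGraph.Reachable v w := by
  induction G.connected v w with
  | rel x y h =>
    by_cases hxy : x = y
    · rw [hxy]
    · exact SimpleGraph.Adj.reachable ((SimpleGraph.fromRel_adj _ _ _).2 ⟨hxy, Or.inl h⟩)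
  | refl => exact SimpleGraph.Reachable.refl _
  | symm x y _ ih => exact ih.symm
  | trans x y z _ _ h1 h2 => exact h1.trans h2

/-- The first step of a shortest path to `r` is such an edge. -/
theorem exists_edge_dist_lt {r v : V} (hv : v ≠ r) : ∃ e w,
    ((G.src e = v ∧ G.tgt e = w) ∨ (G.src e = w ∧ G.tgt e = v)) ∧
      G.vertexGraph.dist w r < G.vertexGraph.dist v r := by
  obtain ⟨p, hp⟩ := (vertexGraph_reachable (G := G) v r).exists_walk_length_eq_dist
  cases p with
  | nil => exact absurd rfl hv
  | @cons _ w _ h p =>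
    have hd : G.vertexGraph.dist w r < G.vertexGraph.dist v r := by
      have := SimpleGraph.dist_le p
      rw [SimpleGraph.Walk.length_cons] at hp
      omega
    obtain ⟨-, ⟨e, he⟩ | ⟨e, he⟩⟩ := (SimpleGraph.fromRel_adj _ _ _).1 h
    · exact ⟨e, w, Or.inl he, hd⟩
    · exact ⟨e, w, Or.inr he, hd⟩

open Classical in
theorem exists_spanningTree [Fintype E] (G : MetricGraph V E H) (r : V) :
    Nonempty (SpanningTree G r) := by
  set d : V → ℕ := fun v => G.vertexGraph.dist v r with hd
  choose ε w hε hw using fun (v : V) (hv : v ≠ r) => exists_edge_dist_lt (G := G) hv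
  -- Every edge whose ends lie at different distances is directed to the end nearer the root; the
  -- tree consists of one distance-decreasing edge chosen at each other vertex.
  set R : E → Prop := fun e => d (G.src e) < d (G.tgt e) with hR
  have tail : ∀ v, ∀ hv : v ≠ r, G.orientedTail R (ε v hv) = v ∧
      G.orientedHead R (ε v hv) = w v hv := by
    intro v hv
    have h2 : d (w v hv) < d v := hw v hv
    obtain ⟨h, h'⟩ | ⟨h, h'⟩ := hε v hv
    · have hn : ¬ R (ε v hv) := by rw [hR]; simp only [h, h']; omega
      rw [orientedTail, orientedHead, if_neg hn, if_neg hn]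
      exact ⟨h, h'⟩
    · have hn : R (ε v hv) := by rw [hR]; simp only [h, h']; omega
      rw [orientedTail, orientedHead, if_pos hn, if_pos hn]
      exact ⟨h', h⟩
  refine ⟨⟨d, Finset.univ.filter fun e => ∃ v, ∃ hv : v ≠ r, ε v hv = e,
    R, ?_, ?_, ?_, ?_⟩⟩
  · simp only [Finset.mem_filter, Finset.mem_univ, true_and]
    rintro _ ⟨v, hv, rfl⟩
    rw [(tail v hv).1, (tail v hv).2]
    exact hw v hv
  · simp only [Finset.mem_filter, Finset.mem_univ, true_and]
    rintro _ ⟨v, hv, rfl⟩ _ ⟨v', hv', rfl⟩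
    rw [(tail v hv).1, (tail v' hv').1]
    rintro rfl
    rfl
  · intro v hv
    exact ⟨ε v hv, by simpa using ⟨v, hv, rfl⟩, (tail v hv).1⟩
  · simp only [Finset.mem_filter, Finset.mem_univ, true_and]
    rintro _ ⟨v, hv, rfl⟩
    rw [(tail v hv).1]
    exact hv

namespace SpanningTree

variable {r : V} (T : SpanningTree G r)

/-- The vertex where an oriented edge starts. -/
noncomputable def tail (e : E) : V := G.orientedTail T.reversed e

/-- The vertex where an oriented edge ends. -/
noncomputable def head (e : E) : V := G.orientedHead T.reversed e

theorem rank_head_lt {e : E} (he : e ∈ T.tree) : T.rank (T.head e) < T.rank (T.tail e) :=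
  T.rank_lt e he

include T in
-- Finiteness of the vertex set follows from that of the edges, because each vertex except the root
-- is the tail of an edge.
theorem finite_vertices [Finite E] : Finite V := by
  have : (Set.univ : Set V) ⊆ {r} ∪ Set.range T.tail := by
    intro v _
    by_cases hv : v = r
    · exact Or.inl hv
    · obtain ⟨e, -, he⟩ := T.exists_mem v hv
      exact Or.inr ⟨e, he⟩
  exact Set.finite_univ_iff.1 (((Set.finite_singleton r).union (Set.finite_range _)).subset this)

theorem sum_tree_tail [Fintype V] (g : V → ℝ) :
    ∑ e ∈ T.tree, g (T.tail e) = ∑ v, g v - g r := by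
  classical
  rw [← Finset.sum_image (f := g) (g := T.tail) (fun e he e' he' h => T.tail_inj e he e' he' h),
    ← Finset.add_sum_erase _ _ (Finset.mem_univ r), add_sub_cancel_left]
  congr 1
  ext v
  simp only [Finset.mem_image, Finset.mem_erase, Finset.mem_univ, and_true]
  exact ⟨fun ⟨e, he, h⟩ => h ▸ T.tail_ne e he, fun hv => T.exists_mem v hv⟩

open Classical in
/-- The quantity flowing into the start of each edge when the amount `A v` leaves the vertex `v`
towards the root. -/
noncomputable def start (A : V → ℝ) (e : E) : ℝ := if e ∈ T.tree then A (T.tail e) else 0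

/-- Conservation: what leaves a vertex is what has arrived, every edge contributing `m e`. -/
def IsFlow [Fintype E] (m : E → ℝ) (A : V → ℝ) : Prop :=
  open Classical in ∀ v, A v = ∑ e with T.head e = v, (T.start A e + m e)

/-- The flow at a vertex depends on vertices farther from the root, hence the reversed order on
ranks; it is well founded because there are finitely many vertices. -/
theorem wellFounded_rank [Finite E] : WellFounded fun v w : V => T.rank w < T.rank v := by
  have := T.finite_vertices
  have : IsTrans V fun v w : V => T.rank w < T.rank v := ⟨fun _ _ _ h1 h2 => h2.trans h1⟩
  have : Std.Irrefl fun v w : V => T.rank w < T.rank v := ⟨fun _ => lt_irrefl _⟩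
  exact Finite.wellFounded_of_trans_of_irrefl _

variable [Fintype E]

theorem exists_isFlow (m : E → ℝ) : ∃ A, T.IsFlow m A := by
  classical
  let A : V → ℝ := T.wellFounded_rank.fix fun v IH =>
    -- The summation range already gives `T.head e = v`; repeating it in the condition makes the
    -- proof of descent available to the recursion.
    ∑ e with T.head e = v, ((if h : e ∈ T.tree ∧ T.head e = v then
      IH (T.tail e) (h.2 ▸ T.rank_head_lt h.1) else 0) + m e)
  refine ⟨A, fun v => ?_⟩
  have : A v = _ := T.wellFounded_rank.fix_eq _ v
  rw [this]
  refine Finset.sum_congr rfl fun e he => ?_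
  have hv := (Finset.mem_filter.1 he).2
  by_cases h : e ∈ T.tree
  · rw [dif_pos ⟨h, hv⟩, start, if_pos h]
  · rw [dif_neg fun h' => h h'.1, start, if_neg h]

variable {T} {m : E → ℝ} {A : V → ℝ}

theorem IsFlow.nonneg (hA : T.IsFlow m A) (hm : ∀ e, 0 ≤ m e) (v : V) : 0 ≤ A v := by
  classical
  induction v using T.wellFounded_rank.induction with
  | _ v ih =>
    rw [hA v]
    refine Finset.sum_nonneg fun e he => add_nonneg ?_ (hm e)
    have hv := (Finset.mem_filter.1 he).2
    unfold start
    split_ifs with h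
    · exact ih _ (hv ▸ T.rank_head_lt h)
    · exact le_rfl

theorem IsFlow.start_nonneg (hA : T.IsFlow m A) (hm : ∀ e, 0 ≤ m e) (e : E) :
    0 ≤ T.start A e := by
  unfold start
  split_ifs
  · exact hA.nonneg hm _
  · exact le_rfl

/-- Summing the conservation law over all vertices cancels the flow through every tail of the tree,
that is, through every vertex but the root. -/
theorem IsFlow.root (hA : T.IsFlow m A) : A r = ∑ e, m e := by
  classical
  have := T.finite_vertices
  have := Fintype.ofFinite V
  have h1 : ∑ v, A v = ∑ e, (T.start A e + m e) := by
    rw [← Finset.sum_fiberwise _ T.head]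
    exact Finset.sum_congr rfl fun v _ => hA v
  have h2 : ∑ e, T.start A e = ∑ v, A v - A r := by
    rw [← T.sum_tree_tail]
    simp [start, Finset.sum_ite_mem]
  rw [Finset.sum_add_distrib, h2] at h1
  linarith

theorem IsFlow.le_head (hA : T.IsFlow m A) (hm : ∀ e, 0 ≤ m e) (e : E) :
    T.start A e + m e ≤ A (T.head e) := by
  classical
  rw [hA (T.head e)]
  exact Finset.single_le_sum (f := fun e => T.start A e + m e)
    (fun e _ => add_nonneg (hA.start_nonneg hm e) (hm e)) (by simp)

/-- The flow does not decrease along a tree edge, and following tree edges leads to the root. -/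
theorem IsFlow.le_root (hA : T.IsFlow m A) (hm : ∀ e, 0 ≤ m e) (v : V) : A v ≤ ∑ e, m e := by
  have key : ∀ n v, T.rank v = n → A v ≤ ∑ e, m e := by
    intro n
    induction n using Nat.strong_induction_on with
    | _ n ih =>
      intro v hn
      by_cases hv : v = r
      · rw [hv, hA.root]
      · obtain ⟨e, he, hev⟩ := T.exists_mem v hv
        have h1 := hA.le_head hm e
        have hev : T.tail e = v := hev
        have h0 := T.rank_head_lt he
        rw [hev, hn] at h0
        have h2 := ih _ h0 _ rfl
        rw [start, if_pos he, hev] at h1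
        have := hm e
        linarith
  exact key _ v rfl

end SpanningTree

end Tree

end MetricGraph

/-! ### Charts, oriented restrictions to edges, and the calibration on the graph. -/

theorem AbsolutelyContinuousOnInterval.comp_sub_left {X : Type*} [PseudoMetricSpace X] {f : ℝ → X}
    {l : ℝ} (hf : AbsolutelyContinuousOnInterval f 0 l) :
    AbsolutelyContinuousOnInterval (fun x => f (l - x)) 0 l := by
  rw [absolutelyContinuousOnInterval_iff] at hf ⊢
  intro ε hε
  obtain ⟨δ, hδ, h⟩ := hf ε hε
  refine ⟨δ, hδ, fun I hI hlt => h (I.1, fun i => (l - (I.2 i).1, l - (I.2 i).2)) ⟨?_, ?_⟩ ?_⟩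
  · intro i hi
    have := hI.1 i hi
    simp only [Set.mem_uIcc] at this ⊢
    grind
  · intro i hi j hj hij
    have := hI.2 hi hj hij
    simp only [Function.onFun, Set.uIoc, Set.Ioc_disjoint_Ioc] at this ⊢
    rw [min_sub_sub_left, min_sub_sub_left, max_sub_sub_left, max_sub_sub_left, max_sub_sub_left,
      min_sub_sub_left]
    linarith
  · simpa only [dist_sub_left] using hlt

namespace MetricGraph

variable {V E H : Type*} {G : MetricGraph V E H}

theorem edist_mk_le {p q : G.Pt} {r : ℝ≥0} (h : G.Joined p q r) :
    edist (SeparationQuotient.mk p : G.Space) (SeparationQuotient.mk q) ≤ r := by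
  rw [SeparationQuotient.edist_mk]
  exact iInf₂_le r h

theorem clamp_of_mem {i : E ⊕ H} {x : ℝ} (hx : x ∈ G.interval i) : G.clamp i x = x := by
  rcases i with e | h
  · simp [clamp, min_eq_left hx.2, hx.1]
  · exact max_eq_right hx

theorem chart_of_mem {i : E ⊕ H} {x : ℝ} (hx : x ∈ G.interval i) :
    G.chart i x = SeparationQuotient.mk ⟨i, x, hx⟩ := by
  unfold chart
  congr
  exact clamp_of_mem hx

theorem mk_eq_chart (p : G.Pt) : (SeparationQuotient.mk p : G.Space) = G.chart p.edge p.coord :=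
  (chart_of_mem p.mem).symm

theorem lipschitzWith_clamp (i : E ⊕ H) : LipschitzWith 1 (G.clamp i) := by
  rcases i with e | h
  · exact (LipschitzWith.id.min_const _).const_max _
  · exact LipschitzWith.id.const_max _

theorem lipschitzWith_chart (i : E ⊕ H) : LipschitzWith 1 (G.chart i) := by
  intro x y
  refine (edist_mk_le (Joined.along ⟨i, G.clamp i x, G.clamp_mem i x⟩
    ⟨i, G.clamp i y, G.clamp_mem i y⟩ rfl)).trans ?_
  rw [← edist_nndist]
  exact lipschitzWith_clamp i x y

theorem continuous_chart (i : E ⊕ H) : Continuous (G.chart i) := (lipschitzWith_chart i).continuous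

theorem endAt_src (e : E) : G.EndAt (Sum.inl e) 0 (G.src e) := Or.inl ⟨rfl, rfl⟩

theorem endAt_tgt (e : E) : G.EndAt (Sum.inl e) (G.len e) (G.tgt e) := Or.inr ⟨rfl, rfl⟩

theorem endAt_origin (h : H) : G.EndAt (Sum.inr h) 0 (G.origin h) := ⟨rfl, rfl⟩

theorem EndAt.mem {i : E ⊕ H} {x : ℝ} {v : V} (h : G.EndAt i x v) : x ∈ G.interval i := by
  rcases i with e | h'
  · rcases h with ⟨rfl, -⟩ | ⟨rfl, -⟩
    · exact ⟨le_rfl, (G.len_pos e).le⟩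
    · exact ⟨(G.len_pos e).le, le_rfl⟩
  · exact h.1.ge

theorem EndAt.chart_eq {i j : E ⊕ H} {x y : ℝ} {v : V} (hi : G.EndAt i x v) (hj : G.EndAt j y v) :
    G.chart i x = G.chart j y := by
  rw [chart_of_mem hi.mem, chart_of_mem hj.mem, SeparationQuotient.mk_eq_mk]
  exact EMetric.inseparable_iff.2 (le_antisymm (iInf₂_le (0 : ℝ≥0) (Joined.glue _ _ v hi hj)) zero_le)

section Value

variable {Y : Type*} [Zero Y]

open Classical in
/-- The value of a function at a vertex. -/
noncomputable def vertexValue (u : G.Space → Y) (v : V) : Y :=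
  if h : ∃ p : (E ⊕ H) × ℝ, G.EndAt p.1 p.2 v then u (G.chart h.choose.1 h.choose.2) else 0

/-- All ends attached at a vertex are at distance zero, so the end selected in `vertexValue` does
not matter. -/
theorem EndAt.apply_chart {i : E ⊕ H} {x : ℝ} {v : V} (h : G.EndAt i x v) (u : G.Space → Y) :
    u (G.chart i x) = vertexValue u v := by
  have h' : ∃ p : (E ⊕ H) × ℝ, G.EndAt p.1 p.2 v := ⟨(i, x), h⟩
  rw [vertexValue, dif_pos h', h.chart_eq h'.choose_spec]

end Value

variable {𝕜 : Type*} [RCLike 𝕜] {u : G.Space → 𝕜}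

section

variable (hu : u ∈ G.H1 𝕜)
include hu

theorem continuous_comp_chart (i : E ⊕ H) : Continuous fun x => u (G.chart i x) :=
  hu.1.comp (continuous_chart i)

theorem integrableOn_norm_sq (i : E ⊕ H) :
    IntegrableOn (fun x => ‖u (G.chart i x)‖ ^ 2) (G.interval i) :=
  (memLp_two_iff_integrable_sq_norm (hu.2 i).2.1.1).1 (hu.2 i).2.1

theorem integrableOn_norm_deriv_sq (i : E ⊕ H) :
    IntegrableOn (fun x => ‖deriv (fun x => u (G.chart i x)) x‖ ^ 2) (G.interval i) :=
  (memLp_two_iff_integrable_sq_norm (hu.2 i).2.2.1).1 (hu.2 i).2.2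

theorem absolutelyContinuous_halfLine (h : H) {l : ℝ} (hl : 0 ≤ l) :
    AbsolutelyContinuousOnInterval (fun x => u (G.chart (Sum.inr h) x)) 0 l :=
  (hu.2 (Sum.inr h)).1 0 (Set.mem_Ici.2 le_rfl) l hl

theorem absolutelyContinuous_edge (e : E) :
    AbsolutelyContinuousOnInterval (fun x => u (G.chart (Sum.inl e) x)) 0 (G.len e) :=
  (hu.2 (Sum.inl e)).1 0 ⟨le_rfl, (G.len_pos e).le⟩ _ ⟨(G.len_pos e).le, le_rfl⟩

theorem intervalIntegrable_norm_deriv_sq (e : E) :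
    IntervalIntegrable (fun x => ‖deriv (fun x => u (G.chart (Sum.inl e) x)) x‖ ^ 2) volume
      0 (G.len e) :=
  (intervalIntegrable_iff_integrableOn_Icc_of_le (G.len_pos e).le).2
    (integrableOn_norm_deriv_sq hu (Sum.inl e))

end

/-- The mass of `u` on a bounded edge. -/
noncomputable def edgeMass (u : G.Space → 𝕜) (e : E) : ℝ :=
  ∫ x in (0 : ℝ)..G.len e, ‖u (G.chart (Sum.inl e) x)‖ ^ 2

/-- The mass of `u` on a half-line. -/
noncomputable def halfLineMass (u : G.Space → 𝕜) (h : H) : ℝ :=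
  ∫ x in Set.Ioi 0, ‖u (G.chart (Sum.inr h) x)‖ ^ 2

theorem edgeMass_nonneg (u : G.Space → 𝕜) (e : E) : 0 ≤ edgeMass u e :=
  intervalIntegral.integral_nonneg (G.len_pos e).le fun _ _ => by positivity

theorem halfLineMass_nonneg (u : G.Space → 𝕜) (h : H) : 0 ≤ halfLineMass u h := by
  unfold halfLineMass; positivity

section

variable [Fintype E] [Fintype H]

theorem normPow_eq (p : ℕ) (u : G.Space → 𝕜) : G.normPow p u =
    ∑ e, (∫ x in (0 : ℝ)..G.len e, ‖u (G.chart (Sum.inl e) x)‖ ^ p) +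
    ∑ h, ∫ x in Set.Ioi 0, ‖u (G.chart (Sum.inr h) x)‖ ^ p := by
  unfold normPow
  rw [Fintype.sum_sum_type]
  congr 1
  · refine Finset.sum_congr rfl fun e _ => ?_
    rw [intervalIntegral.integral_of_le (G.len_pos e).le]
    exact integral_Icc_eq_integral_Ioc
  · exact Finset.sum_congr rfl fun h _ => integral_Ici_eq_integral_Ioi

theorem normPow_two_eq (u : G.Space → 𝕜) :
    G.normPow 2 u = ∑ e, edgeMass u e + ∑ h, halfLineMass u h := normPow_eq 2 u

theorem kinetic_eq (u : G.Space → 𝕜) : G.kinetic u =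
    ∑ e, (∫ x in (0 : ℝ)..G.len e, ‖deriv (fun y => u (G.chart (Sum.inl e) y)) x‖ ^ 2) +
    ∑ h, ∫ x in Set.Ioi 0, ‖deriv (fun y => u (G.chart (Sum.inr h) y)) x‖ ^ 2 := by
  unfold kinetic
  rw [Fintype.sum_sum_type]
  congr 1
  · refine Finset.sum_congr rfl fun e _ => ?_
    rw [intervalIntegral.integral_of_le (G.len_pos e).le]
    exact integral_Icc_eq_integral_Ioc
  · exact Finset.sum_congr rfl fun h _ => integral_Ici_eq_integral_Ioi

end

namespace SpanningTree

variable {r : V} (T : SpanningTree G r)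

open Classical in
/-- The restriction of `u` to a bounded edge, in the direction of its orientation. -/
noncomputable def edgeFun (u : G.Space → 𝕜) (e : E) (x : ℝ) : 𝕜 :=
  u (G.chart (Sum.inl e) (if T.reversed e then G.len e - x else x))

theorem edgeFun_zero (u : G.Space → 𝕜) (e : E) :
    T.edgeFun u e 0 = vertexValue u (T.tail e) := by
  unfold edgeFun tail orientedTail
  split_ifs
  · rw [sub_zero]; exact (endAt_tgt e).apply_chart u
  · exact (endAt_src e).apply_chart u

theorem edgeFun_len (u : G.Space → 𝕜) (e : E) :
    T.edgeFun u e (G.len e) = vertexValue u (T.head e) := by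
  unfold edgeFun head orientedHead
  split_ifs
  · rw [sub_self]; exact (endAt_src e).apply_chart u
  · exact (endAt_tgt e).apply_chart u

theorem integral_edgeFun (u : G.Space → 𝕜) (e : E) (p : ℕ) :
    ∫ x in (0 : ℝ)..G.len e, ‖T.edgeFun u e x‖ ^ p =
      ∫ x in (0 : ℝ)..G.len e, ‖u (G.chart (Sum.inl e) x)‖ ^ p := by
  unfold edgeFun
  split_ifs
  · rw [intervalIntegral.integral_comp_sub_left (fun x => ‖u (G.chart (Sum.inl e) x)‖ ^ p)]
    simp
  · rfl

theorem norm_deriv_edgeFun (u : G.Space → 𝕜) (e : E) (x : ℝ) : ‖deriv (T.edgeFun u e) x‖ =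
    ‖deriv (fun y => u (G.chart (Sum.inl e) y)) (open Classical in
      if T.reversed e then G.len e - x else x)‖ := by
  unfold edgeFun
  split_ifs
  · rw [deriv_comp_const_sub (fun y => u (G.chart (Sum.inl e) y)), norm_neg]
  · rfl

theorem integral_deriv_edgeFun (u : G.Space → 𝕜) (e : E) :
    ∫ x in (0 : ℝ)..G.len e, ‖deriv (T.edgeFun u e) x‖ ^ 2 =
      ∫ x in (0 : ℝ)..G.len e, ‖deriv (fun y => u (G.chart (Sum.inl e) y)) x‖ ^ 2 := by
  simp only [norm_deriv_edgeFun]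
  split_ifs
  · rw [intervalIntegral.integral_comp_sub_left
      (fun x => ‖deriv (fun y => u (G.chart (Sum.inl e) y)) x‖ ^ 2)]
    simp
  · rfl

theorem accMass_edgeFun (u : G.Space → 𝕜) (e : E) (a : ℝ) :
    accMass (T.edgeFun u e) a (G.len e) = a + edgeMass u e := by
  rw [accMass, integral_edgeFun]; rfl

section

variable (hu : u ∈ G.H1 𝕜)
include hu

theorem continuous_edgeFun (e : E) : Continuous (T.edgeFun u e) := by
  have := continuous_comp_chart hu (Sum.inl e)
  unfold edgeFun
  split_ifs
  · exact this.comp (continuous_const.sub continuous_id)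
  · exact this

theorem absolutelyContinuous_edgeFun (e : E) :
    AbsolutelyContinuousOnInterval (T.edgeFun u e) 0 (G.len e) := by
  have := absolutelyContinuous_edge hu e
  unfold edgeFun
  split_ifs
  · exact this.comp_sub_left
  · exact this

theorem intervalIntegrable_deriv_edgeFun (e : E) :
    IntervalIntegrable (fun x => ‖deriv (T.edgeFun u e) x‖ ^ 2) volume 0 (G.len e) := by
  have := intervalIntegrable_norm_deriv_sq hu e
  simp only [norm_deriv_edgeFun]
  split_ifs
  · simpa using (this.comp_sub_left (G.len e)).symm
  · exact this

end

variable [Fintype E]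

/-- The defect of superadditivity at a vertex. -/
noncomputable def gap (m : E → ℝ) (A : V → ℝ) (c : ℝ) (v : V) : ℝ :=
  open Classical in
  tanWeight c (A v) - ∑ e with T.head e = v, tanWeight c (T.start A e + m e)

variable {T} {A : V → ℝ} {m : E → ℝ}

theorem IsFlow.gap_nonneg (hA : T.IsFlow m A) (hm : ∀ e, 0 ≤ m e) {c : ℝ} (hc : 0 < c) {v : V}
    (h : c * A v < Real.pi / 4) : 0 ≤ T.gap m A c v := by
  classical
  have := hA v
  rw [this] at h
  rw [gap, this, sub_nonneg]
  exact sum_tanWeight_le hc _ _ (fun e => add_nonneg (hA.start_nonneg hm e) (hm e)) h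

open Classical in
/-- The calibration inequality on a graph: the quantity `∫|u'|² - c²∫|u|⁶` dominates all
defects. -/
theorem calibration [Fintype V] [Fintype H] (hu : u ∈ G.H1 𝕜) {h₀ : H} {T : SpanningTree G (G.origin h₀)}
    (hA : T.IsFlow (edgeMass u) A) {c : ℝ} (hc : 0 < c)
    (h0 : c * (A (G.origin h₀) + halfLineMass u h₀) < Real.pi / 4)
    (h1 : ∀ h, h ≠ h₀ → c * halfLineMass u h < Real.pi / 4) {N : ℝ} (hN : 0 ≤ N) :
    ∑ e, deficit (T.edgeFun u e) c (T.start A e) (G.len e) +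
    ∑ h, deficit (fun x => u (G.chart (Sum.inr h) x)) c
      (if h = h₀ then A (G.origin h₀) else 0) N +
    ∑ v, ‖vertexValue u v‖ ^ 4 * T.gap (edgeMass u) A c v ≤
      G.kinetic u - c ^ 2 * G.normPow 6 u := by
  have hm := edgeMass_nonneg u
  have hE : ∀ e, deficit (T.edgeFun u e) c (T.start A e) (G.len e) =
      (∫ x in (0 : ℝ)..G.len e, ‖deriv (fun y => u (G.chart (Sum.inl e) y)) x‖ ^ 2) -
      c ^ 2 * (∫ x in (0 : ℝ)..G.len e, ‖u (G.chart (Sum.inl e) x)‖ ^ 6) +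
      ‖vertexValue u (T.head e)‖ ^ 4 * tanWeight c (T.start A e + edgeMass u e) -
      ‖vertexValue u (T.tail e)‖ ^ 4 * tanWeight c (T.start A e) := by
    intro e
    rw [deficit_eq (G.len_pos e).le (T.continuous_edgeFun hu e) hc (hA.start_nonneg hm e) ?_
      (T.absolutelyContinuous_edgeFun hu e) (T.intervalIntegrable_deriv_edgeFun hu e),
      integral_deriv_edgeFun, integral_edgeFun, edgeFun_zero, edgeFun_len, accMass_edgeFun]
    rw [accMass_edgeFun]
    refine (mul_le_mul_of_nonneg_left ?_ hc.le).trans_lt h0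
    have := hA.le_head hm e
    have := hA.le_root hm (T.head e)
    have := halfLineMass_nonneg u h₀
    rw [hA.root]
    linarith
  -- The chosen half-line continues the flow that has arrived at the root. Every other half-line
  -- starts with zero mass and so has no boundary term at its origin.
  have hH : ∀ h, deficit (fun x => u (G.chart (Sum.inr h) x)) c
      (if h = h₀ then A (G.origin h₀) else 0) N ≤
      (∫ x in Set.Ioi 0, ‖deriv (fun y => u (G.chart (Sum.inr h) y)) x‖ ^ 2) -
      c ^ 2 * (∫ x in Set.Ioi 0, ‖u (G.chart (Sum.inr h) x)‖ ^ 6) -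
      (if h = h₀ then
        ‖vertexValue u (G.origin h₀)‖ ^ 4 * tanWeight c (A (G.origin h₀)) else 0) := by
    intro h
    have hd := (integrableOn_norm_deriv_sq hu (Sum.inr h)).mono_set Set.Ioi_subset_Ici_self
    have hi := (integrableOn_norm_sq hu (Sum.inr h)).mono_set Set.Ioi_subset_Ici_self
    have key : ∀ a, 0 ≤ a → c * (a + halfLineMass u h) < Real.pi / 4 → _ := fun a ha hM =>
      deficit_le_of_halfLine (continuous_comp_chart hu (Sum.inr h))
        (fun l hl => absolutelyContinuous_halfLine hu h hl) hd hi hc ha hM hN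
    by_cases hh : h = h₀
    · subst hh
      have := key _ (hA.nonneg hm _) h0
      rw [(endAt_origin h).apply_chart u] at this
      rwa [if_pos rfl, if_pos rfl]
    · have := key 0 le_rfl (by rw [zero_add]; exact h1 h hh)
      simpa only [if_neg hh, tanWeight_zero, mul_zero] using this
  -- Edges outside the tree start with weight zero, and tree tails run once through all vertices
  -- except the root. The missing root term is the boundary term of `h₀`.
  have hsum1 : ∑ e, ‖vertexValue u (T.tail e)‖ ^ 4 * tanWeight c (T.start A e) =
      ∑ v, ‖vertexValue u v‖ ^ 4 * tanWeight c (A v) -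
        ‖vertexValue u (G.origin h₀)‖ ^ 4 * tanWeight c (A (G.origin h₀)) := by
    rw [← T.sum_tree_tail fun v => ‖vertexValue u v‖ ^ 4 * tanWeight c (A v),
      ← Finset.sum_subset (Finset.subset_univ T.tree)]
    · exact Finset.sum_congr rfl fun e he => by rw [start, if_pos he]
    · intro e _ he
      rw [start, if_neg he, tanWeight_zero, mul_zero]
  have hsum2 : ∑ e, ‖vertexValue u (T.head e)‖ ^ 4 * tanWeight c (T.start A e + edgeMass u e) =
      ∑ v, ‖vertexValue u v‖ ^ 4 *
        ∑ e with T.head e = v, tanWeight c (T.start A e + edgeMass u e) := by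
    rw [← Finset.sum_fiberwise _ T.head]
    refine Finset.sum_congr rfl fun v _ => ?_
    rw [Finset.mul_sum]
    exact Finset.sum_congr rfl fun e he => by rw [(Finset.mem_filter.1 he).2]
  have hsum3 := Finset.sum_le_sum fun h (_ : h ∈ Finset.univ) => hH h
  rw [kinetic_eq, normPow_eq, Finset.sum_congr rfl fun e _ => hE e]
  simp only [gap, mul_sub, Finset.sum_sub_distrib, Finset.sum_add_distrib, hsum1, hsum2,
    ← Finset.mul_sum, mul_add] at hsum3 ⊢
  rw [Finset.sum_ite_eq' Finset.univ h₀, if_pos (Finset.mem_univ _)] at hsum3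
  linarith

end SpanningTree

end MetricGraph

/-! ### The sharp Gagliardo–Nirenberg inequality and its equality case. -/

namespace MetricGraph

variable {V E H : Type*} {G : MetricGraph V E H} {𝕜 : Type*} [RCLike 𝕜] [Fintype E] [Fintype H]
  {u : G.Space → 𝕜}

theorem normPow_nonneg (p : ℕ) (u : G.Space → 𝕜) : 0 ≤ G.normPow p u :=
  Finset.sum_nonneg fun _ _ => integral_nonneg fun _ => by positivity

theorem kinetic_nonneg (u : G.Space → 𝕜) : 0 ≤ G.kinetic u :=
  Finset.sum_nonneg fun _ _ => integral_nonneg fun _ => by positivity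

theorem halfLineMass_add_le {h₁ h₂ : H} (h : h₁ ≠ h₂) (u : G.Space → 𝕜) :
    ∑ e, edgeMass u e + (halfLineMass u h₁ + halfLineMass u h₂) ≤ G.normPow 2 u := by
  classical
  rw [normPow_two_eq]
  gcongr
  rw [← Finset.sum_pair h]
  exact Finset.sum_le_sum_of_subset_of_nonneg (Finset.subset_univ _)
    fun h _ _ => halfLineMass_nonneg u h

theorem sum_edgeMass_add_le (h : H) (u : G.Space → 𝕜) :
    ∑ e, edgeMass u e + halfLineMass u h ≤ G.normPow 2 u := by
  rw [normPow_two_eq]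
  gcongr
  exact Finset.single_le_sum (f := halfLineMass u) (fun h _ => halfLineMass_nonneg u h)
    (Finset.mem_univ h)

theorem halfLineMass_le (h : H) (u : G.Space → 𝕜) : halfLineMass u h ≤ G.normPow 2 u :=
  (le_add_of_nonneg_left (Finset.sum_nonneg fun e _ => edgeMass_nonneg u e)).trans
    (sum_edgeMass_add_le h u)

section Terms

open SpanningTree

variable [Fintype V] (hu : u ∈ G.H1 𝕜) {h₀ : H} {T : SpanningTree G (G.origin h₀)} {A : V → ℝ}
  (hA : T.IsFlow (edgeMass u) A) {c : ℝ} (hc : 0 < c)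
  (h0 : c * (A (G.origin h₀) + halfLineMass u h₀) < Real.pi / 4)
  (h1 : ∀ h, h ≠ h₀ → c * halfLineMass u h < Real.pi / 4)
include hu hA hc h0 h1

open Classical in
-- All terms of `calibration` are nonnegative, so each is bounded by the total. The mass carried
-- into `h₀` and that of each other half-line are bounded separately, not through the full mass;
-- this slack excludes a second half-line in `subsingleton_halfLines`.
theorem calibration_terms {N : ℝ} (hN : 0 ≤ N) :
    (∀ e, deficit (T.edgeFun u e) c (T.start A e) (G.len e) ≤
      G.kinetic u - c ^ 2 * G.normPow 6 u) ∧
    (∀ h, deficit (fun x => u (G.chart (Sum.inr h) x)) c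
      (if h = h₀ then A (G.origin h₀) else 0) N ≤ G.kinetic u - c ^ 2 * G.normPow 6 u) ∧
    (∀ v, ‖vertexValue u v‖ ^ 4 * T.gap (edgeMass u) A c v ≤
      G.kinetic u - c ^ 2 * G.normPow 6 u) ∧
    0 ≤ G.kinetic u - c ^ 2 * G.normPow 6 u := by
  have key := calibration hu hA hc h0 h1 hN
  have p1 : ∀ e ∈ Finset.univ, 0 ≤ deficit (T.edgeFun u e) c (T.start A e) (G.len e) :=
    fun e _ => deficit_nonneg _ _ _ (G.len_pos e).le
  have p2 : ∀ h ∈ Finset.univ, 0 ≤ deficit (fun x => u (G.chart (Sum.inr h) x)) c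
      (if h = h₀ then A (G.origin h₀) else 0) N := fun h _ => deficit_nonneg _ _ _ hN
  have p3 : ∀ v ∈ Finset.univ, 0 ≤ ‖vertexValue u v‖ ^ 4 * T.gap (edgeMass u) A c v := by
    refine fun v _ => mul_nonneg (by positivity) (hA.gap_nonneg (edgeMass_nonneg u) hc ?_)
    refine (mul_le_mul_of_nonneg_left ?_ hc.le).trans_lt h0
    have := hA.le_root (edgeMass_nonneg u) v
    rw [← hA.root] at this
    exact this.trans (le_add_of_nonneg_right (halfLineMass_nonneg u h₀))
  have s1 := Finset.sum_nonneg p1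
  have s2 := Finset.sum_nonneg p2
  have s3 := Finset.sum_nonneg p3
  refine ⟨fun e => ?_, fun h => ?_, fun v => ?_, by linarith⟩
  · have := Finset.single_le_sum p1 (Finset.mem_univ e); linarith
  · have := Finset.single_le_sum p2 (Finset.mem_univ h); linarith
  · have := Finset.single_le_sum p3 (Finset.mem_univ v); linarith

end Terms

/-- The sharp Gagliardo–Nirenberg inequality, before passing to the limiting constant. -/
theorem sq_mul_normPow_six_le [Nonempty H] (hu : u ∈ G.H1 𝕜) {c : ℝ} (hc : 0 < c)
    (h : c * G.normPow 2 u < Real.pi / 4) : c ^ 2 * G.normPow 6 u ≤ G.kinetic u := by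
  obtain ⟨h₀⟩ := ‹Nonempty H›
  obtain ⟨T⟩ := exists_spanningTree G (G.origin h₀)
  have := T.finite_vertices
  have := Fintype.ofFinite V
  obtain ⟨A, hA⟩ := T.exists_isFlow (edgeMass u)
  refine sub_nonneg.1 (calibration_terms hu hA hc ?_ (fun h' _ => ?_) le_rfl).2.2.2
  · rw [hA.root]
    exact (mul_le_mul_of_nonneg_left (sum_edgeMass_add_le h₀ u) hc.le).trans_lt h
  · exact (mul_le_mul_of_nonneg_left (halfLineMass_le h' u) hc.le).trans_lt h

theorem gagliardo_nirenberg [Nonempty H] (hu : u ∈ G.H1 𝕜) :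
    Real.pi ^ 2 * G.normPow 6 u ≤ 16 * G.normPow 2 u ^ 2 * G.kinetic u := by
  rcases (normPow_nonneg 2 u).eq_or_lt with hm | hm
  · rw [← hm]
    have h6 : G.normPow 6 u ≤ 0 := by
      by_contra! h6
      have hk := kinetic_nonneg u
      -- For zero mass every `c` is admissible; this one makes `c² ‖u‖₆⁶` exceed the kinetic term.
      have := sq_mul_normPow_six_le hu
        (c := G.kinetic u / G.normPow 6 u + 1) (by positivity)
        (by rw [← hm, mul_zero]; positivity)
      have e : G.kinetic u / G.normPow 6 u * G.normPow 6 u = G.kinetic u := by field_simp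
      have e0 : 0 ≤ G.kinetic u / G.normPow 6 u := by positivity
      nlinarith [mul_nonneg e0 hk]
    nlinarith [Real.pi_pos]
  · have hlim : Filter.Tendsto (fun c : ℝ => c ^ 2 * G.normPow 6 u)
        (nhdsWithin (Real.pi / 4 / G.normPow 2 u) (Set.Iio (Real.pi / 4 / G.normPow 2 u)))
        (nhds ((Real.pi / 4 / G.normPow 2 u) ^ 2 * G.normPow 6 u)) :=
      Filter.Tendsto.mono_left (Continuous.tendsto (by fun_prop) _) nhdsWithin_le_nhds
    have h0 : 0 < Real.pi / 4 / G.normPow 2 u := by positivity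
    have := le_of_tendsto hlim (b := G.kinetic u) (by
      filter_upwards [Ioo_mem_nhdsLT h0] with c hc
      exact sq_mul_normPow_six_le hu hc.1 ((lt_div_iff₀ hm).1 hc.2))
    have e : (Real.pi / 4 / G.normPow 2 u) ^ 2 * G.normPow 6 u =
      Real.pi ^ 2 * G.normPow 6 u / (16 * G.normPow 2 u ^ 2) := by field_simp; ring
    rw [e, div_le_iff₀ (by positivity)] at this
    linarith

section Equality

theorem mul_lt_of_mul_le {k c x : ℝ} (hkc : k < c) (hx : 0 ≤ x) (h : c * x ≤ Real.pi / 4) :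
    k * x < Real.pi / 4 := by
  rcases hx.eq_or_lt with rfl | hx
  · rw [mul_zero]; positivity
  · exact (mul_lt_mul_of_pos_right hkc hx).trans_le h

open SpanningTree

variable [Fintype V] (hu : u ∈ G.H1 𝕜) {h₀ : H} {T : SpanningTree G (G.origin h₀)} {A : V → ℝ}
  (hA : T.IsFlow (edgeMass u) A) {c : ℝ} (hm : c * G.normPow 2 u = Real.pi / 4)
  (heq : G.kinetic u = c ^ 2 * G.normPow 6 u)
include hu hA hm heq

open Classical in
-- Equality at the critical constant `c` turns the right-hand side for `k < c` into a quantity that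
-- tends to zero as `k → c`.
theorem calibration_terms_of_eq {k : ℝ} (hk : 0 < k) (hkc : k < c) {N : ℝ} (hN : 0 ≤ N) :
    (∀ e, deficit (T.edgeFun u e) k (T.start A e) (G.len e) ≤
      (c ^ 2 - k ^ 2) * G.normPow 6 u) ∧
    (∀ h, deficit (fun x => u (G.chart (Sum.inr h) x)) k
      (if h = h₀ then A (G.origin h₀) else 0) N ≤ (c ^ 2 - k ^ 2) * G.normPow 6 u) ∧
    (∀ v, ‖vertexValue u v‖ ^ 4 * T.gap (edgeMass u) A k v ≤
      (c ^ 2 - k ^ 2) * G.normPow 6 u) := by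
  have hlt : k * G.normPow 2 u < Real.pi / 4 := mul_lt_of_mul_le hkc (normPow_nonneg 2 u) hm.le
  have key := calibration_terms hu hA hk (by
    rw [hA.root]
    exact (mul_le_mul_of_nonneg_left (sum_edgeMass_add_le h₀ u) hk.le).trans_lt hlt)
    (fun h' _ => (mul_le_mul_of_nonneg_left (halfLineMass_le h' u) hk.le).trans_lt hlt) hN
  rw [heq, ← sub_mul] at key
  exact ⟨key.1, key.2.1, key.2.2.1⟩

omit [Fintype V] hu hA heq in
theorem pos_of_mul_eq : 0 < G.normPow 2 u := by
  refine (normPow_nonneg 2 u).lt_of_ne fun h => ?_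
  rw [← h, mul_zero] at hm
  linarith [Real.pi_pos]

omit [Fintype V] hu hA heq in
theorem const_pos_of_mul_eq : 0 < c :=
  pos_of_mul_pos_left (hm ▸ by positivity) (pos_of_mul_eq hm).le

theorem edge_dichotomy (e : E) :
    (vertexValue u (T.tail e) = 0 → ∀ x ∈ Set.Icc 0 (G.len e), T.edgeFun u e x = 0) ∧
    (vertexValue u (T.tail e) ≠ 0 → ∀ x ∈ Set.Icc 0 (G.len e), T.edgeFun u e x ≠ 0) := by
  have hc := const_pos_of_mul_eq hm
  have hl := G.len_pos e
  have hcont := T.continuous_edgeFun hu e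
  have hac := T.absolutelyContinuous_edgeFun hu e
  have hd := T.intervalIntegrable_deriv_edgeFun hu e
  have hs := hA.start_nonneg (edgeMass_nonneg u) e
  have htot : T.start A e + edgeMass u e ≤ G.normPow 2 u :=
    ((hA.le_head (edgeMass_nonneg u) e).trans (hA.le_root (edgeMass_nonneg u) _)).trans
      ((le_add_of_nonneg_right (halfLineMass_nonneg u h₀)).trans (sum_edgeMass_add_le h₀ u))
  have hM : c * accMass (T.edgeFun u e) (T.start A e) (G.len e) ≤ Real.pi / 4 := by
    rw [accMass_edgeFun, ← hm]
    exact mul_le_mul_of_nonneg_left htot hc.le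
  have h : ∀ y ∈ Set.Icc 0 (G.len e), c * accMass (T.edgeFun u e) (T.start A e) y < Real.pi / 4 →
      deficit (T.edgeFun u e) c (T.start A e) y = 0 := by
    intro y hy hlt
    have hsub : Set.uIcc 0 y ⊆ Set.uIcc 0 (G.len e) := by
      rw [Set.uIcc_of_le hy.1, Set.uIcc_of_le hl.le]; exact Set.Icc_subset_Icc_right hy.2
    refine deficit_eq_zero_of_limit hcont hc hs hy.1 hlt (hac.mono hsub) (hd.mono_set hsub)
      (C := G.normPow 6 u) fun k hk hkc => ?_
    refine (deficit_mono hcont hk hs ?_ hac hd hy).trans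
      ((calibration_terms_of_eq hu hA hm heq hk hkc le_rfl).1 e)
    exact mul_lt_of_mul_le hkc (hs.trans (le_accMass hcont _ hl.le)) hM
  rw [← edgeFun_zero]
  exact ⟨fun h0 => eq_zero_of_deficit_eq_zero hcont hc hs hl hM hac hd h h0,
    fun h0 => (ne_zero_of_deficit_eq_zero hcont hc hs hl hM hac hd h h0).1⟩

open Classical in
theorem halfLine_dichotomy (h : H) :
    (vertexValue u (G.origin h) = 0 → ∀ x, 0 ≤ x → u (G.chart (Sum.inr h) x) = 0) ∧
    (vertexValue u (G.origin h) ≠ 0 → ∀ x, 0 ≤ x → u (G.chart (Sum.inr h) x) ≠ 0) := by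
  have hc := const_pos_of_mul_eq hm
  set a := if h = h₀ then A (G.origin h₀) else 0 with ha
  have ha0 : 0 ≤ a := by
    rw [ha]; split_ifs
    exacts [hA.nonneg (edgeMass_nonneg u) _, le_rfl]
  have hcont := continuous_comp_chart hu (Sum.inr h)
  have hi := (integrableOn_norm_sq hu (Sum.inr h)).mono_set Set.Ioi_subset_Ici_self
  have hd0 := (integrableOn_norm_deriv_sq hu (Sum.inr h)).mono_set Set.Ioi_subset_Ici_self
  have htot : a + halfLineMass u h ≤ G.normPow 2 u := by
    rw [ha]; split_ifs with hh
    · rw [hh, hA.root]; exact sum_edgeMass_add_le h₀ u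
    · rw [zero_add]; exact halfLineMass_le h u
  have hM : ∀ l, 0 ≤ l → c * accMass (fun x => u (G.chart (Sum.inr h) x)) a l ≤ Real.pi / 4 := by
    intro l hl
    rw [← hm]
    exact mul_le_mul_of_nonneg_left ((accMass_le_total hi a hl).trans htot) hc.le
  have hdef : ∀ y, 0 ≤ y → c * accMass (fun x => u (G.chart (Sum.inr h) x)) a y < Real.pi / 4 →
      deficit (fun x => u (G.chart (Sum.inr h) x)) c a y = 0 := fun y hy hlt =>
    deficit_eq_zero_of_limit hcont hc ha0 hy hlt (absolutelyContinuous_halfLine hu h hy)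
      (intervalIntegrable_of_integrableOn_Ioi hd0 hy) (C := G.normPow 6 u) fun k hk hkc =>
      (calibration_terms_of_eq hu hA hm heq hk hkc hy).2.1 h
  -- The rigidity lemmas need an interval of positive length containing `x`, also for `x = 0`.
  have hl : ∀ x : ℝ, 0 ≤ x → 0 < x + 1 := fun x hx => by linarith
  rw [← (endAt_origin h).apply_chart u]
  exact ⟨fun h0 x hx => eq_zero_of_deficit_eq_zero hcont hc ha0 (hl x hx) (hM _ (hl x hx).le)
      (absolutelyContinuous_halfLine hu h (hl x hx).le)
      (intervalIntegrable_of_integrableOn_Ioi hd0 (hl x hx).le) (fun y hy => hdef y hy.1) h0 x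
      ⟨hx, by linarith⟩,
    fun h0 x hx => (ne_zero_of_deficit_eq_zero hcont hc ha0 (hl x hx) (hM _ (hl x hx).le)
      (absolutelyContinuous_halfLine hu h (hl x hx).le)
      (intervalIntegrable_of_integrableOn_Ioi hd0 (hl x hx).le) (fun y hy => hdef y hy.1) h0).1 x
      ⟨hx, by linarith⟩⟩

/-- The edge dichotomy carries both vanishing and nonvanishing from tail to head, so both spread
through the connected graph. -/
theorem vertexValue_eq_zero_iff (v w : V) : vertexValue u v = 0 ↔ vertexValue u w = 0 := by
  have he : ∀ e, vertexValue u (T.tail e) = 0 ↔ vertexValue u (T.head e) = 0 := by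
    intro e
    have hd := edge_dichotomy hu hA hm heq e
    have hl : G.len e ∈ Set.Icc 0 (G.len e) := ⟨(G.len_pos e).le, le_rfl⟩
    refine ⟨fun h => ?_, fun h => ?_⟩
    · rw [← edgeFun_len]; exact hd.1 h _ hl
    · by_contra h'
      exact hd.2 h' _ hl (by rw [edgeFun_len, h])
  induction G.connected v w with
  | rel x y h =>
    obtain ⟨e, rfl, rfl⟩ := h
    have := he e
    unfold SpanningTree.tail SpanningTree.head orientedTail orientedHead at this
    split_ifs at this
    exacts [this.symm, this]
  | refl => rfl
  | symm x y _ ih => exact ih.symm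
  | trans x y z _ _ h1 h2 => exact h1.trans h2

theorem vertexValue_ne_zero (v : V) : vertexValue u v ≠ 0 := by
  intro h0
  have hz : ∀ w, vertexValue u w = 0 := fun w =>
    (vertexValue_eq_zero_iff hu hA hm heq w v).2 h0
  have hmpos := pos_of_mul_eq hm
  refine hmpos.ne' ?_
  rw [normPow_two_eq, Finset.sum_eq_zero, Finset.sum_eq_zero, add_zero]
  · intro h _
    refine (setIntegral_congr_fun measurableSet_Ioi (g := fun _ => (0 : ℝ)) fun x hx => ?_).trans
      (by simp)
    simp [(halfLine_dichotomy hu hA hm heq h).1 (hz _) x (le_of_lt hx)]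
  · intro e _
    have := T.integral_edgeFun u e 2
    rw [edgeMass, ← this]
    refine (intervalIntegral.integral_congr (g := fun _ => (0 : ℝ)) fun x hx => ?_).trans (by simp)
    rw [Set.uIcc_of_le (G.len_pos e).le] at hx
    simp [(edge_dichotomy hu hA hm heq e).1 (hz _) x hx]

theorem edgeMass_pos (e : E) : 0 < edgeMass u e := by
  have := T.integral_edgeFun u e 2
  rw [edgeMass, ← this]
  have hc := T.continuous_edgeFun hu e
  refine intervalIntegral.integral_pos (G.len_pos e) (Continuous.continuousOn (by fun_prop))
    (fun _ _ => by positivity) ⟨0, ⟨le_rfl, (G.len_pos e).le⟩, ?_⟩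
  rw [edgeFun_zero]
  have := vertexValue_ne_zero hu hA hm heq (T.tail e)
  positivity

theorem halfLine_integral_pos (h : H) {p : ℕ}
    (hi : IntegrableOn (fun x => ‖u (G.chart (Sum.inr h) x)‖ ^ p) (Set.Ioi 0)) :
    0 < ∫ x in Set.Ioi 0, ‖u (G.chart (Sum.inr h) x)‖ ^ p := by
  have hc := continuous_comp_chart hu (Sum.inr h)
  refine lt_of_lt_of_le ?_ (intervalIntegral_le_Ioi hi (fun _ => by positivity) zero_le_one)
  refine intervalIntegral.integral_pos one_pos (hc.norm.pow p).continuousOn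
    (fun _ _ => by positivity) ⟨0, ⟨le_rfl, zero_le_one⟩, ?_⟩
  have := vertexValue_ne_zero hu hA hm heq (G.origin h)
  rw [(endAt_origin h).apply_chart u]
  positivity

theorem halfLineMass_pos (h : H) : 0 < halfLineMass u h :=
  halfLine_integral_pos hu hA hm heq h
    ((integrableOn_norm_sq hu (Sum.inr h)).mono_set Set.Ioi_subset_Ici_self)

theorem normPow_six_pos : 0 < G.normPow 6 u := by
  have hi := (integrableOn_norm_sq hu (Sum.inr h₀)).mono_set Set.Ioi_subset_Ici_self
  have hd := (integrableOn_norm_deriv_sq hu (Sum.inr h₀)).mono_set Set.Ioi_subset_Ici_self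
  have h6 := halfLine_integral_pos hu hA hm heq h₀ (integrableOn_norm_pow_six
    (continuous_comp_chart hu (Sum.inr h₀)) (fun l hl => absolutelyContinuous_halfLine hu h₀ hl)
    hd hi)
  refine h6.trans_le ?_
  rw [← integral_Ici_eq_integral_Ioi]
  exact Finset.single_le_sum (f := fun i => ∫ x in G.interval i, ‖u (G.chart i x)‖ ^ 6)
    (fun _ _ => integral_nonneg fun _ => by positivity) (Finset.mem_univ (Sum.inr h₀))

/-- With two half-lines of positive mass no branch of the calibration carries the full mass, so a
constant larger than the critical one is admissible. This contradicts equality, since `‖u‖₆` is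
positive. -/
theorem subsingleton_halfLines : Subsingleton H := by
  have : ∀ h, h = h₀ := by
    intro h₁
    by_contra hne
    have p0 := halfLineMass_pos hu hA hm heq h₀
    have p1 := halfLineMass_pos hu hA hm heq h₁
    have hmpos := pos_of_mul_eq hm
    have hc := const_pos_of_mul_eq hm
    -- Both branches, through `h₀` or along another half-line alone, miss at least the mass `δ`.
    set δ := min (halfLineMass u h₀) (halfLineMass u h₁) with hδ
    have hδ0 : 0 < δ := lt_min p0 p1
    have d0 : δ ≤ halfLineMass u h₀ := min_le_left _ _
    have d1 : δ ≤ halfLineMass u h₁ := min_le_right _ _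
    have hE : 0 ≤ ∑ e, edgeMass u e := Finset.sum_nonneg fun e _ => edgeMass_nonneg u e
    have b0 : A (G.origin h₀) + halfLineMass u h₀ ≤ G.normPow 2 u - δ := by
      have := halfLineMass_add_le (Ne.symm hne) u
      rw [hA.root]; linarith
    have b1 : ∀ h, h ≠ h₀ → halfLineMass u h ≤ G.normPow 2 u - δ := by
      intro h hh
      have := halfLineMass_add_le hh u
      linarith
    have hpos : 0 < G.normPow 2 u - δ := by
      have := hA.nonneg (edgeMass_nonneg u) (G.origin h₀); linarith
    obtain ⟨k, hck, hk⟩ : ∃ k, c < k ∧ k * (G.normPow 2 u - δ) < Real.pi / 4 := by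
      have : c < Real.pi / 4 / (G.normPow 2 u - δ) := by
        rw [lt_div_iff₀ hpos, ← hm]; nlinarith
      obtain ⟨k, h1, h2⟩ := exists_between this
      exact ⟨k, h1, (lt_div_iff₀ hpos).1 h2⟩
    have hk0 := hc.trans hck
    have key := (calibration_terms hu hA hk0 ((mul_le_mul_of_nonneg_left b0 hk0.le).trans_lt hk)
      (fun h hh => (mul_le_mul_of_nonneg_left (b1 h hh) hk0.le).trans_lt hk) le_rfl).2.2.2
    rw [heq] at key
    have h6 := normPow_six_pos hu hA hm heq
    nlinarith [mul_pos (mul_pos (sub_pos.2 hck) (add_pos hc hk0)) h6]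
  exact ⟨fun a b => (this a).trans (this b).symm⟩

/-- Two edges entering a vertex both bring positive mass, so superadditivity is strict and the gap
is positive. As `u` is nonzero there, this contradicts the gap term tending to zero. -/
theorem head_injective : Function.Injective T.head := by
  classical
  intro e e' hee
  by_contra hne
  have hc := const_pos_of_mul_eq hm
  have hm0 := edgeMass_nonneg u
  set v := T.head e with hv
  -- Strict because `h₀` itself has positive mass: the weight at the critical constant is therefore
  -- finite at `v`.
  have hAv : c * A v < Real.pi / 4 := by
    rw [← hm]
    refine mul_lt_mul_of_pos_left ?_ hc
    have := hA.le_root hm0 v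
    have := sum_edgeMass_add_le h₀ u
    have := halfLineMass_pos hu hA hm heq h₀
    linarith
  have hx : ∀ e, 0 ≤ T.start A e + edgeMass u e := fun e =>
    add_nonneg (hA.start_nonneg hm0 e) (hm0 e)
  have hx' : ∀ e, 0 < T.start A e + edgeMass u e := fun e =>
    add_pos_of_nonneg_of_pos (hA.start_nonneg hm0 e) (edgeMass_pos hu hA hm heq e)
  have hgap : 0 < T.gap (edgeMass u) A c v := by
    have e1 := hA v
    rw [gap, sub_pos]
    rw [e1] at hAv ⊢
    exact sum_tanWeight_lt hc _ _ hx hAv (i := e) (j := e') (by simp [hv]) (by simp [hee])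
      hne (hx' e) (hx' e')
  have hlim : Filter.Tendsto (fun k => ‖vertexValue u v‖ ^ 4 * T.gap (edgeMass u) A k v)
      (nhdsWithin c (Set.Iio c)) (nhds (‖vertexValue u v‖ ^ 4 * T.gap (edgeMass u) A c v)) := by
    refine Filter.Tendsto.const_mul _ (Filter.Tendsto.sub
      (tendsto_tanWeight hc (hA.nonneg hm0 v) hAv) (tendsto_finsetSum _ fun i hi =>
        tendsto_tanWeight hc (hx i) ?_))
    refine (mul_le_mul_of_nonneg_left ?_ hc.le).trans_lt hAv
    have := hA.le_head hm0 i
    rwa [(Finset.mem_filter.1 hi).2] at this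
  have hR : Filter.Tendsto (fun k => (c ^ 2 - k ^ 2) * G.normPow 6 u)
      (nhdsWithin c (Set.Iio c)) (nhds 0) :=
    (Continuous.tendsto' (by fun_prop) c 0 (by ring)).mono_left nhdsWithin_le_nhds
  have hle := le_of_tendsto_of_tendsto hlim hR (by
    filter_upwards [Ioo_mem_nhdsLT hc] with k hk
    exact (calibration_terms_of_eq hu hA hm heq hk.1 hk.2 le_rfl).2.2 v)
  have := vertexValue_ne_zero hu hA hm heq v
  have : 0 < ‖vertexValue u v‖ ^ 4 * T.gap (edgeMass u) A c v := by positivity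
  linarith

end Equality

end MetricGraph

/-! ### A chain from the tip is isometric to the half-line. -/

namespace MetricGraph

variable {V E H : Type*} {G : MetricGraph V E H}

/-- The degree counts ends: `pos` enumerates them, both ends of a self-loop being counted. -/
theorem exists_unique_endAt_of_degree_eq_one [Finite E] [Finite H] {t : V} (ht : G.degree t = 1) :
    ∃ i x, G.EndAt i x t ∧ ∀ j y, G.EndAt j y t → j = i ∧ y = x := by
  let pos : ({e // G.src e = t} ⊕ {e // G.tgt e = t}) ⊕ {h // G.origin h = t} → (E ⊕ H) × ℝ :=
    Sum.elim (Sum.elim (fun e => (Sum.inl e.1, 0)) (fun e => (Sum.inl e.1, G.len e.1)))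
      fun h => (Sum.inr h.1, 0)
  have hpos : ∀ i x, G.EndAt i x t ↔ ∃ w, pos w = (i, x) := by
    intro i x
    constructor
    · intro h
      rcases i with e | h'
      · rcases h with ⟨rfl, h⟩ | ⟨rfl, h⟩
        · exact ⟨Sum.inl (Sum.inl ⟨e, h⟩), rfl⟩
        · exact ⟨Sum.inl (Sum.inr ⟨e, h⟩), rfl⟩
      · obtain ⟨rfl, h⟩ := h
        exact ⟨Sum.inr ⟨h', h⟩, rfl⟩
    · rintro ⟨(⟨e, h⟩ | ⟨e, h⟩) | ⟨h', h⟩, hw⟩ <;>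
        obtain ⟨rfl, rfl⟩ := Prod.mk.inj hw
      exacts [Or.inl ⟨rfl, h⟩, Or.inr ⟨rfl, h⟩, ⟨rfl, h⟩]
  rw [degree, ← Nat.card_sum, ← Nat.card_sum, Nat.card_eq_one_iff_unique] at ht
  obtain ⟨hs, ⟨w⟩⟩ := ht
  refine ⟨(pos w).1, (pos w).2, (hpos _ _).2 ⟨w, rfl⟩, fun j y h => ?_⟩
  obtain ⟨w', hw'⟩ := (hpos _ _).1 h
  rw [hs.elim w' w] at hw'
  rw [hw']
  exact ⟨rfl, rfl⟩

theorem edist_mk_eq {s : G.Pt → ℝ} (hs : ∀ p q r, G.Joined p q r → |s p - s q| ≤ r)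
    (hs' : ∀ p q, G.Joined p q (Real.nnabs (s p - s q))) (p q : G.Pt) :
    edist p q = edist (s p) (s q) := by
  rw [edist_dist, Real.dist_eq]
  refine le_antisymm ?_ (le_iInf₂ fun r hr => ?_)
  · refine (iInf₂_le _ (hs' p q)).trans (le_of_eq ?_)
    rw [← ENNReal.ofReal_coe_nnreal, Real.coe_nnabs]
  · exact ENNReal.ofReal_le_of_le_toReal (hs p q r hr)

/-- A coordinate that measures all distances identifies the graph with the half-line. -/
theorem nonempty_isometryEquiv {s : G.Pt → ℝ} (h0 : ∀ p, 0 ≤ s p)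
    (hs : ∀ p q r, G.Joined p q r → |s p - s q| ≤ r)
    (hs' : ∀ p q, G.Joined p q (Real.nnabs (s p - s q))) (hsurj : ∀ y, 0 ≤ y → ∃ p, s p = y) :
    Nonempty (G.Space ≃ᵢ Set.Ici (0 : ℝ)) := by
  choose g hg using hsurj
  have key := edist_mk_eq hs hs'
  let f : Set.Ici (0 : ℝ) → G.Space := fun y => SeparationQuotient.mk (g y.1 y.2)
  have hf : Isometry f := by
    intro y z
    rw [SeparationQuotient.edist_mk, key]
    exact congrArg₂ edist (hg y.1 y.2) (hg z.1 z.2)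
  have hfs : Function.Surjective f := by
    intro p
    obtain ⟨p, rfl⟩ := SeparationQuotient.surjective_mk p
    refine ⟨⟨s p, h0 p⟩, SeparationQuotient.mk_eq_mk.2 (EMetric.inseparable_iff.2 ?_)⟩
    rw [key, edist_eq_zero]
    exact hg (s p) (h0 p)
  exact ⟨(IsometryEquiv.mk (Equiv.ofBijective f ⟨hf.injective, hfs⟩) hf).symm⟩

namespace SpanningTree

variable {h₀ : H} (T : SpanningTree G (G.origin h₀))

open Classical in
/-- The position of the starting point of an oriented edge. -/
noncomputable def tailCoord (e : E) : ℝ := if T.reversed e then G.len e else 0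

open Classical in
/-- The position of the final point of an oriented edge. -/
noncomputable def headCoord (e : E) : ℝ := if T.reversed e then 0 else G.len e

theorem endAt_tail (e : E) : G.EndAt (Sum.inl e) (T.tailCoord e) (T.tail e) := by
  unfold tailCoord tail orientedTail
  split_ifs
  exacts [endAt_tgt e, endAt_src e]

theorem endAt_head (e : E) : G.EndAt (Sum.inl e) (T.headCoord e) (T.head e) := by
  unfold headCoord head orientedHead
  split_ifs
  exacts [endAt_src e, endAt_tgt e]

theorem endAt_cases {e : E} {x : ℝ} {v : V} (h : G.EndAt (Sum.inl e) x v) :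
    (x = T.tailCoord e ∧ v = T.tail e) ∨ (x = T.headCoord e ∧ v = T.head e) := by
  unfold tailCoord headCoord tail head orientedTail orientedHead
  split_ifs
  · exact h.symm.imp (fun h => ⟨h.1, h.2.symm⟩) fun h => ⟨h.1, h.2.symm⟩
  · exact h.imp (fun h => ⟨h.1, h.2.symm⟩) fun h => ⟨h.1, h.2.symm⟩

/-- The edge leads from the vertex `v` to the vertex `w` in the tree. -/
def Step (v w : V) : Prop := ∃ e ∈ T.tree, T.tail e = v ∧ T.head e = w

theorem step_rightUnique : Relator.RightUnique T.Step := by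
  rintro v w w' ⟨e, he, h1, rfl⟩ ⟨e', he', h2, rfl⟩
  rw [T.tail_inj e he e' he' (h1.trans h2.symm)]

theorem reaches_root (v : V) : Relation.ReflTransGen T.Step v (G.origin h₀) := by
  have key : ∀ n v, T.rank v = n → Relation.ReflTransGen T.Step v (G.origin h₀) := by
    intro n
    induction n using Nat.strong_induction_on with
    | _ n ih =>
      intro v hn
      by_cases hv : v = G.origin h₀
      · rw [hv]
      · obtain ⟨e, he, hev⟩ := T.exists_mem v hv
        have hev : T.tail e = v := hev
        have h0 := T.rank_head_lt he
        rw [hev, hn] at h0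
        exact Relation.ReflTransGen.head ⟨e, he, hev, rfl⟩ (ih _ h0 _ rfl)
  exact key _ v rfl

variable [Finite E] [Finite H] {t : V} (ht : G.degree t = 1) (hinj : Function.Injective T.head)

include ht in
-- The tip has one end, which already leads outwards: it belongs to `h₀` at the root, or else to the
-- tree edge leaving the tip, which cannot also return to it since rank drops.
theorem head_ne_of_degree_eq_one (e : E) : T.head e ≠ t := by
  intro he
  obtain ⟨i, x, -, huniq⟩ := exists_unique_endAt_of_degree_eq_one ht
  have h1 := (huniq _ _ (he ▸ T.endAt_head e)).1
  by_cases htr : t = G.origin h₀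
  · have h2 := (huniq _ _ (htr ▸ endAt_origin h₀)).1
    exact Sum.inl_ne_inr (h1.trans h2.symm)
  · obtain ⟨e', he', hev⟩ := T.exists_mem t htr
    have hev : T.tail e' = t := hev
    have h2 := (huniq _ _ (hev ▸ T.endAt_tail e')).1
    obtain rfl : e = e' := Sum.inl_injective (h1.trans h2.symm)
    have := T.rank_head_lt he'
    rw [he, hev] at this
    exact lt_irrefl _ this

include ht hinj in
-- By induction on rank the tip reaches the parent of `v`. The parent is not the tip, so it is
-- entered by a last tree edge, which by injectivity of `head` is the edge coming from `v`.
theorem tip_reaches (v : V) : Relation.ReflTransGen T.Step t v := by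
  have key : ∀ n v, T.rank v = n → Relation.ReflTransGen T.Step t v := by
    intro n
    induction n using Nat.strong_induction_on with
    | _ n ih =>
      intro v hn
      by_cases hv : v = G.origin h₀
      · rw [hv]; exact T.reaches_root t
      · obtain ⟨e, he, hev⟩ := T.exists_mem v hv
        have hev : T.tail e = v := hev
        have h0 := T.rank_head_lt he
        rw [hev, hn] at h0
        obtain h | ⟨y, hy, ⟨e', he', rfl, h2⟩⟩ :=
          Relation.ReflTransGen.cases_tail_iff .. |>.1 (ih _ h0 _ rfl)
        · exact absurd h (T.head_ne_of_degree_eq_one ht e)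
        · rw [hinj h2, hev] at hy
          exact hy
  exact key _ v rfl

include ht hinj in
theorem mem_tree (e : E) : e ∈ T.tree := by
  obtain h | ⟨y, hy, ⟨e', he', rfl, h2⟩⟩ :=
    Relation.ReflTransGen.cases_tail_iff .. |>.1 (T.tip_reaches ht hinj (T.head e))
  · exact absurd h (T.head_ne_of_degree_eq_one ht e)
  · rwa [← hinj h2]

/-- The tail of an edge, half-lines being directed to infinity. -/
noncomputable def tail' : E ⊕ H → V
  | Sum.inl e => T.tail e
  | Sum.inr h => G.origin h

include ht hinj in
theorem tail'_injective [Subsingleton H] : Function.Injective T.tail' := by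
  rintro (e | h) (e' | h') hee
  · rw [T.tail_inj e (T.mem_tree ht hinj e) e' (T.mem_tree ht hinj e') hee]
  · rw [Subsingleton.elim h' h₀] at hee
    exact absurd hee (T.tail_ne e (T.mem_tree ht hinj e))
  · rw [Subsingleton.elim h h₀] at hee
    exact absurd hee.symm (T.tail_ne e' (T.mem_tree ht hinj e'))
  · rw [Subsingleton.elim h h']

end SpanningTree

section Chain

open SpanningTree

variable [Fintype E] [Finite H] [Subsingleton H] {h₀ : H} {T : SpanningTree G (G.origin h₀)}
  {t : V} (ht : G.degree t = 1) (hinj : Function.Injective T.head) {L : V → ℝ}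
  (hL : T.IsFlow G.len L)

include ht hinj hL

omit [Subsingleton H] in
-- For the flow of lengths, a single incoming edge at each head makes `L` the arc length from the
-- tip.
theorem flow_head (e : E) : L (T.head e) = L (T.tail e) + G.len e := by
  classical
  rw [hL (T.head e)]
  have : (Finset.univ.filter fun e' => T.head e' = T.head e) = {e} := by
    ext e'
    simp only [Finset.mem_filter, Finset.mem_univ, true_and, Finset.mem_singleton]
    exact hinj.eq_iff
  rw [this, Finset.sum_singleton, start, if_pos (T.mem_tree ht hinj e)]

omit hinj [Subsingleton H] in
theorem flow_tip : L t = 0 := by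
  classical
  rw [hL t, Finset.filter_false_of_mem fun e _ => T.head_ne_of_degree_eq_one ht e,
    Finset.sum_empty]

variable (T L) in
open Classical in
omit [Fintype E] [Finite H] [Subsingleton H] ht hinj hL in
/-- The distance of a point from the tip. -/
noncomputable def arc : G.Pt → ℝ
  | ⟨Sum.inl e, x, _⟩ => L (T.tail e) + if T.reversed e then G.len e - x else x
  | ⟨Sum.inr h, x, _⟩ => L (G.origin h) + x

omit [Finite H] [Subsingleton H] ht hinj in
theorem arc_nonneg (p : G.Pt) : 0 ≤ arc T L p := by
  have h0 := hL.nonneg fun e => (G.len_pos e).le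
  obtain ⟨e | h, x, hx⟩ := p
  · refine add_nonneg (h0 _) ?_
    split_ifs
    · exact sub_nonneg.2 hx.2
    · exact hx.1
  · exact add_nonneg (h0 _) hx

omit [Fintype E] [Finite H] [Subsingleton H] ht hinj hL in
theorem abs_arc_sub {p q : G.Pt} (h : p.edge = q.edge) :
    |arc T L p - arc T L q| = |p.coord - q.coord| := by
  obtain ⟨i, x, hx⟩ := p
  obtain ⟨j, y, hy⟩ := q
  obtain rfl : i = j := h
  rcases i with e | h
  · simp only [arc]
    split_ifs
    · rw [add_sub_add_left_eq_sub, sub_sub_sub_cancel_left, abs_sub_comm]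
    · rw [add_sub_add_left_eq_sub]
  · simp only [arc]
    rw [add_sub_add_left_eq_sub]

omit [Subsingleton H] in
theorem arc_endAt {p : G.Pt} {v : V} (h : G.EndAt p.edge p.coord v) :
    arc T L p = L v := by
  obtain ⟨e | h', x, hx⟩ := p
  · rcases T.endAt_cases h with ⟨hx', rfl⟩ | ⟨hx', rfl⟩
    · have hx' : x = T.tailCoord e := hx'
      simp only [arc, hx', tailCoord]
      split_ifs <;> simp
    · have hx' : x = T.headCoord e := hx'
      rw [flow_head ht hinj hL]
      simp only [arc, hx', headCoord]
      split_ifs <;> simp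
  · obtain ⟨h1, h2⟩ := h
    have h1 : x = 0 := h1
    simp [arc, h1, ← h2]

omit [Subsingleton H] in
theorem abs_arc_sub_le {p q : G.Pt} {r : ℝ≥0} (h : G.Joined p q r) :
    |arc T L p - arc T L q| ≤ r := by
  induction h with
  | along p q h => rw [abs_arc_sub h, coe_nndist, Real.dist_eq]
  | glue p q v hp hq => simp [arc_endAt ht hinj hL hp, arc_endAt ht hinj hL hq]
  | trans p q s r t _ _ h1 h2 =>
    rw [NNReal.coe_add]
    exact (abs_sub_le _ _ _).trans (add_le_add h1 h2)

omit [Subsingleton H] in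
theorem joined_of_reaches {v w : V} (h : Relation.ReflTransGen T.Step v w) :
    L v ≤ L w ∧ ∀ p q : G.Pt, G.EndAt p.edge p.coord v → G.EndAt q.edge q.coord w →
      G.Joined p q (L w - L v).toNNReal := by
  induction h with
  | refl =>
    refine ⟨le_rfl, fun p q hp hq => ?_⟩
    rw [sub_self, Real.toNNReal_zero]
    exact Joined.glue p q v hp hq
  | @tail y w _ hyw ih =>
    obtain ⟨e, he, rfl, rfl⟩ := hyw
    have hf := flow_head ht hinj hL e
    have hl := G.len_pos e
    refine ⟨by linarith [ih.1], fun p q hp hq => ?_⟩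
    have e1 : (L (T.head e) - L v).toNNReal =
        (L (T.tail e) - L v).toNNReal + (nndist (T.tailCoord e) (T.headCoord e) + 0) := by
      apply NNReal.eq
      rw [NNReal.coe_add, NNReal.coe_add, Real.coe_toNNReal _ (by linarith [ih.1]),
        Real.coe_toNNReal _ (by linarith [ih.1]), hf, coe_nndist, Real.dist_eq, NNReal.coe_zero,
        tailCoord, headCoord]
      split_ifs <;> simp [abs_of_pos hl] <;> ring
    rw [e1]
    refine Joined.trans _ ⟨Sum.inl e, _, (T.endAt_tail e).mem⟩ _ _ _ (ih.2 _ _ hp (T.endAt_tail e))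
      (Joined.trans _ ⟨Sum.inl e, _, (T.endAt_head e).mem⟩ _ _ _ (Joined.along _ _ rfl)
        (Joined.glue _ _ _ (T.endAt_head e) hq))

omit [Fintype E] [Finite H] [Subsingleton H] ht hinj hL in
theorem tail'_le_arc (p : G.Pt) : L (T.tail' p.edge) ≤ arc T L p := by
  obtain ⟨e | h, x, hx⟩ := p
  · refine le_add_of_nonneg_right ?_
    split_ifs
    · exact sub_nonneg.2 hx.2
    · exact hx.1
  · exact le_add_of_nonneg_right hx

/-- The path leaves `p` through the head `z` of its edge, follows the tree to the starting point `w`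
of the edge of `q`, and ends along that edge. Its three lengths add up to the difference of arc
lengths. -/
theorem joined_of_reaches_tail' {p q : G.Pt} (hpq : p.edge ≠ q.edge)
    (h : Relation.ReflTransGen T.Step (T.tail' p.edge) (T.tail' q.edge)) :
    arc T L p ≤ arc T L q ∧ G.Joined p q (arc T L q - arc T L p).toNNReal := by
  have hne : T.tail' p.edge ≠ T.tail' q.edge := fun h' => hpq (T.tail'_injective ht hinj h')
  obtain h | ⟨y, ⟨e, he, h1, h2⟩, hy⟩ := Relation.ReflTransGen.cases_head_iff.1 h
  · exact absurd h hne
  have hpe : p.edge = Sum.inl e := T.tail'_injective ht hinj h1.symm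
  obtain ⟨hle, hj⟩ := joined_of_reaches ht hinj hL hy
  obtain ⟨w, hw, hqw⟩ : ∃ w : G.Pt, w.edge = q.edge ∧ G.EndAt w.edge w.coord (T.tail' q.edge) := by
    obtain ⟨e' | h', x, hx⟩ := q
    · exact ⟨⟨Sum.inl e', _, (T.endAt_tail e').mem⟩, rfl, T.endAt_tail e'⟩
    · exact ⟨⟨Sum.inr h', 0, (endAt_origin h').mem⟩, rfl, endAt_origin h'⟩
  let z : G.Pt := ⟨Sum.inl e, _, (T.endAt_head e).mem⟩
  have hz : G.EndAt z.edge z.coord y := h2 ▸ T.endAt_head e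
  have sz := arc_endAt ht hinj hL hz
  have sw := arc_endAt ht hinj hL hqw
  have sq := tail'_le_arc (T := T) (L := L) q
  have sp : arc T L p ≤ arc T L z := by
    rw [sz, ← h2, flow_head ht hinj hL]
    obtain ⟨i, x, hx⟩ := p
    obtain rfl : i = Sum.inl e := hpe
    simp only [arc]
    gcongr
    split_ifs
    · linarith [hx.1]
    · exact hx.2
  refine ⟨by linarith, ?_⟩
  have e1 : (arc T L q - arc T L p).toNNReal = nndist p.coord z.coord +
      ((L (T.tail' q.edge) - L y).toNNReal + nndist w.coord q.coord) := by
    apply NNReal.eq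
    rw [NNReal.coe_add, NNReal.coe_add, Real.coe_toNNReal _ (by linarith),
      Real.coe_toNNReal _ (by linarith), coe_nndist, coe_nndist, Real.dist_eq, Real.dist_eq,
      ← abs_arc_sub (T := T) (L := L) (p := p) (q := z) hpe, ← abs_arc_sub (T := T) (L := L) hw,
      abs_sub_comm, abs_of_nonneg (by linarith), abs_sub_comm, abs_of_nonneg (by linarith)]
    linarith
  rw [e1]
  exact Joined.trans _ z _ _ _ (Joined.along _ _ hpe)
    (Joined.trans _ w _ _ _ (hj _ _ hz hqw) (Joined.along _ _ hw))

/-- Both starting vertices lie on the path from the tip, which is deterministic, so one of them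
reaches the other. -/
theorem joined_arc (p q : G.Pt) : G.Joined p q (Real.nnabs (arc T L p - arc T L q)) := by
  by_cases hpq : p.edge = q.edge
  · have : Real.nnabs (arc T L p - arc T L q) = nndist p.coord q.coord := by
      apply NNReal.eq
      rw [Real.coe_nnabs, abs_arc_sub hpq, coe_nndist, Real.dist_eq]
    rw [this]
    exact Joined.along p q hpq
  · have hn : ∀ x y : ℝ, x ≤ y → Real.nnabs (x - y) = (y - x).toNNReal := fun x y h => by
      apply NNReal.eq
      rw [Real.coe_nnabs, Real.coe_toNNReal _ (sub_nonneg.2 h), abs_sub_comm,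
        abs_of_nonneg (sub_nonneg.2 h)]
    have hn' : ∀ x y : ℝ, Real.nnabs (x - y) = Real.nnabs (y - x) := fun x y => by
      apply NNReal.eq
      rw [Real.coe_nnabs, Real.coe_nnabs, abs_sub_comm]
    rcases Relation.ReflTransGen.total_of_right_unique T.step_rightUnique
      (T.tip_reaches ht hinj (T.tail' p.edge)) (T.tip_reaches ht hinj (T.tail' q.edge)) with h | h
    · obtain ⟨h1, h2⟩ := joined_of_reaches_tail' ht hinj hL hpq h
      rwa [hn _ _ h1]
    · obtain ⟨h1, h2⟩ := joined_of_reaches_tail' ht hinj hL (Ne.symm hpq) h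
      rw [hn', hn _ _ h1]
      exact h2.symm

omit [Subsingleton H] in
theorem exists_arc_eq (y : ℝ) (hy : 0 ≤ y) : ∃ p, arc T L p = y := by
  by_cases hr : L (G.origin h₀) ≤ y
  · exact ⟨⟨Sum.inr h₀, y - L (G.origin h₀), sub_nonneg.2 hr⟩, by simp [arc]⟩
  push Not at hr
  have key : ∀ v, Relation.ReflTransGen T.Step t v → y ≤ L v → ∃ p, arc T L p = y := by
    intro v hv
    induction hv with
    | refl =>
      intro hyt
      obtain ⟨i, x, hx, -⟩ := exists_unique_endAt_of_degree_eq_one ht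
      refine ⟨⟨i, x, hx.mem⟩, ?_⟩
      rw [arc_endAt ht hinj hL (p := ⟨i, x, hx.mem⟩) hx]
      rw [flow_tip ht hL] at hyt ⊢
      linarith
    | @tail v w _ hvw ih =>
      intro hyw
      by_cases h : y ≤ L v
      · exact ih h
      · obtain ⟨e, he, rfl, rfl⟩ := hvw
        rw [flow_head ht hinj hL] at hyw
        push Not at h
        by_cases hrev : T.reversed e
        · refine ⟨⟨Sum.inl e, G.len e - (y - L (T.tail e)), by linarith, by linarith⟩, ?_⟩
          simp [arc, hrev]
        · refine ⟨⟨Sum.inl e, y - L (T.tail e), by linarith, by linarith⟩, ?_⟩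
          simp [arc, hrev]
  exact key _ (T.tip_reaches ht hinj _) hr.le

omit hL in
theorem nonempty_isometryEquiv_of_chain : Nonempty (G.Space ≃ᵢ Set.Ici (0 : ℝ)) := by
  obtain ⟨L, hL⟩ := T.exists_isFlow G.len
  exact nonempty_isometryEquiv (arc_nonneg hL) (fun p q r h => abs_arc_sub_le ht hinj hL h)
    (joined_arc ht hinj hL) (exists_arc_eq ht hinj hL)

end Chain

end MetricGraph

/-! ### Test functions supported on one edge. -/

namespace MetricGraph

variable {V E H : Type*} {G : MetricGraph V E H}

/-- A Lipschitz function on an edge that vanishes at its ends, except possibly at terminal points,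
extends by zero to a Lipschitz function on the graph. -/
theorem exists_lipschitz_extension (i : E ⊕ H) {g : ℝ → ℝ} {K : ℝ≥0} (hK : K ≠ 0)
    (hg : LipschitzWith K g)
    (hend : ∀ x v, G.EndAt i x v → g x ≠ 0 → ∀ j y, G.EndAt j y v → j = i ∧ y = x) :
    ∃ φ : G.Space → ℝ, LipschitzWith K φ ∧ (∀ x ∈ G.interval i, φ (G.chart i x) = g x) ∧
      ∀ j ≠ i, ∀ x, φ (G.chart j x) = 0 := by
  classical
  let F : G.Pt → ℝ := fun p => if p.edge = i then g p.coord else 0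
  have hglue : ∀ (p q : G.Pt) v, G.EndAt p.edge p.coord v → G.EndAt q.edge q.coord v →
      F p ≠ 0 → F p = F q := by
    intro p q v hp hq h0
    by_cases hpi : p.edge = i
    · have h0' : g p.coord ≠ 0 := by simpa [F, hpi] using h0
      obtain ⟨h1, h2⟩ := hend _ v (hpi ▸ hp) h0' _ _ hq
      simp [F, hpi, h1, h2]
    · simp [F, hpi] at h0
  have hJ : ∀ p q r, G.Joined p q r → dist (F p) (F q) ≤ K * r := by
    intro p q r h
    induction h with
    | along p q h =>
      rw [coe_nndist]
      by_cases hpi : p.edge = i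
      · simpa only [F, ← h, hpi, if_true] using hg.dist_le_mul _ _
      · simp only [F, ← h, hpi, if_false, dist_self]
        positivity
    | glue p q v hp hq =>
      have : F p = F q := by
        by_cases h0 : F p = 0
        · by_cases h1 : F q = 0
          · rw [h0, h1]
          · exact (hglue q p v hq hp h1).symm
        · exact hglue p q v hp hq h0
      simp [this]
    | trans p q s r t _ _ h1 h2 =>
      rw [NNReal.coe_add, mul_add]
      exact (dist_triangle _ _ _).trans (add_le_add h1 h2)
  have hF : LipschitzWith K F := by
    intro p q
    change _ ≤ (K : ℝ≥0∞) * ⨅ (r : ℝ≥0) (_ : G.Joined p q r), (r : ℝ≥0∞)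
    -- A nonzero constant passes through the infimum over paths.
    rw [ENNReal.mul_iInf_of_ne (by simpa using hK) (by simp)]
    refine le_iInf fun r => ?_
    rw [ENNReal.mul_iInf_of_ne (by simpa using hK) (by simp)]
    refine le_iInf fun hr => ?_
    rw [edist_nndist, ← ENNReal.coe_mul, ENNReal.coe_le_coe]
    exact hJ p q r hr
  have hins : ∀ p q : G.Pt, Inseparable p q → F p = F q := fun p q h =>
    (h.map hF.continuous).eq
  refine ⟨SeparationQuotient.lift F hins, ?_, fun x hx => ?_, fun j hj x => ?_⟩
  · intro a b
    obtain ⟨p, rfl⟩ := SeparationQuotient.surjective_mk a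
    obtain ⟨q, rfl⟩ := SeparationQuotient.surjective_mk b
    rw [SeparationQuotient.edist_mk]
    exact hF p q
  · rw [chart_of_mem hx]
    exact if_pos rfl
  · exact if_neg hj

/-- Charts are constant beyond the ends of an edge and derivatives are two-sided, so derivatives are
compared in the interior only; the endpoints are null. -/
theorem ae_interval_mem_nhds (i : E ⊕ H) :
    ∀ᵐ x ∂(volume.restrict (G.interval i)), G.interval i ∈ nhds x := by
  rcases i with e | h
  · change ∀ᵐ x ∂(volume.restrict (Set.Icc 0 (G.len e))), _
    rw [← Measure.restrict_congr_set Ioo_ae_eq_Icc, ae_restrict_iff' measurableSet_Ioo]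
    exact ae_of_all _ fun x hx => Icc_mem_nhds hx.1 hx.2
  · change ∀ᵐ x ∂(volume.restrict (Set.Ici 0)), _
    rw [← Measure.restrict_congr_set Ioi_ae_eq_Ici, ae_restrict_iff' measurableSet_Ioi]
    exact ae_of_all _ fun x hx => Ici_mem_nhds hx

theorem norm_deriv_ofReal_comp {𝕜 : Type*} [RCLike 𝕜] (g : ℝ → ℝ) (x : ℝ) :
    deriv (fun y => (g y : 𝕜)) x = ((deriv g x : ℝ) : 𝕜) := by
  by_cases h : DifferentiableAt ℝ g x
  · exact ((RCLike.ofRealCLM (K := 𝕜)).hasFDerivAt.comp_hasDerivAt x h.hasDerivAt).deriv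
  · rw [deriv_zero_of_not_differentiableAt h, deriv_zero_of_not_differentiableAt, RCLike.ofReal_zero]
    intro h'
    refine h (((RCLike.reCLM (K := 𝕜)).differentiableAt.comp x h').congr_of_eventuallyEq ?_)
    exact Filter.Eventually.of_forall fun y => by simp

variable {𝕜 : Type*} [RCLike 𝕜] [Fintype E] [Fintype H]

variable (𝕜) in
-- Off the edge `i` the function vanishes, so all integrals reduce to this edge; the exponent is
-- nonzero because `0 ^ 0 = 1` would count the other edges.
theorem exists_localized (i : E ⊕ H) {g : ℝ → ℝ} {K : ℝ≥0} (hg : LipschitzWith K g)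
    (hend : ∀ x v, G.EndAt i x v → g x ≠ 0 → ∀ j y, G.EndAt j y v → j = i ∧ y = x)
    (hsupp : HasCompactSupport g) :
    ∃ u ∈ G.H1 𝕜, (∀ p, p ≠ 0 → G.normPow p u = ∫ x in G.interval i, |g x| ^ p) ∧
      G.kinetic u = ∫ x in G.interval i, deriv g x ^ 2 := by
  obtain ⟨φ, hφ, h1, h2⟩ :=
    exists_lipschitz_extension i (K := K + 1) (by positivity) (hg.weaken (by simp)) hend
  have ae0 : ∀ᵐ x ∂(volume.restrict (G.interval i)), φ (G.chart i x) = g x :=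
    (ae_interval_mem_nhds i).mono fun x hx => h1 x (mem_of_mem_nhds hx)
  have aed : ∀ᵐ x ∂(volume.restrict (G.interval i)),
      deriv (fun x => (φ (G.chart i x) : 𝕜)) x = ((deriv g x : ℝ) : 𝕜) := by
    refine (ae_interval_mem_nhds i).mono fun x hx => ?_
    rw [← norm_deriv_ofReal_comp]
    refine Filter.EventuallyEq.deriv_eq ?_
    filter_upwards [hx] with y hy
    rw [h1 y hy]
  have hdsupp : HasCompactSupport (deriv g) := hsupp.deriv
  have hm0 : MemLp (fun x => (g x : 𝕜)) 2 (volume.restrict (G.interval i)) :=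
    ((hg.continuous.memLp_of_hasCompactSupport hsupp).restrict _).ofReal
  have hm1 : MemLp (fun x => ((deriv g x : ℝ) : 𝕜)) 2 (volume.restrict (G.interval i)) :=
    ((hdsupp.memLp_of_bound (measurable_deriv g).aestronglyMeasurable K
      (ae_of_all _ fun x => norm_deriv_le_of_lipschitz hg)).restrict _).ofReal
  have hz : ∀ j ≠ i, (fun x => (φ (G.chart j x) : 𝕜)) = fun _ => 0 := fun j hj =>
    funext fun x => by rw [h2 j hj, RCLike.ofReal_zero]
  refine ⟨fun x => (φ x : 𝕜), ⟨RCLike.continuous_ofReal.comp hφ.continuous, fun j => ⟨?_, ?_, ?_⟩⟩,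
    fun p hp => ?_, ?_⟩
  · intro a _ b _
    have : LipschitzWith (1 * ((K + 1) * 1)) fun x => (φ (G.chart j x) : 𝕜) :=
      LipschitzWith.comp (g := fun x => φ (G.chart j x)) (f := ((↑) : ℝ → 𝕜))
        (RCLike.ofRealLI (K := 𝕜)).lipschitz (hφ.comp (lipschitzWith_chart j))
    exact this.lipschitzOnWith.absolutelyContinuousOnInterval
  · by_cases hj : j = i
    · subst hj
      refine hm0.ae_eq ?_
      filter_upwards [ae0] with x hx
      rw [hx]
    · rw [hz j hj]; exact MemLp.zero
  · by_cases hj : j = i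
    · subst hj
      refine hm1.ae_eq ?_
      filter_upwards [aed] with x hx
      rw [hx]
    · rw [hz j hj, deriv_const']; exact MemLp.zero
  · unfold normPow
    rw [Finset.sum_eq_single i]
    · refine integral_congr_ae ?_
      filter_upwards [ae0] with x hx
      rw [hx, RCLike.norm_ofReal]
    · intro j _ hj
      simp [h2 j hj, hp]
    · simp
  · unfold kinetic
    rw [Finset.sum_eq_single i]
    · refine integral_congr_ae ?_
      filter_upwards [aed] with x hx
      rw [hx, RCLike.norm_ofReal, sq_abs]
    · intro j _ hj
      rw [hz j hj, deriv_const']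
      simp
    · simp

end MetricGraph

/-! ### The half-soliton and its truncations. -/

section Profile

open Real Set

/-- The profile of the soliton. -/
noncomputable def soliton (x : ℝ) : ℝ := (√(cosh x))⁻¹

theorem soliton_pos (x : ℝ) : 0 < soliton x := inv_pos.2 (sqrt_pos.2 (cosh_pos x))

theorem soliton_neg (x : ℝ) : soliton (-x) = soliton x := by simp [soliton]

theorem soliton_sq (x : ℝ) : soliton x ^ 2 = (cosh x)⁻¹ := by
  rw [soliton, inv_pow, sq_sqrt (cosh_pos x).le]

theorem soliton_pow_six (x : ℝ) : soliton x ^ 6 = (cosh x)⁻¹ ^ 3 := by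
  rw [← soliton_sq, ← pow_mul]

theorem soliton_le_one (x : ℝ) : soliton x ≤ 1 :=
  inv_le_one_of_one_le₀ (one_le_sqrt.2 (one_le_cosh x))

theorem hasDerivAt_soliton (x : ℝ) :
    HasDerivAt soliton (-(1 / 2) * sinh x / cosh x * soliton x) x := by
  have h := ((hasDerivAt_cosh x).sqrt (cosh_pos x).ne').inv (sqrt_pos.2 (cosh_pos x)).ne'
  refine h.congr_deriv ?_
  have := (sqrt_pos.2 (cosh_pos x)).ne'
  have h2 := sq_sqrt (cosh_pos x).le
  have h3 := (cosh_pos x).ne'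
  rw [soliton, h2]
  field_simp

theorem deriv_soliton_sq (x : ℝ) :
    deriv soliton x ^ 2 = 1 / 4 * ((cosh x)⁻¹ - (cosh x)⁻¹ ^ 3) := by
  rw [(hasDerivAt_soliton x).deriv, mul_pow, soliton_sq, div_pow, mul_pow, sinh_sq]
  have h3 := (cosh_pos x).ne'
  field_simp
  ring

theorem abs_deriv_soliton_le (x : ℝ) : |deriv soliton x| ≤ 1 := by
  rw [← sq_le_one_iff_abs_le_one, deriv_soliton_sq]
  have h1 : (cosh x)⁻¹ ≤ 1 := inv_le_one_of_one_le₀ (one_le_cosh x)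
  have h2 : 0 < (cosh x)⁻¹ := inv_pos.2 (cosh_pos x)
  have h3 : 0 < (cosh x)⁻¹ ^ 3 := by positivity
  linarith

theorem lipschitzWith_soliton : LipschitzWith 1 soliton :=
  lipschitzWith_of_nnnorm_deriv_le (fun x => (hasDerivAt_soliton x).differentiableAt)
    fun x => abs_deriv_soliton_le x

theorem soliton_le_of_le {R x : ℝ} (hR : 0 ≤ R) (h : R ≤ |x|) : soliton x ≤ soliton R := by
  refine inv_anti₀ (sqrt_pos.2 (cosh_pos R)) (sqrt_le_sqrt (cosh_le_cosh.2 ?_))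
  rwa [abs_of_nonneg hR]

theorem soliton_le_of_abs_le {R x : ℝ} (hR : 0 ≤ R) (h : |x| ≤ R) : soliton R ≤ soliton x := by
  refine inv_anti₀ (sqrt_pos.2 (cosh_pos x)) (sqrt_le_sqrt (cosh_le_cosh.2 ?_))
  rwa [abs_of_nonneg hR]

theorem hasDerivAt_arctan_sinh (x : ℝ) : HasDerivAt (fun x => arctan (sinh x)) (cosh x)⁻¹ x := by
  refine (hasDerivAt_sinh x).arctan.congr_deriv ?_
  have := (cosh_pos x).ne'
  rw [show 1 + sinh x ^ 2 = cosh x ^ 2 by rw [sinh_sq]; ring]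
  field_simp

theorem hasDerivAt_sech_cube_primitive (x : ℝ) : HasDerivAt
    (fun x => 1 / 2 * (sinh x / cosh x ^ 2 + arctan (sinh x))) ((cosh x)⁻¹ ^ 3) x := by
  have h3 := (cosh_pos x).ne'
  have h := (((hasDerivAt_sinh x).div ((hasDerivAt_cosh x).pow 2) (pow_ne_zero 2 h3)).add
    (hasDerivAt_arctan_sinh x)).const_mul (1 / 2)
  refine h.congr_deriv ?_
  simp only [Pi.pow_apply]
  field_simp
  have := sinh_sq x
  simp only [Nat.cast_ofNat]
  linear_combination (-2 * cosh x) * this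

theorem tendsto_sinh_atTop : Filter.Tendsto sinh Filter.atTop Filter.atTop :=
  Filter.tendsto_atTop_mono' _ (by
    filter_upwards [Filter.eventually_ge_atTop 0] with x hx
    exact self_le_sinh_iff.2 hx) Filter.tendsto_id

theorem tendsto_arctan_sinh : Filter.Tendsto (fun x => arctan (sinh x)) Filter.atTop
    (nhds (π / 2)) :=
  (tendsto_arctan_atTop.comp tendsto_sinh_atTop).mono_right nhdsWithin_le_nhds

theorem tendsto_sech : Filter.Tendsto (fun x => (cosh x)⁻¹) Filter.atTop (nhds 0) := by
  refine Filter.Tendsto.inv_tendsto_atTop ?_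
  exact Filter.tendsto_atTop_mono (fun x => (sinh_lt_cosh x).le) tendsto_sinh_atTop

theorem tendsto_soliton : Filter.Tendsto soliton Filter.atTop (nhds 0) := by
  have := (continuous_sqrt.tendsto 0).comp tendsto_sech
  rw [sqrt_zero] at this
  refine this.congr fun x => ?_
  simp [soliton]

theorem tendsto_sech_cube_primitive : Filter.Tendsto
    (fun x => 1 / 2 * (sinh x / cosh x ^ 2 + arctan (sinh x))) Filter.atTop (nhds (π / 4)) := by
  have h : Filter.Tendsto (fun x => sinh x / cosh x ^ 2) Filter.atTop (nhds 0) := by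
    refine tendsto_of_tendsto_of_tendsto_of_le_of_le' tendsto_const_nhds tendsto_sech ?_ ?_
    · filter_upwards [Filter.eventually_ge_atTop 0] with x hx
      have := sinh_nonneg_iff.2 hx
      positivity
    · filter_upwards with x
      have hc := cosh_pos x
      rw [div_le_iff₀ (by positivity), sq, inv_mul_cancel_left₀ hc.ne']
      exact (sinh_lt_cosh x).le
  have := (h.add tendsto_arctan_sinh).const_mul (1 / 2)
  rwa [zero_add, show 1 / 2 * (π / 2) = π / 4 by ring] at this

theorem integrableOn_sech : IntegrableOn (fun x => (cosh x)⁻¹) (Ioi 0) :=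
  integrableOn_Ioi_deriv_of_nonneg' (fun x _ => hasDerivAt_arctan_sinh x)
    (fun x _ => (inv_pos.2 (cosh_pos x)).le) tendsto_arctan_sinh

theorem integral_sech : ∫ x in Ioi 0, (cosh x)⁻¹ = π / 2 := by
  have := integral_Ioi_of_hasDerivAt_of_nonneg' (a := 0) (fun x _ => hasDerivAt_arctan_sinh x)
    (fun x _ => (inv_pos.2 (cosh_pos x)).le) tendsto_arctan_sinh
  simpa using this

theorem integrableOn_sech_cube : IntegrableOn (fun x => (cosh x)⁻¹ ^ 3) (Ioi 0) :=
  integrableOn_Ioi_deriv_of_nonneg' (fun x _ => hasDerivAt_sech_cube_primitive x)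
    (fun x _ => (pow_pos (inv_pos.2 (cosh_pos x)) 3).le) tendsto_sech_cube_primitive

theorem integral_sech_cube : ∫ x in Ioi 0, (cosh x)⁻¹ ^ 3 = π / 4 := by
  have := integral_Ioi_of_hasDerivAt_of_nonneg' (a := 0)
    (fun x _ => hasDerivAt_sech_cube_primitive x)
    (fun x _ => (pow_pos (inv_pos.2 (cosh_pos x)) 3).le) tendsto_sech_cube_primitive
  simpa using this

theorem integral_soliton_sq : ∫ x in Ioi 0, soliton x ^ 2 = π / 2 := by
  simp_rw [soliton_sq, integral_sech]

theorem integral_soliton_pow_six : ∫ x in Ioi 0, soliton x ^ 6 = π / 4 := by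
  simp_rw [soliton_pow_six, integral_sech_cube]

theorem integrableOn_soliton_sq : IntegrableOn (fun x => soliton x ^ 2) (Ioi 0) := by
  simp_rw [soliton_sq]; exact integrableOn_sech

theorem integrableOn_soliton_pow_six : IntegrableOn (fun x => soliton x ^ 6) (Ioi 0) := by
  simp_rw [soliton_pow_six]; exact integrableOn_sech_cube

theorem integrableOn_deriv_soliton_sq : IntegrableOn (fun x => deriv soliton x ^ 2) (Ioi 0) := by
  simp_rw [deriv_soliton_sq]
  exact (integrableOn_sech.sub integrableOn_sech_cube).const_mul _

/-- Together with the values `π/2` and `π/4` for the second and sixth powers, this gives the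
quotient `16/π²`: the half-soliton is optimal. -/
theorem integral_deriv_soliton_sq : ∫ x in Ioi 0, deriv soliton x ^ 2 = π / 16 := by
  simp_rw [deriv_soliton_sq]
  rw [integral_const_mul, integral_sub integrableOn_sech integrableOn_sech_cube, integral_sech,
    integral_sech_cube]
  ring

/-- The soliton cut off at height `soliton R`. -/
noncomputable def cutoff (R x : ℝ) : ℝ := max (soliton x - soliton R) 0

theorem lipschitzWith_cutoff (R : ℝ) : LipschitzWith 1 (cutoff R) := by
  have := lipschitzWith_soliton.sub (LipschitzWith.const (soliton R))
  rw [add_zero] at this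
  exact this.max_const 0

theorem cutoff_neg (R x : ℝ) : cutoff R (-x) = cutoff R x := by simp [cutoff, soliton_neg]

theorem cutoff_eq_zero {R x : ℝ} (hR : 0 ≤ R) (h : R ≤ |x|) : cutoff R x = 0 :=
  max_eq_right (sub_nonpos.2 (soliton_le_of_le hR h))

theorem cutoff_of_abs_le {R x : ℝ} (hR : 0 ≤ R) (h : |x| ≤ R) :
    cutoff R x = soliton x - soliton R :=
  max_eq_left (sub_nonneg.2 (soliton_le_of_abs_le hR h))

theorem deriv_cutoff_of_lt {R x : ℝ} (hR : 0 ≤ R) (h : |x| < R) :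
    deriv (cutoff R) x = deriv soliton x := by
  have : cutoff R =ᶠ[nhds x] fun x => soliton x - soliton R := by
    filter_upwards [(isOpen_lt continuous_abs continuous_const).mem_nhds h] with y hy
    exact cutoff_of_abs_le hR (le_of_lt hy)
  rw [this.deriv_eq, deriv_sub_const]

theorem deriv_cutoff_of_gt {R x : ℝ} (hR : 0 ≤ R) (h : R < |x|) : deriv (cutoff R) x = 0 := by
  have : cutoff R =ᶠ[nhds x] fun _ => 0 := by
    filter_upwards [(isOpen_lt continuous_const continuous_abs).mem_nhds h] with y hy
    exact cutoff_eq_zero hR (le_of_lt hy)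
  rw [this.deriv_eq, deriv_const]

theorem integral_deriv_cutoff_le {R : ℝ} (hR : 0 ≤ R) :
    ∫ x in Ioi 0, deriv (cutoff R) x ^ 2 ≤ π / 16 := by
  rw [← integral_deriv_soliton_sq]
  refine integral_mono_of_nonneg (ae_of_all _ fun x => by positivity)
    integrableOn_deriv_soliton_sq ?_
  have h0 : ∀ᵐ x ∂(volume.restrict (Ioi (0 : ℝ))), x ≠ R :=
    ae_restrict_of_ae (by simp [ae_iff])
  filter_upwards [h0, ae_restrict_mem measurableSet_Ioi] with x hx hx0
  rcases lt_or_gt_of_ne hx with h | h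
  · simp only [deriv_cutoff_of_lt hR (by rwa [abs_of_pos hx0]), le_refl]
  · simp only [deriv_cutoff_of_gt hR (show R < |x| by rwa [abs_of_pos hx0]), zero_pow two_ne_zero]
    positivity

theorem cutoff_nonneg (R x : ℝ) : 0 ≤ cutoff R x := le_max_right _ _

theorem cutoff_le_soliton (R x : ℝ) : cutoff R x ≤ soliton x :=
  max_le (sub_le_self _ (soliton_pos R).le) (soliton_pos x).le

theorem integral_cutoff_sq_le (R : ℝ) : ∫ x in Ioi 0, cutoff R x ^ 2 ≤ π / 2 := by
  rw [← integral_soliton_sq]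
  exact integral_mono_of_nonneg (ae_of_all _ fun x => by positivity) integrableOn_soliton_sq
    (ae_of_all _ fun x => pow_le_pow_left₀ (cutoff_nonneg R x) (cutoff_le_soliton R x) 2)

/-- Bernoulli gives `(s - r)⁶ ≥ s⁶ - 6rs⁵` where the truncation is active, and `s ≤ 1` replaces `s⁵`
by the integrable `s²`. -/
theorem soliton_pow_six_sub_le_cutoff (R x : ℝ) :
    soliton x ^ 6 - 6 * soliton R * soliton x ^ 2 ≤ cutoff R x ^ 6 := by
  have hx := soliton_pos x
  have hR := soliton_pos R
  have h1 := soliton_le_one x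
  have h5 : soliton x ^ 5 ≤ soliton x ^ 2 := pow_le_pow_of_le_one hx.le h1 (by norm_num)
  have h6 : soliton x ^ 6 - 6 * soliton R * soliton x ^ 5 ≤ cutoff R x ^ 6 := by
    rcases le_total (soliton R) (soliton x) with h | h
    · rw [cutoff, max_eq_left (sub_nonneg.2 h)]
      have hb := one_add_mul_le_pow (a := -(soliton R / soliton x)) (by
        have : soliton R / soliton x ≤ 1 := (div_le_one hx).2 h
        linarith) 6
      have e : soliton x - soliton R = soliton x * (1 + -(soliton R / soliton x)) := by
        field_simp
        ring
      rw [e, mul_pow]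
      have := mul_le_mul_of_nonneg_left hb (pow_pos hx 6).le
      refine le_trans (le_of_eq ?_) this
      push_cast
      field_simp
      ring
    · have : soliton x ^ 6 ≤ soliton R * soliton x ^ 5 := by
        rw [pow_succ']; gcongr
      have h0 : 0 ≤ cutoff R x ^ 6 := by positivity
      have : 0 ≤ soliton R * soliton x ^ 5 := by positivity
      linarith
  have : soliton R * soliton x ^ 5 ≤ soliton R * soliton x ^ 2 := by gcongr
  linarith

theorem le_integral_cutoff_pow_six (R : ℝ) :
    π / 4 - 3 * π * soliton R ≤ ∫ x in Ioi 0, cutoff R x ^ 6 := by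
  have h : IntegrableOn (fun x => cutoff R x ^ 6) (Ioi 0) := by
    refine Integrable.mono' integrableOn_soliton_pow_six
      (((lipschitzWith_cutoff R).continuous.pow 6).aestronglyMeasurable) (ae_of_all _ fun x => ?_)
    rw [Real.norm_eq_abs, abs_of_nonneg (by positivity)]
    exact pow_le_pow_left₀ (cutoff_nonneg R x) (cutoff_le_soliton R x) 6
  have := integral_mono (integrableOn_soliton_pow_six.sub
    (integrableOn_soliton_sq.const_mul (6 * soliton R))) h
    fun x => soliton_pow_six_sub_le_cutoff R x
  rw [integral_sub' integrableOn_soliton_pow_six (integrableOn_soliton_sq.const_mul _),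
    integral_const_mul, integral_soliton_sq, integral_soliton_pow_six] at this
  linarith

/-- The truncated solitons are almost optimal. -/
theorem exists_cutoff_optimal {κ : ℝ} (hκ : κ < 16 / π ^ 2) (h0 : 0 ≤ κ) : ∃ R, 0 < R ∧
    κ * (∫ x in Ioi 0, cutoff R x ^ 2) ^ 2 * (∫ x in Ioi 0, deriv (cutoff R) x ^ 2) <
      ∫ x in Ioi 0, cutoff R x ^ 6 := by
  have hlim : Filter.Tendsto (fun R => π / 4 - 3 * π * soliton R) Filter.atTop (nhds (π / 4)) := by
    simpa using (tendsto_soliton.const_mul (3 * π)).const_sub (π / 4)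
  have hlt : κ * (π / 2) ^ 2 * (π / 16) < π / 4 := by
    rw [lt_div_iff₀ (by positivity)] at hκ
    have := pi_pos
    nlinarith
  obtain ⟨R, hR, hR0⟩ := ((hlim.eventually (lt_mem_nhds hlt)).and
    (Filter.eventually_gt_atTop 0)).exists
  refine ⟨R, hR0, lt_of_le_of_lt ?_ (hR.trans_le (le_integral_cutoff_pow_six R))⟩
  have h1 := integral_cutoff_sq_le R
  have h2 := integral_deriv_cutoff_le hR0.le
  have h3 : 0 ≤ ∫ x in Ioi 0, cutoff R x ^ 2 := by positivity
  have h4 : 0 ≤ ∫ x in Ioi 0, deriv (cutoff R) x ^ 2 := by positivity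
  gcongr

end Profile

/-! ### Concentration at the tip and spreading on a half-line. -/

namespace MetricGraph

variable {V E H : Type*} {G : MetricGraph V E H}

theorem EndAt.vertex_eq {i : E ⊕ H} {x : ℝ} {v w : V} (h : G.EndAt i x v) (h' : G.EndAt i x w) :
    v = w := by
  rcases i with e | k
  · have := G.len_pos e
    rcases h with ⟨h1, rfl⟩ | ⟨h1, rfl⟩ <;> rcases h' with ⟨h2, rfl⟩ | ⟨h2, rfl⟩
    · rfl
    · linarith
    · linarith
    · rfl
  · exact h.2.symm.trans h'.2

/-- Evenness covers both directions in which the tip edge may be parametrized; `R ≤ k * l` makes the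
rescaled profile fit inside the edge. -/
theorem integral_even_edge {Q : ℝ → ℝ} (hQ : ∀ x, Q (-x) = Q x) {R : ℝ}
    (hR : ∀ x, R < x → Q x = 0) {l x₀ : ℝ} (hl : 0 < l) (hx₀ : x₀ = 0 ∨ x₀ = l) {k : ℝ}
    (hk : 0 < k) (hkl : R ≤ k * l) :
    ∫ x in Set.Icc 0 l, Q (k * (x - x₀)) = k⁻¹ * ∫ x in Set.Ioi 0, Q x := by
  have key : ∫ x in (0 : ℝ)..l, Q (k * x) = k⁻¹ * ∫ x in Set.Ioi 0, Q x := by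
    rw [intervalIntegral.integral_comp_mul_left _ hk.ne', mul_zero, smul_eq_mul,
      intervalIntegral.integral_of_le (by positivity)]
    congr 1
    refine (setIntegral_eq_of_subset_of_forall_sdiff_eq_zero measurableSet_Ioi
      Set.Ioc_subset_Ioi_self fun x hx => hR x ?_).symm
    by_contra! h
    exact hx.2 ⟨hx.1, h.trans hkl⟩
  rw [integral_Icc_eq_integral_Ioc, ← intervalIntegral.integral_of_le hl.le, ← key]
  rcases hx₀ with rfl | rfl
  · simp_rw [sub_zero]
  · have := intervalIntegral.integral_comp_sub_left (fun x => Q (k * x)) (a := 0) (b := x₀) x₀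
    rw [sub_zero, sub_self] at this
    rw [← this]
    refine intervalIntegral.integral_congr fun x _ => ?_
    rw [← hQ]
    ring_nf

theorem deriv_scaled (f : ℝ → ℝ) (α k x₀ x : ℝ) :
    deriv (fun x => α * f (k * (x - x₀))) x = α * (k * deriv f (k * (x - x₀))) := by
  rw [deriv_const_mul_field, deriv_comp_sub_const (fun x => f (k * x)), deriv_comp_mul_left,
    smul_eq_mul]

theorem lipschitzWith_scaled {f : ℝ → ℝ} {K : ℝ≥0} (hf : LipschitzWith K f) (α k x₀ : ℝ) :
    LipschitzWith (‖α‖₊ * (K * ‖k‖₊)) fun x => α * f (k * (x - x₀)) := by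
  intro x y
  rw [edist_nndist, edist_nndist, ← ENNReal.coe_mul, ENNReal.coe_le_coe, ← NNReal.coe_le_coe]
  push_cast
  have h := hf.dist_le_mul (k * (x - x₀)) (k * (y - x₀))
  rw [Real.dist_eq, Real.dist_eq] at *
  rw [← mul_sub, sub_sub_sub_cancel_right, abs_mul] at h
  rw [← mul_sub, abs_mul, Real.norm_eq_abs, Real.norm_eq_abs, mul_assoc, mul_assoc]
  exact mul_le_mul_of_nonneg_left h (abs_nonneg α)

variable {𝕜 : Type*} [RCLike 𝕜] [Fintype E] [Fintype H]

variable (𝕜) in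
/-- Truncated solitons concentrated at the tip. -/
theorem exists_tip_function (hG : G.HasTip) {R : ℝ} (hR : 0 < R) : ∃ Λ > 0, ∀ k, Λ ≤ k → ∀ α : ℝ,
    ∃ u ∈ G.H1 𝕜, G.normPow 2 u = α ^ 2 / k * ∫ x in Set.Ioi 0, cutoff R x ^ 2 ∧
      G.normPow 6 u = α ^ 6 / k * ∫ x in Set.Ioi 0, cutoff R x ^ 6 ∧
      G.kinetic u = α ^ 2 * k * ∫ x in Set.Ioi 0, deriv (cutoff R) x ^ 2 := by
  obtain ⟨t, ht⟩ := hG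
  obtain ⟨i, x₀, hx₀, huniq⟩ := exists_unique_endAt_of_degree_eq_one ht
  -- On a bounded edge `Λ = R / len` keeps the far end out of the support; on a half-line any
  -- positive value works.
  obtain ⟨Λ, hΛ, hend, hint⟩ : ∃ Λ > 0, (∀ k, Λ ≤ k → ∀ x v, G.EndAt i x v →
      cutoff R (k * (x - x₀)) ≠ 0 → x = x₀) ∧
      ∀ k, Λ ≤ k → ∀ Q : ℝ → ℝ, (∀ x, Q (-x) = Q x) → (∀ x, R < x → Q x = 0) →
        ∫ x in G.interval i, Q (k * (x - x₀)) = k⁻¹ * ∫ x in Set.Ioi 0, Q x := by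
    rcases i with e | h
    · have hl := G.len_pos e
      have hkl : ∀ k, R / G.len e ≤ k → R ≤ k * G.len e := fun k hk => (div_le_iff₀ hl).1 hk
      have hx₀' : x₀ = 0 ∨ x₀ = G.len e := hx₀.imp (·.1) (·.1)
      refine ⟨R / G.len e, by positivity, fun k hk x v hx h0 => ?_, fun k hk Q hQ hQ0 =>
        integral_even_edge hQ hQ0 hl hx₀' (lt_of_lt_of_le (by positivity) hk) (hkl k hk)⟩
      by_contra hne
      refine h0 (cutoff_eq_zero hR.le ?_)
      have hk0 : 0 < k := lt_of_lt_of_le (by positivity) hk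
      have hx' : x = 0 ∨ x = G.len e := hx.imp (·.1) (·.1)
      have : |x - x₀| = G.len e := by
        rcases hx' with rfl | rfl <;> rcases hx₀' with rfl | rfl
        · exact absurd rfl hne
        · rw [zero_sub, abs_neg, abs_of_pos hl]
        · rw [sub_zero, abs_of_pos hl]
        · exact absurd rfl hne
      rw [abs_mul, this, abs_of_pos hk0]
      exact hkl k hk
    · have h0 : x₀ = 0 := hx₀.1
      refine ⟨1, one_pos, fun k hk x v hx _ => hx.1.trans h0.symm, fun k hk Q hQ hQ0 => ?_⟩
      rw [h0]
      simp_rw [sub_zero]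
      refine integral_Ici_eq_integral_Ioi.trans ?_
      rw [integral_comp_mul_left_Ioi _ _ (lt_of_lt_of_le one_pos hk), mul_zero, smul_eq_mul]
  refine ⟨Λ, hΛ, fun k hk α => ?_⟩
  have hk0 : 0 < k := hΛ.trans_le hk
  obtain ⟨u, hu, hp, hkin⟩ := exists_localized 𝕜 i
    (lipschitzWith_scaled (lipschitzWith_cutoff R) α k x₀) (fun x v hx h0 j y hj => by
      obtain rfl := hend k hk x v hx (right_ne_zero_of_mul h0)
      obtain rfl := hx.vertex_eq hx₀
      exact huniq j y hj)
    (HasCompactSupport.intro (isCompact_Icc (a := x₀ - R / k) (b := x₀ + R / k)) fun x hx => by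
      rw [cutoff_eq_zero hR.le, mul_zero]
      rw [abs_mul, abs_of_pos hk0, mul_comm, ← div_le_iff₀ hk0]
      by_contra! h
      rw [abs_lt] at h
      exact hx ⟨by linarith [h.1], by linarith [h.2]⟩)
  have hpow : ∀ p, p ≠ 0 → Even p → G.normPow p u =
      α ^ p / k * ∫ x in Set.Ioi 0, cutoff R x ^ p := by
    intro p hp0 hev
    rw [hp p hp0]
    simp_rw [hev.pow_abs, mul_pow]
    rw [integral_const_mul, hint k hk (fun x => cutoff R x ^ p) (fun x => by rw [cutoff_neg])
      (fun x hx => by rw [cutoff_eq_zero hR.le (hx.le.trans (le_abs_self x)), zero_pow hp0])]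
    ring
  refine ⟨u, hu, hpow 2 (by norm_num) (by decide), hpow 6 (by norm_num) (by decide), ?_⟩
  rw [hkin]
  simp_rw [deriv_scaled, mul_pow]
  rw [integral_const_mul, integral_const_mul, hint k hk (fun x => deriv (cutoff R) x ^ 2) (fun x => by
      have := deriv_comp_neg (cutoff R) x
      simp_rw [cutoff_neg] at this
      rw [this, neg_sq])
    (fun x hx => by
      rw [deriv_cutoff_of_gt hR.le (hx.trans_le (le_abs_self x)), zero_pow two_ne_zero])]
  field_simp

variable (𝕜) in
/-- Functions spreading out on a half-line. -/
theorem exists_spread_function [Nonempty H] {μ ε : ℝ} (hμ : 0 < μ) (hε : 0 < ε) :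
    ∃ u ∈ G.H1 𝕜, G.normPow 2 u = μ ∧ G.kinetic u < ε := by
  obtain ⟨h⟩ := ‹Nonempty H›
  -- A tent supported in `[0, 2]`: it vanishes at the origin of the half-line, so it extends by
  -- zero.
  set f : ℝ → ℝ := fun x => max (1 - |x - 1|) 0 with hf
  have hfl : LipschitzWith 1 f := by
    have h1 : LipschitzWith 1 fun x : ℝ => |x - 1| := by
      refine LipschitzWith.of_dist_le_mul fun x y => ?_
      rw [NNReal.coe_one, one_mul, Real.dist_eq, Real.dist_eq]
      refine (abs_abs_sub_abs_le _ _).trans (le_of_eq ?_)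
      rw [sub_sub_sub_cancel_right]
    have := (LipschitzWith.const (1 : ℝ)).sub h1
    rw [zero_add] at this
    exact this.max_const 0
  have hf0 : ∀ x, x ∉ Set.Icc 0 2 → f x = 0 := by
    intro x hx
    refine max_eq_right ?_
    by_contra! h
    have h' := abs_lt.1 (sub_pos.1 h)
    exact hx ⟨by linarith [h'.1], by linarith [h'.2]⟩
  have hf00 : f 0 = 0 := by simp [hf]
  have h01 : 0 < f 1 ^ 2 := by simp [hf]
  clear_value f
  set m := ∫ x in Set.Ioi 0, f x ^ 2 with hm
  have hm0 : 0 < m := by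
    have hc2 : HasCompactSupport fun x => f x ^ 2 :=
      HasCompactSupport.intro isCompact_Icc fun x hx => by rw [hf0 x hx, zero_pow two_ne_zero]
    have hi : IntegrableOn (fun x => f x ^ 2) (Set.Ioi 0) :=
      (Continuous.integrable_of_hasCompactSupport (hfl.continuous.pow 2) hc2).integrableOn
    refine lt_of_lt_of_le ?_ (intervalIntegral_le_Ioi hi (fun _ => by positivity) zero_le_one)
    exact intervalIntegral.integral_pos (f := fun x => f x ^ 2) one_pos
      (hfl.continuous.pow 2).continuousOn (fun x _ => sq_nonneg (f x))
      ⟨1, Set.right_mem_Icc.2 zero_le_one, h01⟩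
  set κ := ∫ x in Set.Ioi 0, deriv f x ^ 2 with hκ
  have hκ0 : 0 ≤ κ := by positivity
  obtain ⟨k, hk0, hk1, hkε⟩ : ∃ k : ℝ, 0 < k ∧ k ≤ 1 ∧ μ / m * κ * k < ε := by
    refine ⟨min 1 (ε / (μ / m * κ + 1)), by positivity, min_le_left _ _, ?_⟩
    have h1 := min_le_right 1 (ε / (μ / m * κ + 1))
    rw [le_div_iff₀ (by positivity)] at h1
    have h2 : 0 < min 1 (ε / (μ / m * κ + 1)) := by positivity
    linarith
  -- This amplitude keeps the mass equal to `μ`; the kinetic term is then `μ / m * κ * k²`.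
  set α := √(μ * k / m) with hα
  have hα2 : α ^ 2 = μ * k / m := Real.sq_sqrt (by positivity)
  obtain ⟨u, hu, hp, hkin⟩ := exists_localized (G := G) 𝕜 (Sum.inr h)
    (lipschitzWith_scaled hfl α k 0) (fun x v hx h0 => by
      obtain rfl : x = 0 := hx.1
      simp [hf00] at h0)
    (HasCompactSupport.intro (isCompact_Icc (a := 0) (b := 2 / k)) fun x hx => by
      rw [hf0, mul_zero]
      contrapose! hx
      rw [sub_zero] at hx
      exact ⟨nonneg_of_mul_nonneg_right hx.1 hk0, (le_div_iff₀' hk0).2 hx.2⟩)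
  have hint : ∀ Q : ℝ → ℝ, ∫ x in G.interval (Sum.inr h), Q (k * (x - 0)) =
      k⁻¹ * ∫ x in Set.Ioi 0, Q x := by
    intro Q
    simp_rw [sub_zero]
    refine integral_Ici_eq_integral_Ioi.trans ?_
    rw [integral_comp_mul_left_Ioi _ _ hk0, mul_zero, smul_eq_mul]
  refine ⟨u, hu, ?_, ?_⟩
  · rw [hp 2 two_ne_zero]
    simp_rw [sq_abs, mul_pow]
    rw [integral_const_mul, hint fun x => f x ^ 2, hα2, ← hm]
    field_simp
  · rw [hkin]
    simp_rw [deriv_scaled, mul_pow]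
    rw [integral_const_mul, integral_const_mul, hint fun x => deriv f x ^ 2, hα2, ← hκ]
    have : μ * k / m * (k ^ 2 * (k⁻¹ * κ)) = μ / m * κ * k * k := by field_simp
    rw [this]
    refine lt_of_le_of_lt (mul_le_of_le_one_right (by positivity) hk1) hkε

end MetricGraph

/-! ### Critical mass and energy levels. -/

namespace MetricGraph

open Real

variable {V E H : Type*} {G : MetricGraph V E H} {𝕜 : Type*} [RCLike 𝕜] [Fintype E] [Fintype H]

theorem gnConstant_le [Nonempty H] (G : MetricGraph V E H) :
    G.gnConstant 𝕜 ≤ ENNReal.ofReal (16 / π ^ 2) := by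
  refine iSup₂_le fun u hu => ENNReal.ofReal_le_ofReal ?_
  have h := gagliardo_nirenberg hu.1
  rcases (mul_nonneg (sq_nonneg (G.normPow 2 u)) (kinetic_nonneg u)).eq_or_lt with h0 | h0
  · rw [← h0, div_zero]; positivity
  · rw [div_le_div_iff₀ h0 (by positivity)]
    linarith

theorem gnConstant_eq [Nonempty H] (hG : G.HasTip) :
    G.gnConstant 𝕜 = ENNReal.ofReal (16 / π ^ 2) := by
  refine le_antisymm (gnConstant_le G) (le_of_forall_lt fun c hc => ?_)
  have hcr := ENNReal.ofReal_toReal hc.ne_top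
  rw [← hcr] at hc ⊢
  obtain ⟨R, hR, hopt⟩ := exists_cutoff_optimal ((ENNReal.ofReal_lt_ofReal_iff (by positivity)).1 hc)
    ENNReal.toReal_nonneg
  obtain ⟨k, hk, hu⟩ := exists_tip_function 𝕜 hG hR
  -- The quotient is invariant under scaling and amplitude, so any admissible pair will do.
  obtain ⟨u, hu, h2, h6, hkin⟩ := hu k le_rfl 1
  simp only [one_pow, one_mul] at h2 h6 hkin
  have hlt : c.toReal * (G.normPow 2 u ^ 2 * G.kinetic u) < G.normPow 6 u := by
    rw [h2, h6, hkin]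
    have := mul_lt_mul_of_pos_left hopt (one_div_pos.2 hk)
    refine lt_of_eq_of_lt ?_ this
    field_simp
  have hprod := mul_nonneg (sq_nonneg (G.normPow 2 u)) (kinetic_nonneg u)
  have hp6 : 0 < G.normPow 6 u :=
    lt_of_le_of_lt (mul_nonneg ENNReal.toReal_nonneg hprod) hlt
  have hpos : 0 < G.normPow 2 u ^ 2 * G.kinetic u := by
    have := gagliardo_nirenberg hu
    have : 0 < π ^ 2 * G.normPow 6 u := by positivity
    linarith
  have hu0 : u ≠ 0 := by
    rintro rfl
    simp [normPow] at hp6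
  refine lt_of_lt_of_le ?_ (le_iSup₂ (f := fun (u : G.Space → 𝕜)
    (_ : u ∈ {u | u ∈ G.H1 𝕜 ∧ u ≠ 0}) =>
      ENNReal.ofReal (G.normPow 6 u / (G.normPow 2 u ^ 2 * G.kinetic u))) u ⟨hu, hu0⟩)
  refine (ENNReal.ofReal_lt_ofReal_iff (by positivity)).2 ?_
  rwa [lt_div_iff₀ hpos]

theorem criticalMass_eq [Nonempty H] (hG : G.HasTip) : G.criticalMass 𝕜 = √3 * π / 4 := by
  rw [criticalMass, gnConstant_eq hG, ENNReal.toReal_div, ENNReal.toReal_ofReal (by positivity),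
    ENNReal.toReal_ofNat, show (3 : ℝ) / (16 / π ^ 2) = 3 * (π / 4) ^ 2 by field_simp; norm_num,
    sqrt_mul (by norm_num), sqrt_sq (by positivity)]
  ring

theorem hasTip_halfLine : halfLine.HasTip := by
  refine ⟨(), ?_⟩
  have h1 : Nat.card {e // halfLine.src e = ()} = 0 :=
    Nat.card_eq_zero.2 (Or.inl ⟨fun e => e.1.elim⟩)
  have h2 : Nat.card {e // halfLine.tgt e = ()} = 0 :=
    Nat.card_eq_zero.2 (Or.inl ⟨fun e => e.1.elim⟩)
  have h3 : Nat.card {h // halfLine.origin h = ()} = 1 :=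
    Nat.card_eq_one_iff_unique.2 ⟨⟨fun _ _ => Subtype.ext rfl⟩, ⟨⟨(), rfl⟩⟩⟩
  change Nat.card {e // halfLine.src e = ()} + Nat.card {e // halfLine.tgt e = ()} +
    Nat.card {h // halfLine.origin h = ()} = 1
  omega

variable (𝕜) in
theorem muHalfLine_eq : muHalfLine 𝕜 = √3 * π / 4 := criticalMass_eq hasTip_halfLine

theorem muHalfLine_sq : muHalfLine 𝕜 ^ 2 = 3 * π ^ 2 / 16 := by
  rw [muHalfLine_eq, div_pow, mul_pow, sq_sqrt (by norm_num)]
  norm_num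

theorem muHalfLine_pos : 0 < muHalfLine 𝕜 := by
  rw [muHalfLine_eq]; positivity

theorem energyLevel_eq_bot [Nonempty H] (hG : G.HasTip) {μ : ℝ} (hμ : muHalfLine 𝕜 < μ) :
    G.energyLevel 𝕜 μ = ⊥ := by
  have hμ0 : 0 < μ := muHalfLine_pos.trans hμ
  have hκ : 3 / μ ^ 2 < 16 / π ^ 2 := by
    have := pow_lt_pow_left₀ hμ muHalfLine_pos.le two_ne_zero
    rw [muHalfLine_sq] at this
    rw [div_lt_div_iff₀ (by positivity) (by positivity)]
    linarith
  obtain ⟨R, hR, hopt⟩ := exists_cutoff_optimal hκ (by positivity)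
  obtain ⟨Λ, hΛ, hex⟩ := exists_tip_function (G := G) 𝕜 hG hR
  set I := ∫ x in Set.Ioi 0, cutoff R x ^ 2 with hI
  set J := ∫ x in Set.Ioi 0, deriv (cutoff R) x ^ 2 with hJ
  set P := ∫ x in Set.Ioi 0, cutoff R x ^ 6 with hP
  have hJ0 : 0 ≤ J := by positivity
  have hI0 : 0 < I := by
    refine (show 0 ≤ I by positivity).lt_of_ne fun h => ?_
    obtain ⟨u, hu, h2, h6, -⟩ := hex Λ le_rfl 1
    have hgn := gagliardo_nirenberg hu
    rw [h2, ← h, h6] at hgn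
    rw [← h] at hopt
    have : 0 < π ^ 2 * (1 ^ 6 / Λ * P) := by
      have : 0 < P := by linarith
      positivity
    linarith
  -- With amplitude squared `μ * k / I` the mass is `μ` and the energy is `-k²C`; optimality of the
  -- cutoff for `3 / μ²` is exactly `C > 0`.
  set C := μ / (2 * I) * (μ ^ 2 * P / (3 * I ^ 2) - J) with hC
  have hC0 : 0 < C := by
    refine mul_pos (by positivity) (sub_pos.2 ?_)
    rw [lt_div_iff₀ (by positivity)]
    rw [div_mul_eq_mul_div, div_mul_eq_mul_div, div_lt_iff₀ (by positivity)] at hopt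
    linarith
  refine EReal.eq_bot_iff_forall_lt _ |>.2 fun M => ?_
  set k := Λ + |M| / C + 1 with hk
  have hk1 : 1 ≤ k := by have : 0 ≤ |M| / C := by positivity
                         linarith
  have hk0 : 0 < k := by linarith
  obtain ⟨u, hu, h2, h6, hkin⟩ := hex k (by have : 0 ≤ |M| / C := by positivity
                                            linarith) (√(μ * k / I))
  have hα2 : √(μ * k / I) ^ 2 = μ * k / I := sq_sqrt (by positivity)
  have hα6 : √(μ * k / I) ^ 6 = (μ * k / I) ^ 3 := by
    rw [show √(μ * k / I) ^ 6 = (√(μ * k / I) ^ 2) ^ 3 by ring, hα2]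
  have hmass : G.normPow 2 u = μ := by
    rw [h2, hα2]; field_simp
  have hen : G.energy u = -(k ^ 2 * C) := by
    rw [energy, hkin, h6, hα2, hα6, hC]
    field_simp
    ring
  refine lt_of_le_of_lt (iInf₂_le u ⟨hu, hmass⟩) ?_
  rw [hen, EReal.coe_lt_coe_iff]
  have h3 : |M| < k * C := by
    rw [← div_lt_iff₀ hC0]; linarith
  have h4 : k * C ≤ k ^ 2 * C :=
    mul_le_mul_of_nonneg_right (by nlinarith : k ≤ k ^ 2) hC0.le
  have := neg_abs_le M
  linarith

theorem energy_nonneg_of_critical [Nonempty H] {u : G.Space → 𝕜}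
    (hu : u ∈ G.H1Mass 𝕜 (muHalfLine 𝕜)) : 0 ≤ G.energy u := by
  have h := gagliardo_nirenberg hu.1
  rw [hu.2, muHalfLine_sq] at h
  have h' : π ^ 2 * G.normPow 6 u ≤ π ^ 2 * (3 * G.kinetic u) := by linarith
  have := le_of_mul_le_mul_left h' (by positivity)
  rw [energy]; linarith

theorem energyLevel_critical [Nonempty H] (G : MetricGraph V E H) :
    G.energyLevel 𝕜 (muHalfLine 𝕜) = 0 := by
  refine le_antisymm ?_ (le_iInf₂ fun u hu => EReal.coe_nonneg.2 (energy_nonneg_of_critical hu))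
  refine EReal.le_of_forall_lt_iff_le.1 fun ε hε => ?_
  obtain ⟨u, hu, h2, hk⟩ := exists_spread_function (G := G) 𝕜 (muHalfLine_pos (𝕜 := 𝕜))
    (EReal.coe_pos.1 hε)
  refine (iInf₂_le u ⟨hu, h2⟩).trans (EReal.coe_le_coe_iff.2 ?_)
  have := normPow_nonneg 6 u
  have := kinetic_nonneg u
  rw [energy]; linarith

theorem nonempty_isometryEquiv_of_attained [Nonempty H] (hG : G.HasTip) {u : G.Space → 𝕜}
    (hu : u ∈ G.H1Mass 𝕜 (muHalfLine 𝕜)) (h0 : G.energy u = 0) :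
    Nonempty (G.Space ≃ᵢ Set.Ici (0 : ℝ)) := by
  obtain ⟨h₀⟩ := ‹Nonempty H›
  obtain ⟨t, ht⟩ := hG
  obtain ⟨T⟩ := exists_spanningTree G (G.origin h₀)
  have := T.finite_vertices
  have := Fintype.ofFinite V
  obtain ⟨A, hA⟩ := T.exists_isFlow (edgeMass u)
  have hμ := muHalfLine_pos (𝕜 := 𝕜)
  -- This critical constant has square `1/3`, so zero energy is precisely equality in the
  -- calibration.
  have hm : π / 4 / muHalfLine 𝕜 * G.normPow 2 u = π / 4 := by
    rw [hu.2]; field_simp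
  have heq : G.kinetic u = (π / 4 / muHalfLine 𝕜) ^ 2 * G.normPow 6 u := by
    rw [div_pow, muHalfLine_sq]
    rw [energy] at h0
    field_simp
    linarith
  have := subsingleton_halfLines hu.1 hA hm heq
  exact nonempty_isometryEquiv_of_chain ht (head_injective hu.1 hA hm heq)

end MetricGraph

/-! ### Transplanting the half-soliton through an isometry. -/

namespace MetricGraph

open Real Topology

variable {V E H : Type*} {G : MetricGraph V E H}

theorem EndAt.interval_notMem_nhds {i : E ⊕ H} {x : ℝ} {v : V} (h : G.EndAt i x v) :
    G.interval i ∉ 𝓝 x := by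
  intro hx
  rcases i with e | k
  · have hx : Set.Icc 0 (G.len e) ∈ 𝓝 x := hx
    rcases h with ⟨rfl, -⟩ | ⟨rfl, -⟩
    · exact lt_irrefl _ (Icc_mem_nhds_iff.1 hx).1
    · exact lt_irrefl _ (Icc_mem_nhds_iff.1 hx).2
  · obtain rfl := h.1
    have hx : (0 : ℝ) ∈ interior (Set.Ici 0) := mem_interior_iff_mem_nhds.2 hx
    rw [interior_Ici] at hx
    exact lt_irrefl _ (Set.mem_Ioi.1 hx)

/-- A tent around the interior point extends to a `1`-Lipschitz function on the graph, which bounds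
distances from below without examining paths. -/
theorem exists_le_edist_chart {i : E ⊕ H} {x : ℝ} (hx : G.interval i ∈ 𝓝 x) :
    ∃ δ > 0, (∀ y ∈ G.interval i,
      ENNReal.ofReal (min δ |x - y|) ≤ edist (G.chart i x) (G.chart i y)) ∧
      ∀ j ≠ i, ∀ y, ENNReal.ofReal δ ≤ edist (G.chart i x) (G.chart j y) := by
  obtain ⟨δ, hδ, hball⟩ := Metric.mem_nhds_iff.1 hx
  have hg : LipschitzWith 1 fun y : ℝ => max (δ - |x - y|) 0 := by
    have h1 : LipschitzWith 1 fun y : ℝ => |x - y| := by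
      refine LipschitzWith.of_dist_le_mul fun a b => ?_
      rw [NNReal.coe_one, one_mul, Real.dist_eq, Real.dist_eq]
      refine (abs_abs_sub_abs_le _ _).trans (le_of_eq ?_)
      rw [sub_sub_sub_cancel_left, abs_sub_comm]
    have := (LipschitzWith.const δ).sub h1
    rw [zero_add] at this
    exact this.max_const 0
  obtain ⟨φ, hφ, h1, h2⟩ := exists_lipschitz_extension i one_ne_zero hg (fun y v hy h0 => by
    refine absurd (Filter.mem_of_superset (Metric.isOpen_ball.mem_nhds ?_) hball)
      hy.interval_notMem_nhds
    rw [Metric.mem_ball', Real.dist_eq]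
    by_contra! h
    exact h0 (max_eq_right (by linarith)))
  have hxx : φ (G.chart i x) = δ := by
    rw [h1 x (mem_of_mem_nhds hx), sub_self, abs_zero, sub_zero, max_eq_left hδ.le]
  have key : ∀ q, ENNReal.ofReal |δ - φ q| ≤ edist (G.chart i x) q := fun q => by
    have := hφ (G.chart i x) q
    rwa [ENNReal.coe_one, one_mul, hxx, edist_dist, Real.dist_eq] at this
  refine ⟨δ, hδ, fun y hy => (ENNReal.ofReal_le_ofReal ?_).trans (key _), fun j hj y => ?_⟩
  · rw [h1 y hy]
    refine le_trans ?_ (le_abs_self _)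
    rcases le_total δ |x - y| with h | h
    · rw [min_eq_left h, max_eq_right (by linarith)]; linarith
    · rw [min_eq_right h, max_eq_left (by linarith)]; linarith
  · have := key (G.chart j y)
    rwa [h2 j hj, sub_zero, abs_of_pos hδ] at this

section Isometry

variable (Φ : G.Space ≃ᵢ Set.Ici (0 : ℝ))

/-- The parametrization of an edge read through an isometry onto the half-line. -/
noncomputable def arcLength (i : E ⊕ H) (x : ℝ) : ℝ := (Φ (G.chart i x)).1

theorem ofReal_abs_arcLength_sub (i j : E ⊕ H) (x y : ℝ) :
    ENNReal.ofReal |arcLength Φ i x - arcLength Φ j y| = edist (G.chart i x) (G.chart j y) := by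
  rw [← Φ.isometry.edist_eq, Subtype.edist_eq, edist_dist, Real.dist_eq]
  rfl

theorem lipschitzWith_arcLength (i : E ⊕ H) : LipschitzWith 1 (arcLength Φ i) := by
  have := (LipschitzWith.subtype_val (Set.Ici (0 : ℝ))).comp
    (Φ.isometry.lipschitz.comp (lipschitzWith_chart i))
  rw [one_mul, one_mul] at this
  exact this

theorem exists_le_abs_arcLength_sub {i : E ⊕ H} {x : ℝ} (hx : G.interval i ∈ 𝓝 x) :
    ∃ δ > 0, (∀ y ∈ G.interval i, min δ |x - y| ≤ |arcLength Φ i x - arcLength Φ i y|) ∧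
      ∀ j ≠ i, ∀ y, δ ≤ |arcLength Φ i x - arcLength Φ j y| := by
  obtain ⟨δ, hδ, h1, h2⟩ := exists_le_edist_chart hx
  refine ⟨δ, hδ, fun y hy => ?_, fun j hj y => ?_⟩
  · have := h1 y hy
    rwa [← ofReal_abs_arcLength_sub Φ, ENNReal.ofReal_le_ofReal_iff (abs_nonneg _)] at this
  · have := h2 j hj y
    rwa [← ofReal_abs_arcLength_sub Φ, ENNReal.ofReal_le_ofReal_iff (abs_nonneg _)] at this

/-- Near an interior point the upper and lower distance bounds agree, so all slopes have absolute
value one. -/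
theorem abs_deriv_arcLength {i : E ⊕ H} {x : ℝ} (hx : G.interval i ∈ 𝓝 x)
    (hd : DifferentiableAt ℝ (arcLength Φ i) x) : |deriv (arcLength Φ i) x| = 1 := by
  obtain ⟨δ, hδ, h1, -⟩ := exists_le_abs_arcLength_sub Φ hx
  refine tendsto_nhds_unique ((hasDerivAt_iff_tendsto_slope.1 hd.hasDerivAt).abs)
    (tendsto_const_nhds.congr' ?_)
  filter_upwards [self_mem_nhdsWithin, mem_nhdsWithin_of_mem_nhds hx,
    mem_nhdsWithin_of_mem_nhds (Metric.ball_mem_nhds x hδ)] with y hne hy hyδ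
  rw [Metric.mem_ball', Real.dist_eq] at hyδ
  have hlow := h1 y hy
  rw [min_eq_right hyδ.le] at hlow
  have hup := (lipschitzWith_arcLength Φ i).dist_le_mul x y
  rw [NNReal.coe_one, one_mul, Real.dist_eq, Real.dist_eq] at hup
  have hpos : 0 < |x - y| := abs_pos.2 (sub_ne_zero.2 (Ne.symm hne))
  rw [slope_def_field, abs_div, abs_sub_comm, abs_sub_comm y, le_antisymm hup hlow,
    div_self hpos.ne']

/-- The interior points of an edge at which its image in the half-line is differentiable. -/
def regularPoints (i : E ⊕ H) : Set ℝ :=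
  {x | G.interval i ∈ 𝓝 x} ∩ {x | DifferentiableAt ℝ (arcLength Φ i) x}

theorem measurableSet_regularPoints (i : E ⊕ H) : MeasurableSet (regularPoints Φ i) := by
  have : {x | G.interval i ∈ 𝓝 x} = interior (G.interval i) :=
    Set.ext fun x => mem_interior_iff_mem_nhds.symm
  rw [regularPoints, this]
  exact isOpen_interior.measurableSet.inter (measurableSet_of_differentiableAt ℝ _)

theorem regularPoints_subset (i : E ⊕ H) : regularPoints Φ i ⊆ G.interval i :=
  fun _ hx => mem_of_mem_nhds hx.1

theorem measurableSet_interval (i : E ⊕ H) : MeasurableSet (G.interval i) := by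
  rcases i with e | h
  · exact measurableSet_Icc
  · exact measurableSet_Ici

theorem volume_interval_sdiff_regularPoints (i : E ⊕ H) :
    volume (G.interval i \ regularPoints Φ i) = 0 := by
  have h1 := (ae_restrict_iff' (measurableSet_interval i)).1 (ae_interval_mem_nhds (G := G) i)
  have h2 := (lipschitzWith_arcLength Φ i).ae_differentiableAt (μ := volume)
  refine measure_mono_null (t := {x | ¬ (x ∈ G.interval i → x ∈ regularPoints Φ i)})
    (fun x hx h => hx.2 (h hx.1)) ?_
  filter_upwards [h1, h2] with x hx1 hx2 hx using ⟨hx1 hx, hx2⟩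

theorem regularPoints_ae_eq (i : E ⊕ H) : regularPoints Φ i =ᵐ[volume] G.interval i :=
  (regularPoints_subset Φ i).eventuallyLE.antisymm
    (ae_le_set.2 (volume_interval_sdiff_regularPoints Φ i))

theorem injOn_arcLength (i : E ⊕ H) : Set.InjOn (arcLength Φ i) (regularPoints Φ i) := by
  intro x hx y hy hxy
  obtain ⟨δ, hδ, h1, -⟩ := exists_le_abs_arcLength_sub Φ hx.1
  have := h1 y (regularPoints_subset Φ i hy)
  rw [hxy, sub_self, abs_zero] at this
  by_contra hne
  exact absurd this (not_le.2 (lt_min hδ (abs_pos.2 (sub_ne_zero.2 hne))))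

theorem disjoint_image_arcLength {i j : E ⊕ H} (hij : i ≠ j) :
    Disjoint (arcLength Φ i '' regularPoints Φ i) (arcLength Φ j '' regularPoints Φ j) := by
  refine Set.disjoint_left.2 ?_
  rintro _ ⟨x, hx, rfl⟩ ⟨y, -, hxy⟩
  obtain ⟨δ, hδ, -, h2⟩ := exists_le_abs_arcLength_sub Φ hx.1
  have := h2 j hij.symm y
  rw [hxy, sub_self, abs_zero] at this
  exact absurd this (not_le.2 hδ)

theorem volume_image_eq_zero {f : ℝ → ℝ} (hf : LipschitzWith 1 f) {s : Set ℝ}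
    (hs : volume s = 0) : volume (f '' s) = 0 := by
  rw [← hausdorffMeasure_real] at hs ⊢
  have := hf.hausdorffMeasure_image_le zero_le_one s
  rwa [hs, mul_zero, nonpos_iff_eq_zero] at this

/-- The images of all edges cover the half-line, and a `1`-Lipschitz map sends the discarded null
sets to null sets. With injectivity and disjointness the edges tile the half-line up to measure
zero. -/
theorem iUnion_image_ae_eq [Finite E] [Finite H] :
    (⋃ i, arcLength Φ i '' regularPoints Φ i) =ᵐ[volume] Set.Ici (0 : ℝ) := by
  refine Filter.EventuallyLE.antisymm (LE.le.eventuallyLE ?_) (ae_le_set.2 ?_)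
  · refine Set.iUnion_subset fun i => ?_
    rintro _ ⟨x, -, rfl⟩
    exact (Φ (G.chart i x)).2
  · refine measure_mono_null (t := ⋃ i, arcLength Φ i '' (G.interval i \ regularPoints Φ i)) ?_
      (measure_iUnion_null fun i => volume_image_eq_zero (lipschitzWith_arcLength Φ i)
        (volume_interval_sdiff_regularPoints Φ i))
    rintro y ⟨hy, hn⟩
    obtain ⟨q, hq⟩ := Φ.surjective ⟨y, hy⟩
    obtain ⟨p, rfl⟩ := SeparationQuotient.surjective_mk q
    rw [mk_eq_chart] at hq
    have hval : arcLength Φ p.edge p.coord = y := congrArg Subtype.val hq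
    refine Set.mem_iUnion.2 ⟨p.edge, p.coord, ⟨p.mem, fun hreg => hn ?_⟩, hval⟩
    exact Set.mem_iUnion.2 ⟨p.edge, p.coord, hreg, hval⟩

theorem measurableSet_image_arcLength (i : E ⊕ H) :
    MeasurableSet (arcLength Φ i '' regularPoints Φ i) :=
  (measurableSet_regularPoints Φ i).image_of_continuousOn_injOn
    (lipschitzWith_arcLength Φ i).continuous.continuousOn (injOn_arcLength Φ i)

theorem hasDerivWithinAt_arcLength {i : E ⊕ H} {x : ℝ} (hx : x ∈ regularPoints Φ i) :
    HasDerivWithinAt (arcLength Φ i) (deriv (arcLength Φ i) x) (regularPoints Φ i) x :=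
  hx.2.hasDerivAt.hasDerivWithinAt

theorem integral_comp_arcLength (i : E ⊕ H) (F : ℝ → ℝ) :
    ∫ x in G.interval i, F (arcLength Φ i x) =
      ∫ y in arcLength Φ i '' regularPoints Φ i, F y := by
  rw [integral_image_eq_integral_abs_deriv_smul (measurableSet_regularPoints Φ i)
    (fun x hx => hasDerivWithinAt_arcLength Φ hx) (injOn_arcLength Φ i),
    ← setIntegral_congr_set (regularPoints_ae_eq Φ i)]
  refine setIntegral_congr_fun (measurableSet_regularPoints Φ i) fun x hx => ?_
  simp only [abs_deriv_arcLength Φ hx.1 hx.2, one_smul]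

theorem integrableOn_comp_arcLength [Finite E] [Finite H] (i : E ⊕ H) {F : ℝ → ℝ}
    (hF : IntegrableOn F (Set.Ioi 0)) :
    IntegrableOn (fun x => F (arcLength Φ i x)) (G.interval i) := by
  rw [← integrableOn_congr_set_ae (regularPoints_ae_eq Φ i)]
  have h1 : IntegrableOn F (arcLength Φ i '' regularPoints Φ i) := by
    rw [← integrableOn_Ici_iff_integrableOn_Ioi,
      ← integrableOn_congr_set_ae (iUnion_image_ae_eq Φ)] at hF
    exact hF.mono_set (Set.subset_iUnion (fun i => arcLength Φ i '' regularPoints Φ i) i)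
  rw [integrableOn_image_iff_integrableOn_abs_deriv_smul (measurableSet_regularPoints Φ i)
    (fun x hx => hasDerivWithinAt_arcLength Φ hx) (injOn_arcLength Φ i)] at h1
  refine h1.congr_fun (fun x hx => ?_) (measurableSet_regularPoints Φ i)
  simp only [abs_deriv_arcLength Φ hx.1 hx.2, one_smul]

theorem ae_norm_deriv_comp_arcLength {𝕜 : Type*} [RCLike 𝕜] (i : E ⊕ H) {f : ℝ → ℝ}
    (hf : Differentiable ℝ f) : ∀ᵐ x ∂(volume.restrict (G.interval i)),
      ‖deriv (fun y => (f (arcLength Φ i y) : 𝕜)) x‖ = |deriv f (arcLength Φ i x)| := by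
  rw [← Measure.restrict_congr_set (regularPoints_ae_eq Φ i),
    ae_restrict_iff' (measurableSet_regularPoints Φ i)]
  refine ae_of_all _ fun x hx => ?_
  have h : HasDerivAt (fun y => f (arcLength Φ i y)) _ x :=
    (hf _).hasDerivAt.comp x hx.2.hasDerivAt
  rw [norm_deriv_ofReal_comp, RCLike.norm_ofReal, h.deriv, abs_mul, abs_deriv_arcLength Φ hx.1 hx.2,
    mul_one]

variable [Fintype E] [Fintype H]

/-- An isometry onto the half-line preserves integrals. -/
theorem sum_integral_comp_arcLength {F : ℝ → ℝ} (hF : IntegrableOn F (Set.Ioi 0)) :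
    ∑ i, ∫ x in G.interval i, F (arcLength Φ i x) = ∫ x in Set.Ioi 0, F x := by
  simp_rw [integral_comp_arcLength]
  rw [← integral_Ici_eq_integral_Ioi, ← setIntegral_congr_set (iUnion_image_ae_eq Φ),
    integral_iUnion_fintype (measurableSet_image_arcLength Φ)
      fun i j hij => disjoint_image_arcLength Φ hij]
  intro i
  rw [← integrableOn_Ici_iff_integrableOn_Ioi,
    ← integrableOn_congr_set_ae (iUnion_image_ae_eq Φ)] at hF
  exact hF.mono_set (Set.subset_iUnion (fun i => arcLength Φ i '' regularPoints Φ i) i)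

variable (𝕜 : Type*) [RCLike 𝕜]

/-- The transplanted half-soliton attains the energy level at the critical mass. -/
theorem exists_energy_eq_zero (Φ : G.Space ≃ᵢ Set.Ici (0 : ℝ)) :
    ∃ u ∈ G.H1Mass 𝕜 (muHalfLine 𝕜), G.energy u = 0 := by
  -- The condition `α² * (π / 2) = √3 * π / 4` fixes the mass; then `α⁴ = 3/4` balances the two
  -- energy terms.
  set α := √(√3 / 2) with hα
  have hα2 : α ^ 2 = √3 / 2 := sq_sqrt (by positivity)
  have h3 : √3 ^ 2 = (3 : ℝ) := sq_sqrt (by norm_num)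
  set f : ℝ → ℝ := fun x => α * soliton x with hf
  have hfd : Differentiable ℝ f := fun x =>
    ((hasDerivAt_soliton x).differentiableAt.const_mul α)
  have hfl : LipschitzWith (‖α‖₊ * 1) f := by
    refine LipschitzWith.of_dist_le_mul fun x y => ?_
    have := lipschitzWith_soliton.dist_le_mul x y
    rw [hf, Real.dist_eq, ← mul_sub, abs_mul, NNReal.coe_mul, coe_nnnorm, Real.norm_eq_abs,
      mul_assoc]
    exact mul_le_mul_of_nonneg_left this (abs_nonneg α)
  have hint2 : IntegrableOn (fun x => f x ^ 2) (Set.Ioi 0) := by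
    simp_rw [hf, mul_pow]
    exact integrableOn_soliton_sq.const_mul _
  have hint6 : IntegrableOn (fun x => f x ^ 6) (Set.Ioi 0) := by
    simp_rw [hf, mul_pow]
    exact integrableOn_soliton_pow_six.const_mul _
  have hder : ∀ x, deriv f x = α * deriv soliton x := fun x => deriv_const_mul_field α
  have hintd : IntegrableOn (fun x => deriv f x ^ 2) (Set.Ioi 0) := by
    simp_rw [hder, mul_pow]
    exact integrableOn_deriv_soliton_sq.const_mul _
  set u : G.Space → 𝕜 := fun p => ((f (Φ p).1 : ℝ) : 𝕜) with hu
  have huc : ∀ i x, u (G.chart i x) = ((f (arcLength Φ i x) : ℝ) : 𝕜) := fun _ _ => rfl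
  have hlip : ∀ i, LipschitzWith (1 * (‖α‖₊ * 1 * 1)) fun x => u (G.chart i x) := fun i =>
    LipschitzWith.comp (g := fun x => f (arcLength Φ i x)) (f := ((↑) : ℝ → 𝕜))
      (RCLike.ofRealLI (K := 𝕜)).lipschitz (hfl.comp (lipschitzWith_arcLength Φ i))
  have hnp : ∀ p, Even p → IntegrableOn (fun x => f x ^ p) (Set.Ioi 0) →
      G.normPow p u = ∫ x in Set.Ioi 0, f x ^ p := by
    intro p hp hi
    rw [← sum_integral_comp_arcLength Φ hi, normPow]
    simp_rw [huc, RCLike.norm_ofReal, hp.pow_abs]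
  have haed : ∀ i, ∀ᵐ x ∂(volume.restrict (G.interval i)),
      ‖deriv (fun y => u (G.chart i y)) x‖ ^ 2 = deriv f (arcLength Φ i x) ^ 2 := fun i => by
    filter_upwards [ae_norm_deriv_comp_arcLength (𝕜 := 𝕜) Φ i hfd] with x hx
    simp_rw [huc]
    rw [hx, sq_abs]
  have hkin : G.kinetic u = ∫ x in Set.Ioi 0, deriv f x ^ 2 := by
    rw [← sum_integral_comp_arcLength Φ hintd, kinetic]
    exact Finset.sum_congr rfl fun i _ => integral_congr_ae (haed i)
  have h2 : G.normPow 2 u = α ^ 2 * (π / 2) := by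
    rw [hnp 2 (by decide) hint2, ← integral_soliton_sq, ← integral_const_mul]
    simp_rw [hf, mul_pow]
  have h6 : G.normPow 6 u = α ^ 6 * (π / 4) := by
    rw [hnp 6 (by decide) hint6, ← integral_soliton_pow_six, ← integral_const_mul]
    simp_rw [hf, mul_pow]
  have hk : G.kinetic u = α ^ 2 * (π / 16) := by
    rw [hkin, ← integral_deriv_soliton_sq, ← integral_const_mul]
    simp_rw [hder, mul_pow]
  refine ⟨u, ⟨⟨?_, fun i => ⟨fun a _ b _ => (hlip i).lipschitzOnWith.absolutelyContinuousOnInterval,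
    ?_, ?_⟩⟩, ?_⟩, ?_⟩
  · exact RCLike.continuous_ofReal.comp
      (hfl.continuous.comp (continuous_subtype_val.comp Φ.continuous))
  · refine (memLp_two_iff_integrable_sq_norm (hlip i).continuous.aestronglyMeasurable).2 ?_
    simp_rw [huc, RCLike.norm_ofReal, sq_abs]
    exact integrableOn_comp_arcLength Φ i hint2
  · refine (memLp_two_iff_integrable_sq_norm (measurable_deriv _).aestronglyMeasurable).2 ?_
    exact (integrableOn_comp_arcLength Φ i hintd).congr
      ((haed i).mono fun x hx => hx.symm)
  · rw [h2, hα2, muHalfLine_eq]; ring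
  · have hα6 : α ^ 6 = 3 / 4 * α ^ 2 := by
      rw [show α ^ 6 = (α ^ 2) ^ 2 * α ^ 2 by ring, hα2, div_pow, h3]; norm_num
    rw [energy, hk, h6, hα6]; ring

end Isometry

end MetricGraph

theorem mainTheorem5 {𝕜 : Type*} [RCLike 𝕜] {V E H : Type*} [Fintype E] [Fintype H] [Nonempty H]
    (G : MetricGraph V E H) (hG : G.HasTip) :
    G.criticalMass 𝕜 = MetricGraph.muHalfLine 𝕜 ∧
    (∀ μ ∈ Set.Ioc (MetricGraph.muHalfLine 𝕜) (MetricGraph.muRealLine 𝕜),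
      G.energyLevel 𝕜 μ = ⊥) ∧
    G.energyLevel 𝕜 (MetricGraph.muHalfLine 𝕜) = 0 ∧
    ((∃ u ∈ G.H1Mass 𝕜 (MetricGraph.muHalfLine 𝕜),
        (G.energy u : EReal) = G.energyLevel 𝕜 (MetricGraph.muHalfLine 𝕜)) ↔
      Nonempty (G.Space ≃ᵢ Set.Ici (0 : ℝ))) := by
  refine ⟨(MetricGraph.criticalMass_eq hG).trans (MetricGraph.muHalfLine_eq 𝕜).symm,
    fun μ hμ => MetricGraph.energyLevel_eq_bot hG hμ.1, MetricGraph.energyLevel_critical G, ?_⟩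
  simp_rw [MetricGraph.energyLevel_critical G, EReal.coe_eq_zero]
  exact ⟨fun ⟨_, hu, h0⟩ => MetricGraph.nonempty_isometryEquiv_of_attained hG hu h0,
    fun ⟨Φ⟩ => MetricGraph.exists_energy_eq_zero 𝕜 Φ⟩
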